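/- **Definitions.** An *exponential field* is a field $F$ of characteristic zero with a group homomorphism $\exp:(F,+)\to(F^\times,\cdot)$; write $\ker_F=\{x\in F:\exp(x)=1\}$. It is an *ELA-field* if $F$ is algebraically closed and $\exp$ maps onto $F^\times$. For an ELA-field $F$ and $A\subseteq F$, let $\langle A\rangle^{\mathrm{ELA}}_F$ be the intersection of all ELA-subfields of $F$ containing $A\cup\ker_F$. A *kernel type* is (the isomorphism type of) an ELA-field $K$ with $K=\langle\emptyset\rangle^{\mathrm{ELA}}_K$, and $F$ has kernel type $K$ if $\langle\emptyset\rangle^{\mathrm{ELA}}_F\cong K$ as exponential fields. An embedding $f:F_1\to F_2$ of exponential fields is *kernel-preserving* if $\ker_{F_2}\subseteq f(F_1)$. Let $\mathbf{ELAF}_{K,\mathrm{kp}}$ be the concrete category of ELA-fields with kernel type $K$ and kernel-preserving embeddings. For $A,B,C\subseteq F$ put $A\perp^{\mathrm{td}}_C B$ iff $\operatorname{td}(D/B\cup C)=\operatorname{td}(D/C)$ for all finite $D\subseteq A$, and define *ELA-independence* by $$A\perp^{\mathrm{ELA},F}_C B\iff \langle A\cup C\rangle^{\mathrm{ELA}}_F\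 \perp^{\mathrm{td}}_{\langle C\rangle^{\mathrm{ELA}}_F}\ \langle B\cup C\rangle^{\mathrm{ELA}}_F .$$ An *independence relation* on a concrete category $\mathcal C$ is a ternary relation $A\perp^M_C B$ on subsets of each object $M$ which satisfies, on every $M$: *Normality* ($A\perp_C B\Rightarrow A\perp_C B\cup C$), *Existence* ($A\perp_C C$), *Monotonicity* ($A\perp_C B$, $D\subseteq B\Rightarrow A\perp_C D$), *Transitivity* ($C\subseteq D$, $A\perp_C D$, $A\perp_D B\Rightarrow A\perp_C B$), *Symmetry* ($A\perp_C B\Rightarrow B\perp_C A$), *Finite Character* (if $D\perp_C B$ for all finite $D\subseteq A$ then $A\perp_C B$); and also *Invariance*: $A\perp^M_C B\iff f(A)\perp^N_{f(C)}f(B)$ for every arrow $f:M\to N$. In an abstract elementary class (AEC) with amalgamation, tuples $a_i\in M_i$ ($i=1,2$) have the same Galois type if there are arrows $g_i:M_i\to N$ with $g_1(a_1)=g_2(a_2)$. An independence relation on such an AEC is *NSOP$_1$-like* if moreover: * *Club Local Character* holds for some regular cardinal $\lambda$: for every model $M$, finite $A\subseteq M$ and $B\subseteq M$ there is a family $\mathcal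 B$ of subsets of $B$ of size $<\lambda$ which is unbounded (every subset of $B$ of size $<\lambda$ is contained in a member of $\mathcal B$) and closed (under unions of chains of length $\gamma$, $0<\gamma<\lambda$), such that $A\perp^M_{B_0}B$ for all $B_0\in\mathcal B$. * *Extension*: if $a$ is a (possibly infinite) tuple with $a\perp^M_C B$ and $B\subseteq B'\subseteq M$, there are an extension $M\hookrightarrow N$ in $\mathcal C$ and $a'\in N$ with $a'\perp^N_C B'$ and $\mathrm{gtp}(a'/B\cup C;N)=\mathrm{gtp}(a/B\cup C;M)$. * *3-amalgamation*: given arrows $M\to M_i$ ($1\le i\le3$) and $M_i\to M_{ij}$, $M_j\to M_{ij}$ ($1\le i<j\le 3$) forming a commuting diagram with $M_1\perp^{M_{12}}_M M_2$, $M_2\perp^{M_{23}}_M M_3$, $M_3\perp^{M_{13}}_M M_1$, there are $N$ and arrows $M_{ij}\to N$ making the whole diagram commute with $M_1\perp^N_M M_{23}$. It is *simple* if in addition *Base-Monotonicity* holds: if $A\perp_C B$ and $C\subseteq D\subseteq B$ then $A\perp_D B$. **Theorem.** Let $K$ be a kernel type. Then $\mathbf{ELAF}_{K,\mathrm{kp}}$,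 in the language $\langle +,\cdot,-,0,1,\exp\rangle$, is an AEC with amalgamation, and ELA-independence is an NSOP$_1$-like independence relation on it. Club Local Character holds with $\lambda=|\ker_K|^+$. Base-Monotonicity fails, so ELA-independence is not a simple independence relation on $\mathbf{ELAF}_{K,\mathrm{kp}}$. -/

import Mathlib

universe u v w

namespace ELA

open CategoryTheory CategoryTheory.Limits FirstOrder Cardinal

/-! ### Independence relations on a structure -/

/-- A ternary relation on the subsets of `M` is an independence relation if it has the six basic
properties.  Here `I A B C` reads: `A` is independent from `B` over `C`. -/
structure IsIndependenceOn {M : Type w} (I : Set M → Set M → Set M → Prop) : Prop where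
  normality : ∀ A B C, I A B C → I A (B ∪ C) C
  existence : ∀ A C, I A C C
  monotonicity : ∀ A B C D, I A B C → D ⊆ B → I A D C
  transitivity : ∀ A B C D, C ⊆ D → I A D C → I A B D → I A B C
  symmetry : ∀ A B C, I A B C → I B A C
  finite_character : ∀ A B C, (∀ D, D ⊆ A → D.Finite → I D B C) → I A B C

/-- `ℬ` is a clubset of `[X]^{<lam}`.  Chains are indexed by nonzero ordinals `γ < lam`. -/
structure IsClub {M : Type w} (X : Set M) (lam : Cardinal.{w}) (ℬ : Set (Set M)) : Prop where
  subset : ∀ Y ∈ ℬ, Y ⊆ X ∧ #Y < lam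
  unbounded : ∀ Z, Z ⊆ X → #Z < lam → ∃ Y ∈ ℬ, Z ⊆ Y
  closed : ∀ γ : Ordinal.{w}, γ ≠ 0 → γ < lam.ord → ∀ Y : Ordinal.{w} → Set M,
    (∀ i < γ, Y i ∈ ℬ) → (∀ i j, i ≤ j → j < γ → Y i ⊆ Y j) → (⋃ i < γ, Y i) ∈ ℬ

/-! ### Independence relations on a concrete category -/

section Concrete

variable {C : Type u} [Category.{v} C] {FC : C → C → Type*} {CC : C → Type w}
  [∀ X Y, FunLike (FC X Y) (CC X) (CC Y)] [ConcreteCategory C FC]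

variable (C) in
/-- A ternary relation on the subsets of every object. -/
abbrev TernaryRelation : Type (max u w) :=
  ∀ M : C, Set (ToType M) → Set (ToType M) → Set (ToType M) → Prop

/-- An independence relation on a concrete category: an independence relation on each object,
subject to Invariance under all arrows. -/
structure IsIndependenceRelation (I : TernaryRelation C) : Prop where
  basic : ∀ M : C, IsIndependenceOn (I M)
  invariance : ∀ {M N : C} (f : M ⟶ N) (A B D : Set (ToType M)),
    I M A B D ↔ I N (f '' A) (f '' B) (f '' D)

def BaseMonotonicity (I : TernaryRelation C) : Prop :=
  ∀ (M : C) (A B D E : Set (ToType M)), I M A B D → D ⊆ E → E ⊆ B → I M A B E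

/-- Two (possibly infinite) tuples have the same Galois type. -/
def SameGaloisType {M₁ M₂ : C} {ι : Type w} (a₁ : ι → ToType M₁) (a₂ : ι → ToType M₂) : Prop :=
  ∃ (N : C) (g₁ : M₁ ⟶ N) (g₂ : M₂ ⟶ N), ∀ i, g₁ (a₁ i) = g₂ (a₂ i)

/-- Club Local Character with the cardinal `lam`. -/
def ClubLocalCharacter (I : TernaryRelation C) (lam : Cardinal.{w}) : Prop :=
  lam.IsRegular ∧ ∀ (M : C) (A B : Set (ToType M)), A.Finite →
    ∃ ℬ : Set (Set (ToType M)), IsClub B lam ℬ ∧ ∀ B₀ ∈ ℬ, I M A B B₀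

/-- Extension.  The Galois types over `B ∪ D` are those of the concatenations of the tuples `a'`
and `a` with an enumeration of `B ∪ D` (regarded as a subset of `N` via `f`). -/
def Extension (I : TernaryRelation C) : Prop :=
  ∀ (M : C) (ι : Type w) (a : ι → ToType M) (B B' D : Set (ToType M)),
    I M (Set.range a) B D → B ⊆ B' →
    ∃ (N : C) (f : M ⟶ N) (a' : ι → ToType N),
      I N (Set.range a') (f '' B') (f '' D) ∧
      SameGaloisType (Sum.elim a' fun x : ↥(B ∪ D) => f (x : ToType M))
        (Sum.elim a fun x : ↥(B ∪ D) => (x : ToType M))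

def ThreeAmalgamation (I : TernaryRelation C) : Prop :=
  ∀ (M M₁ M₂ M₃ M₁₂ M₁₃ M₂₃ : C)
    (f₁ : M ⟶ M₁) (f₂ : M ⟶ M₂) (f₃ : M ⟶ M₃)
    (p₁ : M₁ ⟶ M₁₂) (p₂ : M₂ ⟶ M₁₂)
    (q₁ : M₁ ⟶ M₁₃) (q₃ : M₃ ⟶ M₁₃)
    (r₂ : M₂ ⟶ M₂₃) (r₃ : M₃ ⟶ M₂₃),
    f₁ ≫ p₁ = f₂ ≫ p₂ → f₁ ≫ q₁ = f₃ ≫ q₃ → f₂ ≫ r₂ = f₃ ≫ r₃ →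
    I M₁₂ (Set.range p₁) (Set.range p₂) (Set.range (f₁ ≫ p₁)) →
    I M₂₃ (Set.range r₂) (Set.range r₃) (Set.range (f₂ ≫ r₂)) →
    I M₁₃ (Set.range q₃) (Set.range q₁) (Set.range (f₃ ≫ q₃)) →
    ∃ (N : C) (g₁₂ : M₁₂ ⟶ N) (g₁₃ : M₁₃ ⟶ N) (g₂₃ : M₂₃ ⟶ N),
      p₁ ≫ g₁₂ = q₁ ≫ g₁₃ ∧ p₂ ≫ g₁₂ = r₂ ≫ g₂₃ ∧ q₃ ≫ g₁₃ = r₃ ≫ g₂₃ ∧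
      I N (Set.range (p₁ ≫ g₁₂)) (Set.range g₂₃) (Set.range (f₁ ≫ p₁ ≫ g₁₂))

structure IsNSOP1Like (I : TernaryRelation C) : Prop where
  indep : IsIndependenceRelation I
  club_local_character : ∃ lam : Cardinal.{w}, ClubLocalCharacter I lam
  extension : Extension I
  three_amalgamation : ThreeAmalgamation I

structure IsSimple (I : TernaryRelation C) : Prop extends IsNSOP1Like I where
  base_monotonicity : BaseMonotonicity I

/-! ### Abstract elementary classes -/

variable (C) in
def HasAmalgamation : Prop :=
  ∀ {A B B' : C} (f : A ⟶ B) (f' : A ⟶ B'),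
    ∃ (D : C) (g : B ⟶ D) (g' : B' ⟶ D), f ≫ g = f' ≫ g'

variable (C) in
/-- A concrete category whose objects carry `L`-structures is an abstract elementary class.
Inclusions of models are replaced by arrows.  Accordingly, closure under unions of (nonempty)
chains says that each chain has a colimit whose underlying set is the union of the images. -/
structure IsAEC (L : Language) [∀ M : C, L.Structure (ToType M)] : Prop where
  arrow_embedding : ∀ {M N : C} (f : M ⟶ N), ∃ g : ToType M ↪[L] ToType N, ∀ x, g x = f x
  iso_closed_obj : ∀ (A : C) (B : Type w) [L.Structure B], (ToType A ≃[L] B) →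
    ∃ A' : C, (Bundled.of (c := L.Structure) (ToType A')) = Bundled.of (c := L.Structure) B
  iso_closed_arrow : ∀ {A A' : C} (e : ToType A ≃[L] ToType A'), ∃ f : A ⟶ A', ∀ x, f x = e x
  coherence : ∀ {A B D : C} (f : A ⟶ D) (g : B ⟶ D), Set.range f ⊆ Set.range g →
    ∃ h : A ⟶ B, h ≫ g = f
  union_of_chain : ∀ (J : Type w) [LinearOrder J] [WellFoundedLT J] [Nonempty J] (F : J ⥤ C),
    ∃ c : Cocone F, Nonempty (IsColimit c) ∧ ∀ x : ToType c.pt, ∃ j, x ∈ Set.range (c.ι.app j)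
  lowenheim_skolem : ∃ κ : Cardinal.{w}, ℵ₀ ≤ κ ∧ ∀ (A : C) (S : Set (ToType A)),
    ∃ (B : C) (f : B ⟶ A), S ⊆ Set.range f ∧ #(ToType B) ≤ #S + κ

end Concrete

/-! ### Exponential fields -/

/-- A field of characteristic zero with a homomorphism from its additive group to its
multiplicative group. -/
class ExpField (F : Type u) extends Field F where
  charZero : CharZero F
  expHom : Multiplicative F →* Fˣ

attribute [instance] ExpField.charZero

section ExpField

variable {F : Type u} [ExpField F]

/-- The exponential map, valued in the field. -/
def exp (x : F) : F := (ExpField.expHom (F := F) (Multiplicative.ofAdd x) : Fˣ)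

variable (F) in
/-- The kernel of the exponential map. -/
def ker : Set F := {x | exp x = 1}

variable (F) in
structure IsELAField : Prop where
  algClosed : IsAlgClosed F
  log : ∀ y : F, y ≠ 0 → ∃ x, exp x = y

/-- `B` is, with the restriction of `exp`, an ELA-field. -/
structure IsELASubfield (B : Subfield F) : Prop where
  exp_mem : ∀ x ∈ B, exp x ∈ B
  algClosed : IsAlgClosed B
  log : ∀ y ∈ B, y ≠ 0 → ∃ x ∈ B, exp x = y

/-- The intersection of all ELA-subfields containing `A` and the kernel. -/
def elaClosure (A : Set F) : Subfield F := sInf {B | IsELASubfield B ∧ A ∪ ker F ⊆ B}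

end ExpField

/-- The transcendence degree of `D` over the subfield generated by `C`. -/
noncomputable def td {F : Type u} [Field F] (D C : Set F) : Cardinal.{u} :=
  Algebra.trdeg (Subfield.closure C) (IntermediateField.adjoin (Subfield.closure C) D)

/-- Field-theoretic algebraic independence of `A` from `B` over `C`. -/
def TdIndep {F : Type u} [Field F] (A B C : Set F) : Prop :=
  ∀ D, D ⊆ A → D.Finite → td D (B ∪ C) = td D C

/-- ELA-independence of `A` from `B` over `C` in `F`. -/
def ElaIndep {F : Type u} [ExpField F] (A B C : Set F) : Prop :=
  TdIndep (elaClosure (A ∪ C) : Set F) (elaClosure (B ∪ C)) (elaClosure C)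

/-- Embeddings of exponential fields. -/
structure ExpEmb (F₁ : Type u) (F₂ : Type v) [ExpField F₁] [ExpField F₂] extends F₁ →+* F₂ where
  map_exp : ∀ x, toFun (exp x) = exp (toFun x)

/-- Kernel-preserving embeddings: every kernel element of the codomain is in the image. -/
structure KPEmb (F₁ : Type u) (F₂ : Type v) [ExpField F₁] [ExpField F₂]
    extends ExpEmb F₁ F₂ where
  ker_subset : ker F₂ ⊆ Set.range toFun

/-- `K` is a kernel type: an ELA-field that is the ELA-closure of (its kernel and) the empty set.
Up to isomorphism these are exactly the ELA-closures of the empty set in ELA-fields. -/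
structure IsKernelType (K : Type u) [ExpField K] : Prop where
  isELA : IsELAField K
  closure_empty : elaClosure (∅ : Set K) = ⊤

/-- `F` has kernel type `K`: the ELA-closure of the empty set in `F` is isomorphic to `K`. -/
def HasKernelType (F : Type u) (K : Type v) [ExpField F] [ExpField K] : Prop :=
  ∃ f : ExpEmb K F, Set.range f.toFun = elaClosure (∅ : Set F)

instance {F₁ : Type u} {F₂ : Type v} [ExpField F₁] [ExpField F₂] :
    FunLike (KPEmb F₁ F₂) F₁ F₂ where
  coe f := f.toFun
  coe_injective f g h := by
    obtain ⟨⟨f, _⟩, _⟩ := f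
    obtain ⟨⟨g, _⟩, _⟩ := g
    obtain rfl : f = g := DFunLike.coe_injective h
    rfl

def KPEmb.id (F : Type u) [ExpField F] : KPEmb F F where
  toRingHom := RingHom.id F
  map_exp _ := rfl
  ker_subset x _ := ⟨x, rfl⟩

def KPEmb.comp {F₁ F₂ F₃ : Type u} [ExpField F₁] [ExpField F₂] [ExpField F₃]
    (g : KPEmb F₂ F₃) (f : KPEmb F₁ F₂) : KPEmb F₁ F₃ where
  toRingHom := g.toRingHom.comp f.toRingHom
  map_exp x := (congrArg g.toFun (f.map_exp x)).trans (g.map_exp (f.toFun x))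
  ker_subset z hz := by
    obtain ⟨y, rfl⟩ := g.ker_subset hz
    have hy : y ∈ ker F₂ := by
      have h : g.toRingHom (exp y) = g.toRingHom 1 := by
        rw [map_one]
        exact (g.map_exp y).trans hz
      exact g.toRingHom.injective h
    obtain ⟨x, rfl⟩ := f.ker_subset hy
    exact ⟨x, rfl⟩

/-! ### The category of ELA-fields with kernel type `K` -/

/-- ELA-fields with kernel type `K`. -/
structure ELAF (K : Type u) [ExpField K] : Type (u + 1) where
  carrier : Type u
  [expField : ExpField carrier]
  isELA : IsELAField carrier
  kernelType : HasKernelType carrier K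

attribute [instance] ELAF.expField

variable {K : Type u} [ExpField K]

instance : Category (ELAF K) where
  Hom M N := KPEmb M.carrier N.carrier
  id M := KPEmb.id M.carrier
  comp f g := g.comp f

instance : ConcreteCategory (ELAF K) (fun M N => KPEmb M.carrier N.carrier)
    (CC := ELAF.carrier) where
  hom f := f
  ofHom f := f
  id_apply _ := rfl
  comp_apply _ _ _ := rfl

/-- ELA-independence as a ternary relation on the objects of the category. -/
def elaIndep (K : Type u) [ExpField K] : TernaryRelation (ELAF K) :=
  fun _ A B C => ElaIndep A B C

/-! ### The language of exponential rings -/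

inductive ExpRingFunc : ℕ → Type
  | add : ExpRingFunc 2
  | mul : ExpRingFunc 2
  | neg : ExpRingFunc 1
  | zero : ExpRingFunc 0
  | one : ExpRingFunc 0
  | exp : ExpRingFunc 1

def expRing : Language where
  Functions := ExpRingFunc
  Relations _ := Empty

instance (M : ELAF K) : expRing.Structure (ToType M) where
  funMap {_} s x := match s, x with
    | .add, x => (x 0 + x 1 : M.carrier)
    | .mul, x => (x 0 * x 1 : M.carrier)
    | .neg, x => (-x 0 : M.carrier)
    | .zero, _ => (0 : M.carrier)
    | .one, _ => (1 : M.carrier)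
    | .exp, x => (exp (x 0) : M.carrier)
  RelMap r := r.elim

end ELA

/-! ELA-independence is algebraic independence of ELA-closed fields over an ELA-closed base, so the
basic properties come from the pregeometry of algebraic closure (`tdIndep_iff_ind`); symmetry is the
exchange property. Two logarithms of an element differ by a kernel element, hence kernel-preserving
embeddings commute with ELA-closure (`KPEmb.image_elaClosure`), which gives Invariance. Closing a
small subset of `B` off under finite witnesses of dependence gives Club Local Character
(`exists_club`).

New objects are all built by one device. In a large algebraically closed field `Ω` a partial
exponential is given by homomorphisms `i : P → (Ω, +)` and `e : P → Ωˣ` on a small rational vector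
space `P`, where `i p = 0` forces `e p = 1` and all roots of unity are values of `e`. A complement
of `i(P)` in `Ω` and one of `e(P)` in `Ωˣ` are rational vector spaces of dimension `#Ω`; an
isomorphism between them extends the partial map to a surjective exponential without new kernel
(`exists_exp_extension`, `exists_completion`).

To amalgamate a diagram one therefore places the fields as freely as possible in `Ω`, lets `P` be
their product, and shows that a sum vanishes, or a product equals one, only for the reasons dictated
by the diagram. For two fields this says that they meet in the base, which gives amalgamation and
Extension. For the triangle in 3-amalgamation it is `exists_add_and_exists_mul_of_ind`: if `u + v`
lies in `N₁₂` with `u` in `N₁₃` and `v` in `N₂₃`, a specialization that fixes `N₁₂` sends `u` into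
`N₁` and `v` into `N₂`, so the sum already comes from the vertices; the same holds for products.

Base-Monotonicity fails because the same device can impose an equation `exp(αγ) = α + β`, where `α`
comes from one copy of a large field, `β` and `γ` from another, and the copies are independent over
`K`. Then `α` is independent from `{β, γ}` over the empty set, but over `γ` the closure of `α`
captures `β`. -/

namespace ELA

open Cardinal AlgebraicIndependent

/-! ### The pregeometry of relative algebraic closure, and independence in it. -/

section Acl

set_option linter.unusedSectionVars false

variable {F : Type u} [Field F] [CharZero F]

/-- The relative algebraic closure in `F` of the field generated by `S`. -/
def acl (S : Set F) : Subfield F where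
  toSubring := (Subalgebra.algebraicClosure (Algebra.adjoin ℤ S) F).toSubring
  inv_mem' _ hx := IsAlgebraic.inv hx

theorem mem_acl {S : Set F} {x : F} : x ∈ acl S ↔ IsAlgebraic (Algebra.adjoin ℤ S) x := Iff.rfl

theorem matroid_closure_eq_acl (S : Set F) : (matroid ℤ F).closure S = acl S :=
  matroid_closure_eq

theorem subset_acl (S : Set F) : S ⊆ acl S := by
  rw [← matroid_closure_eq_acl]
  exact (matroid ℤ F).subset_closure S (Set.subset_univ _)

theorem acl_mono {S T : Set F} (h : S ⊆ T) : (acl S : Set F) ⊆ acl T := by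
  rw [← matroid_closure_eq_acl, ← matroid_closure_eq_acl]
  exact (matroid ℤ F).closure_subset_closure h

theorem acl_subset_iff {S T : Set F} : (acl S : Set F) ⊆ acl T ↔ S ⊆ acl T := by
  refine ⟨fun h => (subset_acl S).trans h, fun h => ?_⟩
  rw [← matroid_closure_eq_acl, ← matroid_closure_eq_acl] at *
  exact (matroid ℤ F).closure_subset_closure_of_subset_closure h

theorem isAlgebraic_of_subset {R T : Type*} [SetLike R F] [SubringClass R F] [SetLike T F]
    [SubringClass T F] {r : R} {t : T} (h : (r : Set F) ⊆ t) {x : F} (hx : IsAlgebraic r x) :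
    IsAlgebraic t x := by
  obtain ⟨p, hp, hpx⟩ := hx
  let i : r →+* t :=
    { toFun := fun y => ⟨y, h y.2⟩
      map_one' := rfl
      map_mul' := fun _ _ => rfl
      map_zero' := rfl
      map_add' := fun _ _ => rfl }
  have hi : Function.Injective i := fun a b hab => Subtype.ext (congrArg (fun z : t => (z : F)) hab)
  refine ⟨p.map i, (Polynomial.map_ne_zero_iff hi).2 hp, ?_⟩
  rw [Polynomial.aeval_def, Polynomial.eval₂_map]
  exact hpx

theorem mem_acl_of_isAlgebraic {R : Type*} [SetLike R F] [SubringClass R F] {r : R} {S : Set F}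
    (h : (r : Set F) ⊆ acl S) {x : F} (hx : IsAlgebraic r x) : x ∈ acl S := by
  have h1 : IsAlgebraic (Algebra.adjoin ℤ (acl S : Set F)) x :=
    isAlgebraic_of_subset (h.trans Algebra.subset_adjoin) hx
  have h2 : x ∈ acl (acl S : Set F) := h1
  have h3 : (acl (acl S : Set F) : Set F) ⊆ acl S := acl_subset_iff.2 le_rfl
  exact h3 h2

theorem closure_subset_acl (S : Set F) : (Subfield.closure S : Set F) ⊆ acl S :=
  (Subfield.closure_le (t := acl S)).2 (subset_acl S)

theorem adjoin_subset_closure (S : Set F) :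
    (Algebra.adjoin ℤ S : Set F) ⊆ Subfield.closure S := by
  let A : Subalgebra ℤ F := subalgebraOfSubring (Subfield.closure S).toSubring
  exact (Algebra.adjoin_le (S := A) Subfield.subset_closure : Algebra.adjoin ℤ S ≤ A)

theorem mem_acl_iff {S : Set F} {x : F} : x ∈ acl S ↔ IsAlgebraic (Subfield.closure S) x :=
  ⟨fun h => isAlgebraic_of_subset (adjoin_subset_closure S) (mem_acl.1 h),
    fun h => mem_acl_of_isAlgebraic (closure_subset_acl S) h⟩

theorem acl_eq_of_isAlgClosed (B : Subfield F) [IsAlgClosed B] : acl (B : Set F) = B := by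
  apply SetLike.coe_injective
  refine Set.Subset.antisymm (fun x hx => ?_) (subset_acl _)
  have h : IsAlgebraic B x := by
    have := mem_acl_iff.1 hx
    rwa [Subfield.closure_eq] at this
  obtain ⟨y, hy⟩ := minpoly.mem_range_of_degree_eq_one B x
    (IsAlgClosed.degree_eq_one_of_irreducible B (minpoly.irreducible h.isIntegral))
  rw [← hy]
  exact y.2

theorem isAlgClosed_acl [IsAlgClosed F] (S : Set F) : IsAlgClosed (acl S) := by
  refine IsAlgClosed.of_exists_root _ fun p hp hp' => ?_
  have hd : (p.map (algebraMap (acl S) F)).degree ≠ 0 := by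
    rw [Polynomial.degree_map]
    exact ne_of_gt (Polynomial.degree_pos_of_irreducible hp')
  obtain ⟨x, hx⟩ := IsAlgClosed.exists_root _ hd
  have hx' : x ∈ acl S := by
    refine mem_acl_of_isAlgebraic (r := acl S) le_rfl ⟨p, hp.ne_zero, ?_⟩
    rwa [Polynomial.IsRoot, Polynomial.eval_map_algebraMap] at hx
  refine ⟨⟨x, hx'⟩, ?_⟩
  apply (algebraMap (acl S) F).injective
  rw [map_zero, ← hx.eq_zero, Polynomial.eval_map_algebraMap]
  exact (Polynomial.aeval_algebraMap_apply F (⟨x, hx'⟩ : acl S) p).symm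

/-- `X` is algebraically independent over (the field generated by) `C`. -/
def IndepOver (C X : Set F) : Prop := ∀ x ∈ X, x ∉ acl (C ∪ X \ {x})

/-- This makes bases, exchange and finite character available from matroid theory. The ground set of
the contraction omits `C`; correspondingly `IndepOver` excludes elements of `C`. -/
theorem indepOver_iff_matroid {C X : Set F} :
    IndepOver C X ↔ (Matroid.contract (matroid ℤ F) C).Indep X := by
  constructor
  · intro h
    have hE : X ⊆ (Matroid.contract (matroid ℤ F) C).E :=
      fun x hx => ⟨trivial, fun hC => h x hx (subset_acl _ (Or.inl hC))⟩
    rw [Matroid.indep_iff_forall_notMem_closure_sdiff hE]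
    intro e he
    rw [Matroid.contract_closure_eq, matroid_closure_eq_acl, Set.union_comm]
    exact fun h' => h e he h'.1
  · intro h x hx hx'
    have hE := h.subset_ground
    have := (Matroid.indep_iff_forall_notMem_closure_sdiff hE).1 h hx
    rw [Matroid.contract_closure_eq, matroid_closure_eq_acl, Set.union_comm] at this
    exact this ⟨hx', (hE hx).2⟩

theorem IndepOver.mono_left {C D X : Set F} (h : IndepOver D X) (hCD : C ⊆ acl D) :
    IndepOver C X := fun x hx hx' => h x hx (acl_subset_iff.2 (Set.union_subset
      (hCD.trans (acl_mono Set.subset_union_left))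
      (Set.subset_union_right.trans (subset_acl _))) hx')

theorem IndepOver.mono_right {C X Y : Set F} (h : IndepOver C X) (hY : Y ⊆ X) :
    IndepOver C Y := fun x hx hx' => h x (hY hx)
      (acl_mono (Set.union_subset_union_right _ (Set.sdiff_subset_sdiff_left hY)) hx')

theorem IndepOver.notMem {C X : Set F} (h : IndepOver C X) {x : F} (hx : x ∈ X) : x ∉ acl C :=
  fun hx' => h x hx (acl_mono Set.subset_union_left hx')

theorem indepOver_singleton {C : Set F} {x : F} : IndepOver C {x} ↔ x ∉ acl C := by
  simp [IndepOver]

theorem indepOver_union_iff {C X Y : Set F} (hd : Disjoint X Y) :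
    IndepOver C (X ∪ Y) ↔ IndepOver C X ∧ IndepOver (C ∪ X) Y := by
  have key : IndepOver C X → (IndepOver C (X ∪ Y) ↔ IndepOver (C ∪ X) Y) := by
    intro h
    have := (indepOver_iff_matroid.1 h).union_indep_iff_contract_indep (J := Y)
    rw [← indepOver_iff_matroid, Matroid.contract_contract, ← indepOver_iff_matroid,
      hd.symm.sdiff_eq_left] at this
    exact this
  exact ⟨fun h => ⟨h.mono_right Set.subset_union_left,
    (key (h.mono_right Set.subset_union_left)).1 h⟩, fun h => (key h.1).2 h.2⟩

theorem indepOver_of_finite {C X : Set F} (h : ∀ Y ⊆ X, Y.Finite → IndepOver C Y) :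
    IndepOver C X := by
  rw [indepOver_iff_matroid, Matroid.indep_iff_forall_finite_subset_indep]
  exact fun Y hY hf => indepOver_iff_matroid.1 (h Y hY hf)

theorem exists_indepOver_extension {C X A : Set F} (h : IndepOver C X) (hX : X ⊆ A) :
    ∃ Y, X ⊆ Y ∧ Y ⊆ A ∧ IndepOver C Y ∧ A ⊆ acl (C ∪ Y) := by
  obtain ⟨Y, hY, hXY⟩ := (indepOver_iff_matroid.1 h).subset_isBasis'_of_subset hX
  refine ⟨Y, hXY, hY.subset, indepOver_iff_matroid.2 hY.indep, fun a ha => ?_⟩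
  by_cases haC : a ∈ C
  · exact subset_acl _ (Or.inl haC)
  · have : a ∈ (Matroid.contract (matroid ℤ F) C).closure Y := by
      rw [hY.closure_eq_closure]
      exact Matroid.mem_closure_of_mem' _ ha ⟨trivial, haC⟩
    rw [Matroid.contract_closure_eq, matroid_closure_eq_acl, Set.union_comm] at this
    exact this.1

theorem exists_indepOver_basis (C A : Set F) :
    ∃ Y ⊆ A, IndepOver C Y ∧ A ⊆ acl (C ∪ Y) := by
  obtain ⟨Y, -, h⟩ := exists_indepOver_extension (C := C) (X := ∅) (A := A)
    (fun x hx => hx.elim) (Set.empty_subset _)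
  exact ⟨Y, h⟩

theorem adjoin_int_union_subset (L : Subfield F) (Y : Set F) :
    (Algebra.adjoin ℤ ((L : Set F) ∪ Y) : Set F) ⊆ Algebra.adjoin L Y := by
  intro y hy
  induction hy using Algebra.adjoin_induction with
  | mem x hx =>
    rcases hx with h | h
    · exact (Algebra.adjoin L Y).algebraMap_mem ⟨x, h⟩
    · exact Algebra.subset_adjoin h
  | algebraMap r => exact intCast_mem _ r
  | add x y _ _ hx hy => exact add_mem hx hy
  | mul x y _ _ hx hy => exact mul_mem hx hy

theorem algebraicIndepOn_iff_indepOver (L : Subfield F) (X : Set F) :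
    AlgebraicIndependent L ((↑) : X → F) ↔ IndepOver (L : Set F) X := by
  have h1 : AlgebraicIndependent L ((↑) : X → F) ↔ (matroid L F).Indep X := Iff.rfl
  rw [h1, Matroid.indep_iff_forall_notMem_closure_sdiff (Set.subset_univ _)]
  refine forall₂_congr fun x hx => not_congr ?_
  rw [matroid_closure_eq]
  have h2 : ∀ Y : Set F, (Algebra.adjoin L Y : Set F) ⊆ acl ((L : Set F) ∪ Y) := by
    intro Y y hy
    induction hy using Algebra.adjoin_induction with
    | mem x hx => exact subset_acl _ (Or.inr hx)
    | algebraMap r => exact subset_acl _ (Or.inl r.2)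
    | add x y _ _ hx hy => exact (acl _).add_mem hx hy
    | mul x y _ _ hx hy => exact (acl _).mul_mem hx hy
  exact ⟨fun h => mem_acl_of_isAlgebraic (h2 _) h,
    fun h => isAlgebraic_of_subset (adjoin_int_union_subset L _) (mem_acl.1 h)⟩

/-- Independence of `A` from `B` over `C` in the pregeometry of algebraic closure. -/
def Ind (A B C : Set F) : Prop := ∀ X ⊆ A, IndepOver C X → IndepOver (B ∪ C) X

theorem Ind.mono {A B C A' B' : Set F} (h : Ind A B C) (hA : A' ⊆ A) (hB : B' ⊆ acl (B ∪ C)) :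
    Ind A' B' C := fun X hX hC => (h X (hX.trans hA) hC).mono_left
      (Set.union_subset hB (Set.subset_union_right.trans (subset_acl _)))

/-- Algebraic independence is base monotone with `A` fixed. ELA-independence does not inherit this,
since enlarging the base also enlarges the ELA-closure of the left side. -/
theorem Ind.base {A B C D : Set F} (h : Ind A B C) (hC : C ⊆ acl D) (hD : D ⊆ acl (B ∪ C)) :
    Ind A B D := fun X hX hX' => (h X hX (hX'.mono_left hC)).mono_left
      (Set.union_subset (Set.subset_union_left.trans (subset_acl _)) hD)

theorem Ind.trans {A B C D : Set F} (h : Ind A D C) (h' : Ind A B D) (hC : C ⊆ acl D) :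
    Ind A B C := fun X hX hX' =>
  (h' X hX ((h X hX hX').mono_left (Set.subset_union_left.trans (subset_acl _)))).mono_left
    (Set.union_subset (Set.subset_union_left.trans (subset_acl _))
      (hC.trans (acl_mono Set.subset_union_right)))

/-- This is exchange, the source of symmetry. If `Y ⊆ B` is independent over `C`, then `S` is
independent over `C ∪ Y`, so `Y ∪ S` is independent over `C`, so `Y` is independent over `C ∪ S` and
hence over `A ∪ C`. -/
theorem ind_of_basis {A B C S : Set F} (hA : A ⊆ acl (C ∪ S)) (hS : IndepOver (B ∪ C) S) :
    Ind B A C := by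
  intro Y hY hYC
  have hSY : IndepOver (C ∪ Y) S := hS.mono_left (Set.union_subset
    (Set.subset_union_right.trans (subset_acl _))
    ((hY.trans Set.subset_union_left).trans (subset_acl _)))
  have hd : Disjoint Y S := Set.disjoint_left.2 fun x hx hx' =>
    hSY.notMem hx' (subset_acl _ (Or.inr hx))
  have h := ((indepOver_union_iff hd).2 ⟨hYC, hSY⟩)
  rw [Set.union_comm] at h
  exact ((indepOver_union_iff hd.symm).1 h).2.mono_left
    (Set.union_subset hA (Set.subset_union_left.trans (subset_acl _)))

theorem Ind.symm {A B C : Set F} (h : Ind A B C) : Ind B A C := by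
  obtain ⟨S, hSA, hS, hA⟩ := exists_indepOver_basis C A
  exact ind_of_basis hA (h S hSA hS)

theorem Ind.acl_left {A B C : Set F} (h : Ind A B C) : Ind (acl (A ∪ C)) B C :=
  (h.symm.mono (A' := B) (B' := acl (A ∪ C)) le_rfl le_rfl).symm

theorem Ind.acl_base {A B C D : Set F} (h : Ind A B C) (hD : acl D = acl C) : Ind A B D :=
  fun X hX hX' => (h X hX (hX'.mono_left (hD ▸ subset_acl _))).mono_left
    (Set.union_subset (Set.subset_union_left.trans (subset_acl _))
      ((hD ▸ subset_acl D : D ⊆ acl C).trans (acl_mono Set.subset_union_right)))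

theorem Ind.inter_subset {A B C : Set F} (h : Ind A B C) : A ∩ B ⊆ acl C := by
  rintro x ⟨hA, hB⟩
  by_contra hx
  exact indepOver_singleton.1 (h {x} (Set.singleton_subset_iff.2 hA) (indepOver_singleton.2 hx))
    (subset_acl _ (Or.inl hB))

theorem ind_of_finite {A B C : Set F} (h : ∀ X ⊆ A, X.Finite → Ind X B C) : Ind A B C :=
  fun _ hX hX' => indepOver_of_finite fun Y hY hf =>
    h Y (hY.trans hX) hf Y le_rfl (hX'.mono_right hY)

/-- Left transitivity. -/
theorem Ind.trans_left {A B C D : Set F} (h : Ind A B D) (h' : Ind D B C) (hC : C ⊆ acl D) :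
    Ind A B C := (h'.symm.trans h.symm hC).symm

theorem indepOver_closure_iff {C X : Set F} :
    IndepOver (Subfield.closure C : Set F) X ↔ IndepOver C X :=
  ⟨fun h => h.mono_left (Subfield.subset_closure.trans (subset_acl _)),
    fun h => h.mono_left (closure_subset_acl C)⟩

theorem td_eq_mk {C D I : Set F} (hI : I ⊆ D) (hC : IndepOver C I) (hD : D ⊆ acl (C ∪ I)) :
    td D C = #I := by
  set k := Subfield.closure C with hk
  set E := IntermediateField.adjoin k D with hE
  have hinj : Function.Injective E.val := Subtype.val_injective
  have hEsub : (E : Set F) ⊆ acl (C ∪ I) := by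
    intro y hy
    induction hy using IntermediateField.adjoin_induction with
    | mem x hx => exact hD hx
    | algebraMap r => exact acl_mono Set.subset_union_left (closure_subset_acl C r.2)
    | add x y _ _ hx hy => exact (acl _).add_mem hx hy
    | mul x y _ _ hx hy => exact (acl _).mul_mem hx hy
    | inv x _ hx => exact (acl _).inv_mem hx
  let x : I → E := fun i => ⟨i, IntermediateField.subset_adjoin k D (hI i.2)⟩
  have hx : AlgebraicIndependent k x := by
    rw [← E.val.algebraicIndependent_iff hinj]
    exact (algebraicIndepOn_iff_indepOver k I).2 (indepOver_closure_iff.2 hC)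
  have hb : IsTranscendenceBasis k x := by
    refine ⟨hx, fun s hs hxs => ?_⟩
    refine Set.Subset.antisymm hxs fun y hy => ?_
    have hs' : AlgebraicIndependent k ((↑) : (E.val '' s : Set F) → F) := by
      have := ((E.val.algebraicIndependent_iff hinj).2 hs).to_subtype_range
      refine this.mono ?_
      rintro _ ⟨z, hz, rfl⟩
      exact ⟨⟨z, hz⟩, rfl⟩
    have hs2 := indepOver_closure_iff.1 ((algebraicIndepOn_iff_indepOver k _).1 hs')
    by_contra hyI
    refine hs2 (E.val y) ⟨y, hy, rfl⟩ (acl_mono (Set.union_subset_union_right _ ?_) (hEsub y.2))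
    intro i hi
    refine ⟨⟨x ⟨i, hi⟩, hxs ⟨_, rfl⟩, rfl⟩, fun h => hyI ⟨⟨i, hi⟩, hinj h⟩⟩
  exact hb.cardinalMk_eq_trdeg.symm

/-- Transcendence degrees detect independence of finite sets: a basis `I ⊆ Y` over `B ∪ C` with as
many elements as the finite set `Y` is all of `Y`. -/
theorem tdIndep_iff_ind {A B C : Set F} : TdIndep A B C ↔ Ind A B C := by
  constructor
  · refine fun h => ind_of_finite fun X hX hf Y hY hYC => ?_
    obtain ⟨I, hIY, hI, hYI⟩ := exists_indepOver_basis (B ∪ C) Y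
    have h1 := h Y (hY.trans hX) (hf.subset hY)
    rw [td_eq_mk hIY hI hYI, td_eq_mk le_rfl hYC
      (Set.subset_union_right.trans (subset_acl _))] at h1
    have hfY := hf.subset hY
    have h2 : I = Y := by
      refine Set.eq_of_subset_of_ncard_le hIY ?_ hfY
      rw [Set.ncard_def, Set.ncard_def, Set.encard, Set.encard, ENat.card, ENat.card, h1]
    exact h2 ▸ hI
  · intro h D hD _
    obtain ⟨I, hID, hI, hDI⟩ := exists_indepOver_basis C D
    rw [td_eq_mk hID hI hDI, td_eq_mk hID (h I (hID.trans hD) hI)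
      (hDI.trans (acl_mono (Set.union_subset_union_left _ Set.subset_union_right)))]

end Acl

end ELA

namespace ELA

open Cardinal AlgebraicIndependent

/-! ### Finite character, cardinality and field embeddings for algebraic closure. -/

section AclMore

set_option linter.unusedSectionVars false

variable {F : Type u} [Field F] [CharZero F]

theorem isAlgClosed_iff_acl [IsAlgClosed F] (B : Subfield F) :
    IsAlgClosed B ↔ (acl (B : Set F) : Set F) ⊆ B := by
  refine ⟨fun h => by rw [acl_eq_of_isAlgClosed B], fun h => ?_⟩
  have : acl (B : Set F) = B := SetLike.coe_injective (h.antisymm (subset_acl _))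
  rw [← this]
  exact isAlgClosed_acl _

theorem exists_finite_of_mem_acl {S : Set F} {x : F} (h : x ∈ acl S) :
    ∃ T ⊆ S, T.Finite ∧ x ∈ acl T := by
  have h' : x ∈ (matroid ℤ F).closure S := by rwa [matroid_closure_eq_acl]
  obtain ⟨T, hT, hf, -, hx⟩ := Matroid.exists_mem_finite_closure_of_mem_closure h'
  rw [matroid_closure_eq_acl] at hx
  exact ⟨T, hT, hf, hx⟩

theorem exists_mem_acl_of_directed {ι : Type*} [Nonempty ι] {S : ι → Set F}
    (hS : Directed (· ⊆ ·) S) {T : Set F} {x : F} (hx : x ∈ acl ((⋃ i, S i) ∪ T)) :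
    ∃ i, x ∈ acl (S i ∪ T) := by
  obtain ⟨D, hD, hf, hx⟩ := exists_finite_of_mem_acl hx
  have h : ∀ y : (D \ T : Set F), ∃ i, (y : F) ∈ S i := fun y =>
    Set.mem_iUnion.1 ((hD y.2.1).resolve_right y.2.2)
  choose g hg using h
  have := (hf.subset (Set.sdiff_subset (t := T))).to_subtype
  obtain ⟨i, hi⟩ := hS.finite_le g
  refine ⟨i, acl_mono (fun y hy => ?_) hx⟩
  by_cases hyT : y ∈ T
  · exact Or.inr hyT
  · exact Or.inl (hi ⟨y, hy, hyT⟩ (hg ⟨y, hy, hyT⟩))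

theorem mk_acl_le (S : Set F) : #(acl S) ≤ max #S ℵ₀ := by
  let k := Subfield.closure S
  have hk : #k ≤ max #S ℵ₀ := Subfield.cardinalMk_closure_le_max S
  have h : Algebra.IsAlgebraic k (algebraicClosure k F) := inferInstance
  have h1 := Algebra.IsAlgebraic.cardinalMk_le_max k (algebraicClosure k F)
  have h2 : #(acl S) ≤ #(algebraicClosure k F) := by
    refine mk_le_mk_of_subset (s := (acl S : Set F)) (t := algebraicClosure k F) fun x hx => ?_
    exact (mem_algebraicClosure_iff).2 (mem_acl_iff.1 hx)
  exact h2.trans (h1.trans (max_le hk (le_max_right _ _)))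

variable {G : Type u} [Field G] [CharZero G]

theorem map_mem_acl_iff (f : F →+* G) {S : Set F} {x : F} : f x ∈ acl (f '' S) ↔ x ∈ acl S := by
  let φ : F →ₐ[ℤ] G := f.toIntAlgHom
  have hφ : Function.Injective φ := f.injective
  have h1 : Subalgebra.map φ (Algebra.adjoin ℤ S) = Algebra.adjoin ℤ (f '' S) :=
    AlgHom.map_adjoin φ S
  rw [mem_acl, mem_acl, ← h1]
  exact isAlgebraic_ringHom_iff_of_comp_eq
    (Subalgebra.equivMapOfInjective (Algebra.adjoin ℤ S) φ hφ) f f.injective rfl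

theorem image_acl_subset (f : F →+* G) (S : Set F) : f '' (acl S) ⊆ acl (f '' S) := by
  rintro _ ⟨x, hx, rfl⟩
  exact (map_mem_acl_iff f).2 hx

theorem indepOver_image_iff (f : F →+* G) {C X : Set F} :
    IndepOver (f '' C) (f '' X) ↔ IndepOver C X := by
  unfold IndepOver
  rw [Set.forall_mem_image]
  refine forall₂_congr fun x hx => not_congr ?_
  rw [← map_mem_acl_iff f, Set.image_union, Set.image_sdiff f.injective, Set.image_singleton]

theorem ind_image_iff (f : F →+* G) {A B C : Set F} :
    Ind (f '' A) (f '' B) (f '' C) ↔ Ind A B C := by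
  unfold Ind
  constructor
  · intro h X hX hC
    rw [← indepOver_image_iff f, Set.image_union]
    exact h _ (Set.image_mono hX) ((indepOver_image_iff f).2 hC)
  · intro h X hX hC
    obtain ⟨Y, hY, rfl⟩ := Set.subset_image_iff.1 hX
    rw [← Set.image_union, indepOver_image_iff]
    exact h Y hY ((indepOver_image_iff f).1 hC)

theorem isAlgClosed_fieldRange (f : F →+* G) [IsAlgClosed F] : IsAlgClosed f.fieldRange := by
  exact IsAlgClosed.of_ringEquiv F _ (RingEquiv.ofBijective f.rangeRestrictField
    f.rangeRestrictField_bijective)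

theorem mk_iUnion_le_of_le {α ι : Type u} {S : ι → Set α} {κ : Cardinal.{u}} (hκ : ℵ₀ ≤ κ)
    (hι : #ι ≤ κ) (h : ∀ i, #(S i) ≤ κ) : #(⋃ i, S i) ≤ κ :=
  (mk_iUnion_le S).trans ((mul_le_mul' hι (ciSup_le' h)).trans_eq (mul_eq_self hκ))

theorem mk_iUnion_nat_le {α : Type u} {S : ℕ → Set α} {κ : Cardinal.{u}} (hκ : ℵ₀ ≤ κ)
    (h : ∀ i, #(S i) ≤ κ) : #(⋃ i, S i) ≤ κ := by
  rw [← Equiv.ulift.{u}.surjective.iUnion_comp]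
  exact mk_iUnion_le_of_le hκ (by simpa using hκ) fun i => h _

end AclMore

/-! ### Exponential fields and the ELA-closure. -/

section Exp

/-- Construct an exponential field from its exponential map. -/
abbrev ExpField.ofExp (F : Type u) [Field F] [CharZero F] (e : F → F)
    (h0 : e 0 = 1) (hadd : ∀ x y, e (x + y) = e x * e y) : ExpField F where
  charZero := inferInstance
  expHom :=
    { toFun := fun x => Units.mk0 (e x.toAdd) fun h => by
        have := hadd x.toAdd (-x.toAdd)
        rw [add_neg_cancel, h0, h, zero_mul] at this
        exact one_ne_zero this
      map_one' := Units.ext h0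
      map_mul' := fun x y => Units.ext (hadd x.toAdd y.toAdd) }

variable {F : Type u} [ExpField F]

theorem exp_zero : exp (0 : F) = 1 := by
  simp [exp]

theorem exp_add (x y : F) : exp (x + y) = exp x * exp y := by
  simp [exp]

theorem exp_ne_zero (x : F) : exp x ≠ 0 := Units.ne_zero _

theorem exp_neg (x : F) : exp (-x) = (exp x)⁻¹ := by
  simp [exp]

theorem exp_sub (x y : F) : exp (x - y) = exp x / exp y := by
  rw [sub_eq_add_neg, exp_add, exp_neg, div_eq_mul_inv]

theorem mem_ker {x : F} : x ∈ ker F ↔ exp x = 1 := Iff.rfl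

theorem exp_eq_exp_iff {x y : F} : exp x = exp y ↔ x - y ∈ ker F := by
  rw [mem_ker, exp_sub, div_eq_one_iff_eq (exp_ne_zero y)]

theorem exp_nsmul (n : ℕ) (x : F) : exp (n * x) = exp x ^ n := by
  induction n with
  | zero => simp [exp_zero]
  | succ n ih => rw [Nat.cast_succ, add_mul, one_mul, exp_add, ih, pow_succ]

theorem IsELAField.exists_ker_ne_zero (h : IsELAField F) : ∃ x ∈ ker F, x ≠ 0 := by
  -- Twice a logarithm of `-1` is a kernel element; it is nonzero because `exp 0 = 1 ≠ -1`.
  obtain ⟨y, hy⟩ := h.log (-1) (by simp)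
  refine ⟨2 * y, ?_, ?_⟩
  · have := exp_nsmul 2 y
    rw [mem_ker]
    push_cast at this
    rw [this, hy]
    norm_num
  · intro h0
    have : y = 0 := by simpa using h0
    rw [this, exp_zero] at hy
    norm_num [eq_neg_iff_add_eq_zero] at hy

theorem IsELAField.aleph0_le_mk_ker (h : IsELAField F) : ℵ₀ ≤ #(ker F) := by
  obtain ⟨x, hx, hx0⟩ := h.exists_ker_ne_zero
  rw [aleph0_le_mk_iff]
  refine Infinite.of_injective (fun n : ℕ => (⟨n * x, ?_⟩ : ker F)) fun m n hmn => ?_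
  · rw [mem_ker, exp_nsmul, mem_ker.1 hx, one_pow]
  · have := congrArg Subtype.val hmn
    exact_mod_cast mul_right_cancel₀ hx0 this

theorem subset_elaClosure (A : Set F) : A ⊆ elaClosure A := fun _ hx =>
  Subfield.mem_sInf.2 fun _ hB => hB.2 (Or.inl hx)

theorem ker_subset_elaClosure (A : Set F) : ker F ⊆ elaClosure A := fun _ hx =>
  Subfield.mem_sInf.2 fun _ hB => hB.2 (Or.inr hx)

theorem elaClosure_le {A : Set F} {B : Subfield F} (hB : IsELASubfield B) (hA : A ⊆ B)
    (hk : ker F ⊆ B) : elaClosure A ≤ B := sInf_le ⟨hB, Set.union_subset hA hk⟩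

/-- Logarithms survive the intersection because every subfield involved contains the kernel: once it
contains one logarithm of an element it contains them all. -/
theorem isELASubfield_elaClosure (h : IsELAField F) (A : Set F) :
    IsELASubfield (elaClosure A) where
  exp_mem x hx := Subfield.mem_sInf.2 fun B hB => hB.1.exp_mem x (Subfield.mem_sInf.1 hx B hB)
  algClosed := by
    have := h.algClosed
    rw [isAlgClosed_iff_acl]
    intro x hx
    refine Subfield.mem_sInf.2 fun B hB => ?_
    have := hB.1.algClosed
    rw [← acl_eq_of_isAlgClosed B]
    exact acl_mono (SetLike.coe_subset_coe.2 (sInf_le hB : elaClosure A ≤ B)) hx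
  log y hy hy0 := by
    obtain ⟨x, hx⟩ := h.log y hy0
    refine ⟨x, Subfield.mem_sInf.2 fun B hB => ?_, hx⟩
    obtain ⟨z, hz, hzy⟩ := hB.1.log y (Subfield.mem_sInf.1 hy B hB) hy0
    have : x - z ∈ B := hB.2 (Or.inr (exp_eq_exp_iff.1 (hx.trans hzy.symm)))
    simpa using B.add_mem this hz

theorem acl_elaClosure (h : IsELAField F) (A : Set F) :
    acl (elaClosure A : Set F) = elaClosure A := by
  have := (isELASubfield_elaClosure h A).algClosed
  exact acl_eq_of_isAlgClosed _

theorem elaClosure_mono {A B : Set F} (hAB : A ⊆ B) : elaClosure A ≤ elaClosure B :=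
  le_sInf fun _ hC => sInf_le ⟨hC.1, (Set.union_subset_union_left _ hAB).trans hC.2⟩

theorem isELASubfield_iSup (h : IsELAField F) {ι : Type*} [Nonempty ι] {B : ι → Subfield F}
    (hd : Directed (· ≤ ·) B) (hB : ∀ i, IsELASubfield (B i)) : IsELASubfield (⨆ i, B i) where
  exp_mem x hx := by
    rw [Subfield.mem_iSup_of_directed hd] at hx ⊢
    exact hx.imp fun i hi => (hB i).exp_mem x hi
  algClosed := by
    have := h.algClosed
    rw [isAlgClosed_iff_acl, Subfield.coe_iSup_of_directed hd]
    intro x hx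
    rw [← Set.union_empty (⋃ i, _)] at hx
    obtain ⟨i, hi⟩ := exists_mem_acl_of_directed (S := fun i => (B i : Set F)) hd hx
    have := (hB i).algClosed
    rw [Set.union_empty, acl_eq_of_isAlgClosed] at hi
    exact Set.mem_iUnion.2 ⟨i, hi⟩
  log y hy hy0 := by
    rw [Subfield.mem_iSup_of_directed hd] at hy
    obtain ⟨i, hi⟩ := hy
    obtain ⟨x, hx, hxy⟩ := (hB i).log y hi hy0
    exact ⟨x, (Subfield.mem_iSup_of_directed hd).2 ⟨i, hx⟩, hxy⟩

theorem elaClosure_iUnion_of_directed (h : IsELAField F) {ι : Type*} [Nonempty ι]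
    {A : ι → Set F} (hd : Directed (· ⊆ ·) A) :
    (elaClosure (⋃ i, A i) : Set F) = ⋃ i, (elaClosure (A i) : Set F) := by
  have hd' : Directed (· ≤ ·) fun i => elaClosure (A i) := fun i j =>
    (hd i j).imp fun _ h => ⟨elaClosure_mono h.1, elaClosure_mono h.2⟩
  apply Set.Subset.antisymm
  · rw [← Subfield.coe_iSup_of_directed hd', SetLike.coe_subset_coe]
    refine elaClosure_le (isELASubfield_iSup h hd' fun i => isELASubfield_elaClosure h _) ?_ ?_
    · rw [Subfield.coe_iSup_of_directed hd']
      exact Set.iUnion_mono fun i => subset_elaClosure (A i)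
    · rw [Subfield.coe_iSup_of_directed hd']
      exact (ker_subset_elaClosure _).trans
        (Set.subset_iUnion (fun i => (elaClosure (A i) : Set F)) (Classical.arbitrary ι))
  · exact Set.iUnion_subset fun i =>
      SetLike.coe_subset_coe.2 (elaClosure_mono (Set.subset_iUnion A i))

theorem exists_finite_of_mem_elaClosure (h : IsELAField F) {A : Set F} {x : F}
    (hx : x ∈ elaClosure A) : ∃ D ⊆ A, D.Finite ∧ x ∈ elaClosure D := by
  let S : {D : Set F // D ⊆ A ∧ D.Finite} → Set F := Subtype.val
  have : Nonempty {D : Set F // D ⊆ A ∧ D.Finite} := ⟨⟨∅, Set.empty_subset _, Set.finite_empty⟩⟩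
  have hS : Directed (· ⊆ ·) S := fun D E => ⟨⟨D.1 ∪ E.1, Set.union_subset D.2.1 E.2.1,
    D.2.2.union E.2.2⟩, Set.subset_union_left, Set.subset_union_right⟩
  have hA : A = ⋃ i, S i := Set.Subset.antisymm (fun a ha => Set.mem_iUnion.2
    ⟨⟨{a}, Set.singleton_subset_iff.2 ha, Set.finite_singleton a⟩, rfl⟩)
    (Set.iUnion_subset fun D => D.2.1)
  rw [hA, ← SetLike.mem_coe, elaClosure_iUnion_of_directed h hS, Set.mem_iUnion] at hx
  obtain ⟨D, hD⟩ := hx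
  exact ⟨D.1, D.2.1, D.2.2, hD⟩

/-- One chosen logarithm per element suffices for an ELA-subfield, so the closure lies in the union
of countably many rounds of adding exponentials and chosen logarithms and closing algebraically.
None of these rounds raises an infinite cardinality. -/
theorem mk_elaClosure_le (h : IsELAField F) (A : Set F) :
    #(elaClosure A) ≤ max #A #(ker F) := by
  set κ := max #A #(ker F) with hκ
  have hω : ℵ₀ ≤ κ := h.aleph0_le_mk_ker.trans (le_max_right _ _)
  choose! log hlog using h.log
  let step : Set F → Set F := fun S => acl (S ∪ exp '' S ∪ log '' S)
  let S : ℕ → Set F := fun n => step^[n] (acl (A ∪ ker F))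
  have hS : ∀ n, S (n + 1) = step (S n) := fun n => Function.iterate_succ_apply' _ _ _
  have hmono : Monotone S := monotone_nat_of_le_succ fun n => by
    rw [hS]
    exact (Set.subset_union_left.trans Set.subset_union_left).trans (subset_acl _)
  have hsub : ∀ n, ∃ B : Subfield F, (B : Set F) = S n ∧ IsAlgClosed B := by
    have := h.algClosed
    rintro (_ | n)
    · exact ⟨_, rfl, isAlgClosed_acl _⟩
    · exact ⟨_, (hS n).symm, isAlgClosed_acl _⟩
  choose B hB hBa using hsub
  have hd : Directed (· ≤ ·) B := by
    refine Monotone.directed_le fun m n hmn => ?_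
    rw [← SetLike.coe_subset_coe, hB, hB]
    exact hmono hmn
  have hcard : ∀ n, #(S n) ≤ κ := by
    intro n
    induction n with
    | zero =>
      refine (mk_acl_le _).trans (max_le ((mk_union_le _ _).trans ?_) hω)
      exact add_le_of_le hω (le_max_left _ _) (le_max_right _ _)
    | succ n ih =>
      rw [hS]
      refine (mk_acl_le _).trans (max_le ((mk_union_le _ _).trans ?_) hω)
      refine add_le_of_le hω ((mk_union_le _ _).trans ?_) (mk_image_le.trans ih)
      exact add_le_of_le hω ih (mk_image_le.trans ih)
  have hELA : IsELASubfield (⨆ n, B n) := by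
    have hsucc : ∀ n x, x ∈ B n → exp x ∈ B (n + 1) ∧ log x ∈ B (n + 1) := by
      intro n x hx
      rw [← SetLike.mem_coe, hB] at hx
      rw [← SetLike.mem_coe, ← SetLike.mem_coe, hB, hS]
      exact ⟨subset_acl _ (Or.inl (Or.inr ⟨x, hx, rfl⟩)), subset_acl _ (Or.inr ⟨x, hx, rfl⟩)⟩
    refine ⟨fun x hx => ?_, ?_, fun y hy hy0 => ?_⟩
    · rw [Subfield.mem_iSup_of_directed hd] at hx ⊢
      exact hx.elim fun n hn => ⟨n + 1, (hsucc n x hn).1⟩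
    · have := h.algClosed
      rw [isAlgClosed_iff_acl, Subfield.coe_iSup_of_directed hd]
      intro x hx
      rw [← Set.union_empty (⋃ i, _)] at hx
      obtain ⟨i, hi⟩ := exists_mem_acl_of_directed (S := fun i => (B i : Set F)) hd hx
      have := hBa i
      rw [Set.union_empty, acl_eq_of_isAlgClosed] at hi
      exact Set.mem_iUnion.2 ⟨i, hi⟩
    · rw [Subfield.mem_iSup_of_directed hd] at hy
      obtain ⟨n, hn⟩ := hy
      exact ⟨log y, (Subfield.mem_iSup_of_directed hd).2 ⟨n + 1, (hsucc n y hn).2⟩, hlog y hy0⟩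
  have h0 : A ∪ ker F ⊆ (⨆ n, B n : Subfield F) := by
    refine Set.Subset.trans ?_ (le_iSup B 0 : B 0 ≤ _)
    rw [hB]
    exact subset_acl _
  have hle : elaClosure A ≤ ⨆ n, B n := sInf_le ⟨hELA, h0⟩
  refine (mk_le_mk_of_subset (SetLike.coe_subset_coe.2 hle)).trans ?_
  rw [Subfield.coe_iSup_of_directed hd]
  exact mk_iUnion_nat_le hω fun n => (hB n).symm ▸ hcard n

end Exp

end ELA

namespace ELA

open Cardinal CategoryTheory

/-! ### Basic properties of ELA-independence and Club Local Character. -/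

section Independence

variable {F : Type u} [ExpField F]

theorem elaIndep_iff_ind {A B C : Set F} : ElaIndep A B C ↔
    Ind (elaClosure (A ∪ C) : Set F) (elaClosure (B ∪ C)) (elaClosure C) := tdIndep_iff_ind

theorem exists_subset_of_finite_of_directed {α ι : Type*} [Nonempty ι] {S : ι → Set α}
    (hS : Directed (· ⊆ ·) S) {X : Set α} (hX : X ⊆ ⋃ i, S i) (hf : X.Finite) :
    ∃ i, X ⊆ S i := by
  choose g hg using fun y : X => Set.mem_iUnion.1 (hX y.2)
  have := hf.to_subtype
  obtain ⟨i, hi⟩ := hS.finite_le g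
  exact ⟨i, fun y hy => hi ⟨y, hy⟩ (hg ⟨y, hy⟩)⟩

theorem exists_finite_subset_elaClosure (h : IsELAField F) {A X : Set F}
    (hX : X ⊆ elaClosure A) (hf : X.Finite) : ∃ D ⊆ A, D.Finite ∧ X ⊆ elaClosure D := by
  choose! D hD using fun x (hx : x ∈ X) => exists_finite_of_mem_elaClosure h (hX hx)
  refine ⟨⋃ x ∈ X, D x, Set.iUnion₂_subset fun x hx => (hD x hx).1,
    hf.biUnion fun x hx => (hD x hx).2.1, fun x hx => ?_⟩
  exact elaClosure_mono (Set.subset_biUnion_of_mem (u := D) hx) (hD x hx).2.2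

theorem isIndependenceOn_elaIndep (h : IsELAField F) :
    IsIndependenceOn (ElaIndep : Set F → Set F → Set F → Prop) where
  normality A B C hABC := by
    rw [elaIndep_iff_ind] at *
    rwa [Set.union_assoc, Set.union_self]
  existence A C := by
    rw [elaIndep_iff_ind, Set.union_self]
    intro X hX hC
    rwa [Set.union_self]
  monotonicity A B C D hABC hD := by
    rw [elaIndep_iff_ind] at *
    exact hABC.mono le_rfl ((SetLike.coe_subset_coe.2 (elaClosure_mono
      (Set.union_subset_union_left _ hD))).trans (Set.subset_union_left.trans (subset_acl _)))
  transitivity A B C D hCD hAD hAB := by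
    rw [elaIndep_iff_ind] at *
    rw [Set.union_eq_self_of_subset_right hCD] at hAD
    have h1 := hAB.mono (A' := (elaClosure (A ∪ C) : Set F))
      (B' := (elaClosure (B ∪ C) : Set F))
      (SetLike.coe_subset_coe.2 (elaClosure_mono (Set.union_subset_union_right _ hCD)))
      ((SetLike.coe_subset_coe.2 (elaClosure_mono (Set.union_subset_union_right _ hCD))).trans
        (Set.subset_union_left.trans (subset_acl _)))
    exact hAD.trans h1 ((SetLike.coe_subset_coe.2 (elaClosure_mono hCD)).trans (subset_acl _))
  symmetry A B C hABC := by
    rw [elaIndep_iff_ind] at *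
    exact hABC.symm
  finite_character A B C hABC := by
    rw [elaIndep_iff_ind]
    refine ind_of_finite fun X hX hf => ?_
    obtain ⟨D, hD, hDf, hXD⟩ := exists_finite_subset_elaClosure h hX hf
    have := elaIndep_iff_ind.1 (hABC (D ∩ A) Set.inter_subset_right
      (hDf.subset Set.inter_subset_left))
    refine this.mono (hXD.trans (SetLike.coe_subset_coe.2 (elaClosure_mono ?_)))
      (Set.subset_union_left.trans (subset_acl _))
    intro x hx
    exact (hD hx).imp (fun h => ⟨hx, h⟩) id

theorem mk_iUnion_le_of_lift_le {α : Type u} {ι : Type v} {S : ι → Set α} {κ : Cardinal.{u}}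
    (hκ : ℵ₀ ≤ κ) (hι : lift.{u} #ι ≤ lift.{v} κ) (h : ∀ i, #(S i) ≤ κ) : #(⋃ i, S i) ≤ κ := by
  rw [← lift_le.{v}]
  refine (mk_iUnion_le_lift S).trans ((mul_le_mul' hι (ciSup_le' fun i => ?_)).trans_eq
    (mul_eq_self (aleph0_le_lift.2 hκ)))
  exact lift_le.2 (h i)

/-- One step of closing off. A dependence of a finite `X` over `elaClosure B` uses finitely many
elements there, hence only a finite part of `B`. There are at most `κ` finite sets `X` in
`elaClosure (A ∪ W)`, so the parts needed for all of them can be added to `W`. -/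
theorem exists_small_dependence_witness (h : IsELAField F) {A B W : Set F} {κ : Cardinal.{u}}
    (hκ : ℵ₀ ≤ κ) (hker : #(ker F) ≤ κ) (hA : #A ≤ κ) (hW : W ⊆ B ∧ #W ≤ κ) :
    ∃ W' : Set F, (W' ⊆ B ∧ #W' ≤ κ) ∧ W ⊆ W' ∧
      ∀ X : Set F, X.Finite → X ⊆ elaClosure (A ∪ W) →
        IndepOver (elaClosure W' : Set F) X → IndepOver (elaClosure B : Set F) X := by
  have key : ∀ X : Set F, ∃ E ⊆ B, E.Finite ∧
      (IndepOver (elaClosure E : Set F) X → IndepOver (elaClosure B : Set F) X) := by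
    intro X
    by_cases hX : IndepOver (elaClosure B : Set F) X
    · exact ⟨∅, Set.empty_subset _, Set.finite_empty, fun _ => hX⟩
    · unfold IndepOver at hX
      push Not at hX
      obtain ⟨x, hx, hxB⟩ := hX
      obtain ⟨T, hT, hTf, hxT⟩ := exists_finite_of_mem_acl hxB
      obtain ⟨E, hE, hEf, hTE⟩ := exists_finite_subset_elaClosure h
        (X := T ∩ elaClosure B) Set.inter_subset_right (hTf.subset Set.inter_subset_left)
      refine ⟨E, hE, hEf, fun hEX => absurd (acl_mono ?_ hxT) (hEX x hx)⟩
      intro t ht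
      exact (hT ht).imp (fun h' => hTE ⟨ht, h'⟩) id
  choose E hEB hEf hE using key
  let Z : Finset (elaClosure (A ∪ W)) → Set F := fun X => E (Subtype.val '' (X : Set (elaClosure (A ∪ W))))
  have hcl : #(elaClosure (A ∪ W)) ≤ κ := (mk_elaClosure_le h _).trans
    (max_le ((mk_union_le _ _).trans (add_le_of_le hκ hA hW.2)) hker)
  have hZ : #(⋃ X, Z X) ≤ κ := by
    refine mk_iUnion_le_of_le hκ ?_ fun X => (hEf _).lt_aleph0.le.trans hκ
    exact (mk_finset_of_infinite _).trans_le hcl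
  refine ⟨W ∪ ⋃ X, Z X, ⟨Set.union_subset hW.1 (Set.iUnion_subset fun X => hEB _),
    (mk_union_le _ _).trans (add_le_of_le hκ hW.2 hZ)⟩, Set.subset_union_left, ?_⟩
  intro X hf hX hXi
  lift X to Set (elaClosure (A ∪ W)) using hX
  have hf' : X.Finite := hf.of_finite_image Subtype.val_injective.injOn
  lift X to Finset (elaClosure (A ∪ W)) using hf'
  refine hE _ (hXi.mono_left (Set.Subset.trans ?_ (subset_acl _)))
  exact SetLike.coe_subset_coe.2 (elaClosure_mono
    ((Set.subset_iUnion Z X).trans Set.subset_union_right))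

theorem exists_club (h : IsELAField F) {A : Set F} (B : Set F) {κ : Cardinal.{u}}
    (hκ : ℵ₀ ≤ κ) (hker : #(ker F) ≤ κ) (hA : #A ≤ κ) :
    ∃ ℬ : Set (Set F), IsClub B (Order.succ κ) ℬ ∧ ∀ B₀ ∈ ℬ, ElaIndep A B B₀ := by
  -- A finite subset of the closure of `A ∪ ⋃ Y i` lies in the closure of one `A ∪ Y i`. For that
  -- fixed finite set, `Ind.base` moves the base from `Y i` up to the union.
  have hunion : ∀ {ι : Type _} [Nonempty ι] (Y : ι → Set F), Directed (· ⊆ ·) Y →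
      (∀ i, Y i ⊆ B) → (∀ i, ElaIndep A B (Y i)) → ElaIndep A B (⋃ i, Y i) := by
    intro ι _ Y hd hYB hY
    have hd' : Directed (· ⊆ ·) fun i => A ∪ Y i := fun i j => (hd i j).imp fun _ h =>
      ⟨Set.union_subset_union_right _ h.1, Set.union_subset_union_right _ h.2⟩
    rw [elaIndep_iff_ind, Set.union_eq_self_of_subset_right (Set.iUnion_subset hYB),
      Set.union_iUnion, elaClosure_iUnion_of_directed h hd']
    refine ind_of_finite fun X hX hf => ?_
    obtain ⟨i, hi⟩ := exists_subset_of_finite_of_directed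
      (S := fun i => (elaClosure (A ∪ Y i) : Set F))
      (fun i j => (hd' i j).imp fun _ h => ⟨SetLike.coe_subset_coe.2 (elaClosure_mono h.1),
        SetLike.coe_subset_coe.2 (elaClosure_mono h.2)⟩) hX hf
    have h1 := elaIndep_iff_ind.1 (hY i)
    rw [Set.union_eq_self_of_subset_right (hYB i)] at h1
    refine (h1.mono hi (Set.subset_union_left.trans (subset_acl _))).base ?_ ?_
    · exact (SetLike.coe_subset_coe.2 (elaClosure_mono (Set.subset_iUnion Y i))).trans
        (subset_acl _)
    · exact (SetLike.coe_subset_coe.2 (elaClosure_mono (Set.iUnion_subset hYB))).trans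
        (Set.subset_union_left.trans (subset_acl _))
  refine ⟨{B₀ | (B₀ ⊆ B ∧ #B₀ ≤ κ) ∧ ElaIndep A B B₀}, ⟨?_, ?_, ?_⟩, fun B₀ h => h.2⟩
  · exact fun Y hY => ⟨hY.1.1, Order.lt_succ_iff.2 hY.1.2⟩
  · intro Z hZ hZκ
    let Small := {W : Set F // W ⊆ B ∧ #W ≤ κ}
    choose next hnext hle hdep using fun W : Small =>
      exists_small_dependence_witness h hκ hker hA W.2
    -- A finite set in the closure of `A ∪ ⋃ W n` already lies in the closure of `A ∪ W n` for some
    -- `n`, and its dependences over `elaClosure B` are witnessed in `W (n + 1)`.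
    let W : ℕ → Small := fun n => (fun W => ⟨next W, hnext W⟩)^[n] ⟨Z, hZ, Order.lt_succ_iff.1 hZκ⟩
    have hW : ∀ n, (W (n + 1)).1 = next (W n) := fun n =>
      congrArg Subtype.val (Function.iterate_succ_apply' _ _ _)
    have hmono : Monotone fun n => (W n).1 := monotone_nat_of_le_succ fun n => by
      rw [hW]
      exact hle _
    refine ⟨⋃ n, (W n).1, ⟨⟨Set.iUnion_subset fun n => (W n).2.1,
      mk_iUnion_nat_le hκ fun n => (W n).2.2⟩, ?_⟩, Set.subset_iUnion (fun n => (W n).1) 0⟩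
    have hBW : B ∪ ⋃ n, (W n).1 = B :=
      Set.union_eq_self_of_subset_right (Set.iUnion_subset fun n => (W n).2.1)
    rw [elaIndep_iff_ind, hBW, Set.union_iUnion]
    have hd : Directed (· ⊆ ·) fun n => A ∪ (W n).1 :=
      Monotone.directed_le fun m n hmn => Set.union_subset_union_right _ (hmono hmn)
    rw [elaClosure_iUnion_of_directed h hd]
    intro X hX hXi
    refine indepOver_of_finite fun Y hY hf => ?_
    obtain ⟨n, hn⟩ := exists_subset_of_finite_of_directed
      (S := fun n => (elaClosure (A ∪ (W n).1) : Set F))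
      (Monotone.directed_le fun m n hmn => SetLike.coe_subset_coe.2 (elaClosure_mono
        (Set.union_subset_union_right _ (hmono hmn)))) (hY.trans hX) hf
    have h1 : IndepOver (elaClosure (next (W n)) : Set F) Y := by
      refine (hXi.mono_right hY).mono_left (Set.Subset.trans ?_ (subset_acl _))
      rw [← hW]
      exact SetLike.coe_subset_coe.2 (elaClosure_mono (Set.subset_iUnion (fun n => (W n).1) _))
    refine (hdep (W n) Y hf hn h1).mono_left (Set.Subset.trans ?_ (subset_acl _))
    exact Set.union_subset le_rfl (SetLike.coe_subset_coe.2 (elaClosure_mono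
      (Set.iUnion_subset fun n => (W n).2.1)))
  · intro γ hγ0 hγ Y hY hmono
    have hne : Nonempty (Set.Iio γ) := ⟨⟨0, pos_iff_ne_zero.2 hγ0⟩⟩
    have hU : (⋃ i < γ, Y i) = ⋃ i : Set.Iio γ, Y i := Set.biUnion_eq_iUnion _ _
    have hd : Directed (· ⊆ ·) fun i : Set.Iio γ => Y i :=
      Monotone.directed_le fun i j hij => hmono i j hij j.2
    rw [hU]
    refine ⟨⟨Set.iUnion_subset fun i => (hY i i.2).1.1, ?_⟩,
      hunion _ hd (fun i => (hY i i.2).1.1) fun i => (hY i i.2).2⟩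
    refine mk_iUnion_le_of_lift_le hκ ?_ fun i => (hY i i.2).1.2
    rw [Cardinal.mk_Iio_ordinal, lift_lift, lift_le]
    exact Order.lt_succ_iff.1 (Cardinal.lt_ord.1 hγ)

end Independence

end ELA

namespace ELA

open Cardinal CategoryTheory CategoryTheory.Limits FirstOrder

/-! ### Kernel-preserving embeddings commute with ELA-closure. -/

section Emb

variable {M N : Type u} [ExpField M] [ExpField N]

theorem KPEmb.coe_eq (f : KPEmb M N) (x : M) : f x = f.toRingHom x := rfl

theorem KPEmb.map_exp' (f : KPEmb M N) (x : M) : f (exp x) = exp (f x) := f.map_exp x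

theorem KPEmb.injective (f : KPEmb M N) : Function.Injective f := f.toRingHom.injective

theorem ExpEmb.exp_eq_one_iff (f : ExpEmb M N) {x : M} : exp (f.toRingHom x) = 1 ↔ exp x = 1 := by
  have h : f.toRingHom (exp x) = exp (f.toRingHom x) := f.map_exp x
  rw [← h, map_eq_one_iff _ f.toRingHom.injective]

theorem ExpEmb.ker_eq_image (f : ExpEmb M N) (h : ker N ⊆ Set.range f.toFun) :
    ker N = f.toRingHom '' ker M := by
  apply Set.Subset.antisymm
  · intro y hy
    obtain ⟨x, rfl⟩ := h hy
    exact ⟨x, f.exp_eq_one_iff.1 hy, rfl⟩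
  · rintro _ ⟨x, hx, rfl⟩
    exact f.exp_eq_one_iff.2 hx

theorem KPEmb.ker_eq_image (f : KPEmb M N) : ker N = f '' ker M :=
  f.toExpEmb.ker_eq_image f.ker_subset

theorem KPEmb.isELASubfield_map (f : KPEmb M N) {B : Subfield M}
    (hB : IsELASubfield B) : IsELASubfield (B.map f.toRingHom) where
  exp_mem := by
    rintro _ ⟨x, hx, rfl⟩
    exact ⟨exp x, hB.exp_mem x hx, f.map_exp x⟩
  algClosed := by
    have := hB.algClosed
    have h := isAlgClosed_fieldRange (f.toRingHom.comp B.subtype)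
    have h' : (f.toRingHom.comp B.subtype).fieldRange = B.map f.toRingHom := by
      ext x
      simp [RingHom.mem_fieldRange, Subfield.mem_map]
    rwa [h'] at h
  log := by
    rintro _ ⟨y, hy, rfl⟩ hy0
    obtain ⟨x, hx, rfl⟩ := hB.log y hy fun h => hy0 (by rw [h]; exact map_zero _)
    exact ⟨_, ⟨x, hx, rfl⟩, (f.map_exp x).symm⟩

/-- The inclusion `ker N ⊆ B` supplies the logarithms: one coming from `M` differs from one in `B`
by a kernel element, so its image lies in `B` too. -/
theorem KPEmb.isELASubfield_comap (f : KPEmb M N) (hM : IsELAField M) {B : Subfield N}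
    (hB : IsELASubfield B) (hk : ker N ⊆ B) : IsELASubfield (B.comap f.toRingHom) where
  exp_mem x hx := by
    have := hB.exp_mem _ hx
    rwa [Subfield.mem_comap, ← f.coe_eq, f.map_exp']
  algClosed := by
    have := hM.algClosed
    rw [isAlgClosed_iff_acl]
    intro x hx
    have h := image_acl_subset f.toRingHom _ ⟨x, hx, rfl⟩
    have := hB.algClosed
    rw [SetLike.mem_coe, Subfield.mem_comap, ← acl_eq_of_isAlgClosed B]
    refine acl_mono ?_ h
    rintro _ ⟨y, hy, rfl⟩
    exact hy
  log y hy hy0 := by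
    obtain ⟨x, hx⟩ := hM.log y hy0
    refine ⟨x, ?_, hx⟩
    obtain ⟨z, hz, hzy⟩ := hB.log _ hy (by simpa using hy0)
    have h1 : exp (f.toRingHom x) = exp z := by
      rw [hzy, ← hx]
      exact (f.map_exp x).symm
    have := B.add_mem (hk (exp_eq_exp_iff.1 h1)) hz
    rwa [sub_add_cancel] at this

/-- Both inclusions follow from minimality, applied to the preimage and to the image of a closure;
kernel preservation makes the two kernels correspond. -/
theorem KPEmb.image_elaClosure (f : KPEmb M N) (hM : IsELAField M) (hN : IsELAField N)
    (A : Set M) : f '' (elaClosure A : Set M) = elaClosure (f '' A) := by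
  apply Set.Subset.antisymm
  · have hk := ker_subset_elaClosure (f '' A)
    have h : elaClosure A ≤ (elaClosure (f '' A)).comap f.toRingHom := by
      refine elaClosure_le (f.isELASubfield_comap hM (isELASubfield_elaClosure hN _) hk) ?_ ?_
      · exact fun a ha => subset_elaClosure (f '' A) ⟨a, ha, rfl⟩
      · intro x hx
        exact hk (f.ker_eq_image ▸ ⟨x, hx, rfl⟩)
    rintro _ ⟨x, hx, rfl⟩
    exact h hx
  · have h : elaClosure (f '' A) ≤ (elaClosure A).map f.toRingHom := by
      refine elaClosure_le (f.isELASubfield_map (isELASubfield_elaClosure hM _)) ?_ ?_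
      · exact Set.image_mono (subset_elaClosure A)
      · rw [f.ker_eq_image]
        exact Set.image_mono (ker_subset_elaClosure A)
    exact h

theorem KPEmb.elaIndep_image_iff (f : KPEmb M N) (hM : IsELAField M) (hN : IsELAField N)
    (A B C : Set M) : ElaIndep (f '' A) (f '' B) (f '' C) ↔ ElaIndep A B C := by
  rw [elaIndep_iff_ind, elaIndep_iff_ind, ← Set.image_union, ← Set.image_union,
    ← f.image_elaClosure hM hN, ← f.image_elaClosure hM hN, ← f.image_elaClosure hM hN]
  exact ind_image_iff f.toRingHom

/-- The range of a kernel-preserving embedding of ELA-fields is closed. -/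
theorem KPEmb.elaClosure_range (f : KPEmb M N) (hM : IsELAField M) (hN : IsELAField N) :
    (elaClosure (Set.range f) : Set N) = Set.range f := by
  rw [← Set.image_univ, ← f.image_elaClosure hM hN]
  congr 1
  exact Set.eq_univ_of_univ_subset (subset_elaClosure _)

theorem ExpEmb.exists_lift {L : Type v} [ExpField L] (g : ExpEmb L N) (f : ExpEmb M N)
    (h : Set.range g.toFun ⊆ Set.range f.toFun) :
    ∃ k : ExpEmb L M, ∀ x, f.toFun (k.toFun x) = g.toFun x := by
  choose k hk using fun x => h ⟨x, rfl⟩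
  have hk' : ∀ x, f.toRingHom (k x) = g.toRingHom x := hk
  have inj := f.toRingHom.injective
  refine ⟨⟨⟨⟨⟨k, inj ?_⟩, fun x y => inj ?_⟩, inj ?_, fun x y => inj ?_⟩, fun x => inj ?_⟩, hk⟩
  · simp [hk']
  · simp [hk']
  · simp [hk']
  · simp [hk']
  · have h1 : f.toRingHom (exp (k x)) = exp (f.toRingHom (k x)) := f.map_exp _
    have h2 : g.toRingHom (exp x) = exp (g.toRingHom x) := g.map_exp _
    exact (hk' (exp x)).trans (h2.trans ((congrArg exp (hk' x)).symm.trans h1.symm))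

theorem HasKernelType.of_kpEmb {K : Type v} [ExpField K] (f : KPEmb M N) (hM : IsELAField M)
    (hN : IsELAField N) (h : HasKernelType M K) : HasKernelType N K := by
  obtain ⟨g, hg⟩ := h
  refine ⟨⟨f.toRingHom.comp g.toRingHom, fun x => ?_⟩, ?_⟩
  · exact (congrArg f (g.map_exp x)).trans (f.map_exp _)
  · have : Set.range (f ∘ g.toFun) = (elaClosure (∅ : Set N) : Set N) := by
      rw [Set.range_comp, hg, f.image_elaClosure hM hN, Set.image_empty]
    exact this

theorem HasKernelType.of_kpEmb_left {K : Type v} [ExpField K] (f : KPEmb M N)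
    (hM : IsELAField M) (hN : IsELAField N) (h : HasKernelType N K) : HasKernelType M K := by
  obtain ⟨g, hg⟩ := h
  have h1 := f.image_elaClosure hM hN ∅
  rw [Set.image_empty, ← hg] at h1
  obtain ⟨k, hk⟩ := g.exists_lift f.toExpEmb (h1 ▸ Set.image_subset_range _ _)
  refine ⟨k, f.injective.image_injective ?_⟩
  rw [h1, ← Set.range_comp]
  exact congrArg Set.range (funext hk)

theorem HasKernelType.mk_ker_eq {K : Type u} [ExpField K] (h : HasKernelType M K) :
    #(ker M) = #(ker K) := by
  obtain ⟨g, hg⟩ := h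
  rw [g.ker_eq_image (hg ▸ ker_subset_elaClosure _)]
  exact mk_image_eq g.toRingHom.injective

end Emb

/-! ### ELA-subfields as objects; Invariance and Club Local Character in the category. -/

section Subfield

variable {F : Type u} [ExpField F]

/-- The exponential field structure on a subfield closed under exponentiation. -/
abbrev IsELASubfield.expField {B : Subfield F} (hB : IsELASubfield B) : ExpField B :=
  ExpField.ofExp B (fun x => ⟨exp x.1, hB.exp_mem x x.2⟩) (Subtype.ext exp_zero)
    fun _ _ => Subtype.ext (exp_add _ _)

theorem IsELASubfield.isELAField {B : Subfield F} (hB : IsELASubfield B) :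
    @IsELAField B hB.expField :=
  @IsELAField.mk B hB.expField hB.algClosed fun y hy => by
    obtain ⟨x, hx, hxy⟩ := hB.log y y.2 fun h => hy (Subtype.ext h)
    exact ⟨⟨x, hx⟩, Subtype.ext hxy⟩

def IsELASubfield.inclusion {B : Subfield F} (hB : IsELASubfield B) (hk : ker F ⊆ B) :
    @KPEmb B F hB.expField _ :=
  letI := hB.expField
  { toRingHom := B.subtype
    map_exp := fun _ => rfl
    ker_subset := fun x hx => ⟨⟨x, hk hx⟩, rfl⟩ }

end Subfield

section Category

variable {K : Type u} [ExpField K]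

/-- The ELA-closure of a subset of an object, as an object. -/
def ELAF.closure (M : ELAF K) (A : Set M.carrier) : ELAF K :=
  letI hB := isELASubfield_elaClosure M.isELA A
  letI := hB.expField
  { carrier := elaClosure A
    expField := hB.expField
    isELA := hB.isELAField
    kernelType := M.kernelType.of_kpEmb_left (hB.inclusion (ker_subset_elaClosure A))
      hB.isELAField M.isELA }

def ELAF.closureInclusion (M : ELAF K) (A : Set M.carrier) : M.closure A ⟶ M :=
  (isELASubfield_elaClosure M.isELA A).inclusion (ker_subset_elaClosure A)

theorem ELAF.range_closureInclusion (M : ELAF K) (A : Set M.carrier) :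
    Set.range (M.closureInclusion A) = (elaClosure A : Set M.carrier) :=
  Subtype.range_coe

theorem ELAF.mk_ker (M : ELAF K) : #(ker M.carrier) = #(ker K) := M.kernelType.mk_ker_eq

theorem isIndependenceRelation_elaIndep : IsIndependenceRelation (elaIndep K) where
  basic M := isIndependenceOn_elaIndep M.isELA
  invariance {M N} f A B D := (KPEmb.elaIndep_image_iff f M.isELA N.isELA A B D).symm

theorem clubLocalCharacter_elaIndep (hK : IsELAField K) :
    ClubLocalCharacter (elaIndep K) (Order.succ #(ker K)) := by
  refine ⟨isRegular_succ hK.aleph0_le_mk_ker, fun M A B hA => ?_⟩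
  exact exists_club M.isELA B hK.aleph0_le_mk_ker M.mk_ker.le
    (hA.lt_aleph0.le.trans hK.aleph0_le_mk_ker)

end Category

end ELA

namespace ELA

open Cardinal CategoryTheory CategoryTheory.Limits FirstOrder FirstOrder.Language

/-! ### The axioms of an abstract elementary class other than unions of chains. -/

section Category

variable {K : Type u} [ExpField K]

theorem ELAF.hom_ext {M N : ELAF K} {f g : M ⟶ N}
    (h : ∀ x : M.carrier, (f : KPEmb M.carrier N.carrier) x = (g : KPEmb M.carrier N.carrier) x) :
    f = g :=
  DFunLike.ext (F := KPEmb M.carrier N.carrier) f g h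

theorem arrow_embedding {M N : ELAF K} (f : M ⟶ N) :
    ∃ g : ToType M ↪[expRing] ToType N, ∀ x, g x = f x := by
  let φ : KPEmb M.carrier N.carrier := f
  refine ⟨⟨⟨φ, φ.injective⟩, ?_, fun {n} r => r.elim⟩, fun _ => rfl⟩
  intro n s x
  cases s with
  | add => exact map_add φ.toRingHom (x 0) (x 1)
  | mul => exact map_mul φ.toRingHom (x 0) (x 1)
  | neg => exact map_neg φ.toRingHom (x 0)
  | zero => exact map_zero φ.toRingHom
  | one => exact map_one φ.toRingHom
  | exp => exact φ.map_exp (x 0)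

theorem iso_closed_arrow {M N : ELAF K} (e : ToType M ≃[expRing] ToType N) :
    ∃ f : M ⟶ N, ∀ x, f x = e x := by
  let φ : KPEmb M.carrier N.carrier :=
    { toFun := e
      map_one' := e.map_fun' ExpRingFunc.one ![]
      map_zero' := e.map_fun' ExpRingFunc.zero ![]
      map_mul' := fun x y => e.map_fun' ExpRingFunc.mul ![x, y]
      map_add' := fun x y => e.map_fun' ExpRingFunc.add ![x, y]
      map_exp := fun x => e.map_fun' ExpRingFunc.exp ![x]
      ker_subset := fun x _ => e.surjective x }
  exact ⟨φ, fun _ => rfl⟩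

/-- All operations are transported along `e`. The conclusion is an equality of bundled structures,
so the transported operations are compared with the given ones symbol by symbol. -/
theorem iso_closed_obj (A : ELAF K) (B : Type u) [expRing.Structure B]
    (e : ToType A ≃[expRing] B) :
    ∃ A' : ELAF K, (Bundled.of (c := expRing.Structure) (ToType A')) =
      Bundled.of (c := expRing.Structure) B := by
  let e' : B ≃ A.carrier := e.toEquiv.symm
  let fB : Field B := e'.field
  let r : B ≃+* A.carrier := e'.ringEquiv
  have hr : ∀ b, r (e b) = b := fun b => e.toEquiv.symm_apply_apply b
  have hr' : ∀ b, e (r b) = b := fun b => e.toEquiv.apply_symm_apply b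
  have : CharZero B := charZero_of_injective_ringHom (f := r.symm.toRingHom) r.symm.injective
  let eB : ExpField B := ExpField.ofExp B (fun b => r.symm (exp (r b)))
    (by rw [map_zero, exp_zero, map_one]) (fun x y => by rw [map_add, exp_add, map_mul])
  have hexp : ∀ b, exp b = r.symm (exp (r b)) := fun _ => rfl
  let φ : KPEmb A.carrier B :=
    { toRingHom := r.symm.toRingHom
      map_exp := fun x => by
        change r.symm (exp x) = exp (r.symm x)
        rw [hexp, r.apply_symm_apply]
      ker_subset := fun b _ => ⟨r b, r.symm_apply_apply b⟩ }
  have hB : IsELAField B := by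
    refine ⟨?_, fun y hy => ?_⟩
    · have := A.isELA.algClosed
      exact IsAlgClosed.of_ringEquiv A.carrier B r.symm
    · obtain ⟨x, hx⟩ := A.isELA.log (r y) (by simpa using hy)
      exact ⟨r.symm x, by rw [hexp, r.apply_symm_apply, hx, r.symm_apply_apply]⟩
  refine ⟨⟨B, hB, A.kernelType.of_kpEmb φ A.isELA hB⟩, ?_⟩
  unfold Bundled.of
  congr 1
  have hsymm : ∀ a, r.symm a = e a := fun a => by
    rw [r.symm_apply_eq, hr]
  refine Structure.ext ?_ ?_
  · funext n s x
    have key := e.map_fun' s (r ∘ x)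
    have hx : (e.toFun ∘ (r ∘ x)) = x := funext fun i => hr' _
    rw [hx] at key
    refine Eq.trans ?_ key
    cases s with
    | add =>
      change x 0 + x 1 = e (r (x 0) + r (x 1) : A.carrier)
      rw [← map_add, hr']
    | mul =>
      change x 0 * x 1 = e (r (x 0) * r (x 1) : A.carrier)
      rw [← map_mul, hr']
    | neg =>
      change - x 0 = e (- r (x 0) : A.carrier)
      rw [← map_neg, hr']
    | zero =>
      change 0 = e (0 : A.carrier)
      rw [← map_zero r, hr']
    | one =>
      change 1 = e (1 : A.carrier)
      rw [← map_one r, hr']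
    | exp => exact hsymm _
  · funext n s
    exact s.elim

theorem coherence {A B D : ELAF K} (f : A ⟶ D) (g : B ⟶ D) (h : Set.range f ⊆ Set.range g) :
    ∃ k : A ⟶ B, k ≫ g = f := by
  let φ : KPEmb A.carrier D.carrier := f
  let ψ : KPEmb B.carrier D.carrier := g
  obtain ⟨k, hk⟩ := φ.toExpEmb.exists_lift ψ.toExpEmb h
  refine ⟨{ toExpEmb := k, ker_subset := fun b hb => ?_ }, ELAF.hom_ext hk⟩
  obtain ⟨a, ha⟩ := φ.ker_subset (ψ.exp_eq_one_iff.2 hb : ψ.toRingHom b ∈ ker D.carrier)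
  exact ⟨a, ψ.injective ((hk a).trans ha)⟩

theorem lowenheim_skolem (A : ELAF K) (S : Set (ToType A)) :
    ∃ (B : ELAF K) (f : B ⟶ A), S ⊆ Set.range f ∧ #(ToType B) ≤ #S + #(ker K) := by
  refine ⟨A.closure S, A.closureInclusion S, ?_, ?_⟩
  · have := A.range_closureInclusion S
    exact (subset_elaClosure S).trans this.symm.subset
  · refine (mk_elaClosure_le A.isELA S).trans ?_
    rw [A.mk_ker]
    exact max_le (self_le_add_right _ _) (self_le_add_left _ _)

end Category

/-! ### Unions of chains as direct limits. -/

noncomputable section Chain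

set_option linter.unusedSectionVars false

variable {K : Type u} [ExpField K] {J : Type u} [LinearOrder J] [Nonempty J] (F : J ⥤ ELAF K)

abbrev chainMap (i j : J) (h : i ≤ j) : (F.obj i).carrier →+* (F.obj j).carrier :=
  KPEmb.toExpEmb (F.map (homOfLE h)) |>.toRingHom

instance : DirectedSystem (fun j => (F.obj j).carrier) fun i j h => (chainMap F i j h) where
  map_self i x := by
    have : F.map (homOfLE (le_refl i)) = 𝟙 (F.obj i) := F.map_id i
    exact congrArg (fun f : F.obj i ⟶ F.obj i => (f : KPEmb _ _) x) this
  map_map k j i hij hjk x := by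
    have : F.map (homOfLE hij) ≫ F.map (homOfLE hjk) = F.map (homOfLE (hij.trans hjk)) :=
      (F.map_comp _ _).symm
    exact congrArg (fun f : F.obj i ⟶ F.obj k => (f : KPEmb _ _) x) this

/-- The union of a chain. -/
abbrev ChainLimit : Type u := DirectLimit (fun j => (F.obj j).carrier) (chainMap F)

abbrev ChainLimit.of (j : J) : (F.obj j).carrier →+* ChainLimit F :=
  DirectLimit.Ring.of (fun j => (F.obj j).carrier) (chainMap F) j

theorem chainMap_exp (i j : J) (h : i ≤ j) (x : (F.obj i).carrier) :
    chainMap F i j h (exp x) = exp (chainMap F i j h x) :=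
  ExpEmb.map_exp _ x

theorem ChainLimit.exists_of (z : ChainLimit F) : ∃ i x, z = ChainLimit.of F i x :=
  DirectLimit.exists_eq_mk _ z

theorem ChainLimit.of_chainMap {i j : J} (h : i ≤ j) (x : (F.obj i).carrier) :
    ChainLimit.of F j (chainMap F i j h x) = ChainLimit.of F i x :=
  DirectLimit.mk_apply (F := fun j => (F.obj j).carrier) (f := chainMap F) i j x h

instance : CharZero (ChainLimit F) :=
  charZero_of_injective_ringHom (ChainLimit.of F (Classical.arbitrary J)).injective

instance : ExpField (ChainLimit F) :=
  ExpField.ofExp (ChainLimit F)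
    (DirectLimit.map (chainMap F) (chainMap F) (fun _ x => exp x) fun i j h x =>
      chainMap_exp F i j h x)
    (by
      let j := Classical.arbitrary J
      rw [← map_zero (ChainLimit.of F j), ← map_one (ChainLimit.of F j), ← exp_zero]
      rfl)
    (by
      refine DirectLimit.induction₂ _ fun i x y => ?_
      have h1 := map_add (ChainLimit.of F i) x y
      have h2 := map_mul (ChainLimit.of F i) (exp x) (exp y)
      rw [← exp_add] at h2
      exact (congrArg _ h1.symm).trans h2)

theorem ChainLimit.exp_of (j : J) (x : (F.obj j).carrier) :
    exp (ChainLimit.of F j x) = ChainLimit.of F j (exp x) := rfl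

def ChainLimit.emb (j : J) : KPEmb (F.obj j).carrier (ChainLimit F) where
  toRingHom := ChainLimit.of F j
  map_exp x := (ChainLimit.exp_of F j x).symm
  ker_subset z hz := by
    obtain ⟨i, x, rfl⟩ := ChainLimit.exists_of F z
    have hx : exp x = 1 := by
      apply (ChainLimit.of F i).injective
      rw [← ChainLimit.exp_of, map_one]
      exact hz
    -- No kernel appears along the chain: a kernel element from stage `i` is pushed up to `k`, and
    -- the kernel-preserving map from stage `j` to stage `k` already hits it.
    obtain ⟨k, hik, hjk⟩ := exists_ge_ge i j
    have hxk : chainMap F i k hik x ∈ ker (F.obj k).carrier := by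
      rw [mem_ker, ← chainMap_exp, hx, map_one]
    obtain ⟨y, hy⟩ := KPEmb.ker_subset (F.map (homOfLE hjk)) hxk
    refine ⟨y, ?_⟩
    have : ChainLimit.of F j y = ChainLimit.of F i x := by
      rw [← ChainLimit.of_chainMap F hik, ← ChainLimit.of_chainMap F hjk]
      exact congrArg _ hy
    exact this

theorem ChainLimit.isELAField : IsELAField (ChainLimit F) where
  algClosed := by
    refine IsAlgClosed.of_exists_root _ fun p _ hp => ?_
    -- The finitely many coefficients of `p` come from a common stage, which is algebraically
    -- closed.
    have hlift : ∃ j, p ∈ Polynomial.lifts (ChainLimit.of F j) := by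
      choose g x hx using fun n : p.support => ChainLimit.exists_of F (p.coeff n)
      obtain ⟨j, hj⟩ := Finite.exists_le g
      refine ⟨j, (Polynomial.lifts_iff_coeff_lifts p).2 fun n => ?_⟩
      by_cases hn : n ∈ p.support
      · refine ⟨chainMap F _ j (hj ⟨n, hn⟩) (x ⟨n, hn⟩), ?_⟩
        rw [ChainLimit.of_chainMap]
        exact (hx ⟨n, hn⟩).symm
      · rw [Polynomial.notMem_support_iff.1 hn]
        exact ⟨0, map_zero _⟩
    obtain ⟨j, q, rfl⟩ := hlift
    have := (F.obj j).isELA.algClosed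
    have hq : q.degree ≠ 0 := by
      have := Polynomial.degree_pos_of_irreducible hp
      rw [Polynomial.coe_mapRingHom, Polynomial.degree_map] at this
      exact this.ne'
    obtain ⟨x, hx⟩ := IsAlgClosed.exists_root q hq
    exact ⟨ChainLimit.of F j x, hx.map⟩
  log y hy := by
    obtain ⟨j, y, rfl⟩ := ChainLimit.exists_of F y
    obtain ⟨x, rfl⟩ := (F.obj j).isELA.log y fun h => hy (by rw [h, map_zero])
    exact ⟨_, ChainLimit.exp_of F j x⟩

def ChainLimit.obj : ELAF K where
  carrier := ChainLimit F
  isELA := ChainLimit.isELAField F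
  kernelType := (F.obj (Classical.arbitrary J)).kernelType.of_kpEmb
    (ChainLimit.emb F _) (F.obj _).isELA (ChainLimit.isELAField F)

def ChainLimit.cocone : Cocone F where
  pt := ChainLimit.obj F
  ι :=
    { app := fun j => ChainLimit.emb F j
      naturality := fun _ _ h => ELAF.hom_ext fun x => ChainLimit.of_chainMap F (leOfHom h) x }

def ChainLimit.desc (s : Cocone F) : KPEmb (ChainLimit F) s.pt.carrier where
  toRingHom := DirectLimit.Ring.lift (fun j => (F.obj j).carrier) (chainMap F) s.pt.carrier
    (fun j => (s.ι.app j : KPEmb _ _).toRingHom) fun i j h x =>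
      congrArg (fun f : F.obj i ⟶ s.pt => (f : KPEmb _ _) x) (s.w (homOfLE h))
  map_exp z := by
    obtain ⟨j, x, rfl⟩ := ChainLimit.exists_of F z
    exact (s.ι.app j : KPEmb _ _).map_exp x
  ker_subset z hz := by
    obtain ⟨x, hx⟩ := (s.ι.app (Classical.arbitrary J) : KPEmb _ _).ker_subset hz
    exact ⟨ChainLimit.of F _ x, hx⟩

def ChainLimit.isColimit : IsColimit (ChainLimit.cocone F) where
  desc s := ChainLimit.desc F s
  fac s j := ELAF.hom_ext fun x => rfl
  uniq s m h := ELAF.hom_ext fun z => by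
    obtain ⟨j, x, rfl⟩ := ChainLimit.exists_of F z
    exact congrArg (fun f : F.obj j ⟶ s.pt => (f : KPEmb _ _) x) (h j)

end Chain

theorem isAEC {K : Type u} [ExpField K] (hK : IsELAField K) : IsAEC (ELAF K) expRing where
  arrow_embedding := arrow_embedding
  iso_closed_obj := iso_closed_obj
  iso_closed_arrow := iso_closed_arrow
  coherence := coherence
  union_of_chain J _ _ _ F := ⟨ChainLimit.cocone F, ⟨ChainLimit.isColimit F⟩, fun x => by
    obtain ⟨j, y, rfl⟩ := ChainLimit.exists_of F x
    exact ⟨j, y, rfl⟩⟩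
  lowenheim_skolem := ⟨#(ker K), hK.aleph0_le_mk_ker, lowenheim_skolem⟩

end ELA

namespace ELA

open Cardinal Polynomial

/-! ### Extending specializations to algebraic elements. -/

section Place

/-- Lying over gives a maximal ideal `Q` of `B` above `ker ψ`. The field `B ⧸ Q` is integral over
the algebraically closed field `L`, hence equal to it, and the quotient map is the extension. -/
theorem exists_algHom_extending_of_isIntegral {L A B : Type*} [Field L] [IsAlgClosed L]
    [CommRing A] [CommRing B] [Algebra L A] [Algebra L B] [Algebra A B] [IsScalarTower L A B]
    [Algebra.IsIntegral A B] (hAB : Function.Injective (algebraMap A B)) (ψ : A →ₐ[L] L) :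
    ∃ φ : B →ₐ[L] L, ∀ a, φ (algebraMap A B a) = ψ a := by
  have hψ : Function.Surjective ψ := fun l => ⟨algebraMap L A l, by simp⟩
  have hmax : (RingHom.ker ψ).IsMaximal := RingHom.ker_isMaximal_of_surjective ψ hψ
  obtain ⟨Q, hQ, hQA⟩ := Ideal.exists_ideal_over_maximal_of_isIntegral (S := B) (RingHom.ker ψ)
    (by rw [(RingHom.injective_iff_ker_eq_bot _).1 hAB]; exact bot_le)
  let _ : Field (B ⧸ Q) := Ideal.Quotient.field Q
  have hmk : ∀ a : A, (Ideal.Quotient.mk Q) (algebraMap A B a) = algebraMap L (B ⧸ Q) (ψ a) := by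
    intro a
    have h1 : algebraMap L (B ⧸ Q) (ψ a) =
        Ideal.Quotient.mk Q (algebraMap A B (algebraMap L A (ψ a))) := by
      rw [← IsScalarTower.algebraMap_apply]
      rfl
    rw [h1, Ideal.Quotient.eq, ← map_sub, ← Ideal.mem_comap, hQA, RingHom.mem_ker]
    simp
  have hint : Algebra.IsIntegral L (B ⧸ Q) := by
    refine ⟨fun x => ?_⟩
    obtain ⟨b, rfl⟩ := Ideal.Quotient.mk_surjective x
    obtain ⟨p, hp, hpb⟩ := Algebra.IsIntegral.isIntegral (R := A) b
    refine ⟨p.map (ψ : A →+* L), hp.map _, ?_⟩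
    rw [Polynomial.eval₂_map]
    have : (algebraMap L (B ⧸ Q)).comp (ψ : A →+* L) =
        (Ideal.Quotient.mk Q).comp (algebraMap A B) := RingHom.ext fun a => (hmk a).symm
    rw [this, ← Polynomial.hom_eval₂, hpb, map_zero]
  have hbij := IsAlgClosed.algebraMap_bijective_of_isIntegral (k := L) (K := B ⧸ Q)
  let e : L ≃ₐ[L] (B ⧸ Q) := AlgEquiv.ofBijective (Algebra.ofId L (B ⧸ Q)) hbij
  refine ⟨(e.symm : (B ⧸ Q) →ₐ[L] L).comp (Ideal.Quotient.mkₐ L Q), fun a => ?_⟩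
  change e.symm (Ideal.Quotient.mk Q (algebraMap A B a)) = ψ a
  rw [hmk]
  exact e.symm_apply_apply (ψ a)

/-- Extension of a specialization to all elements satisfying a polynomial equation whose
leading coefficient does not vanish. -/
theorem exists_place {L Ω R : Type*} [Field L] [IsAlgClosed L] [Field Ω] [Algebra L Ω]
    [CommRing R] [Algebra L R] [Algebra R Ω] [IsScalarTower L R Ω]
    (hinj : Function.Injective (algebraMap R Ω)) (ψ : R →ₐ[L] L) :
    ∃ (O : Subalgebra L Ω) (φ : O →ₐ[L] L),
      ∀ (p : R[X]) (u : Ω), aeval u p = 0 → ψ p.leadingCoeff ≠ 0 →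
        ∃ h : u ∈ O, (p.map (ψ : R →+* L)).eval (φ ⟨u, h⟩) = 0 := by
  -- Inverting everything that `ψ` does not kill still leaves `ψ` defined, and makes the leading
  -- coefficients in question units.
  let S : Submonoid R := (nonZeroDivisors L).comap ψ
  have hS : ∀ s, s ∈ S ↔ ψ s ≠ 0 := fun s => mem_nonZeroDivisors_iff_ne_zero
  have hS1 : ∀ y : S, IsUnit (ψ y) := fun y => isUnit_iff_ne_zero.2 ((hS _).1 y.2)
  have hS2 : ∀ y : S, IsUnit (IsScalarTower.toAlgHom L R Ω y) := fun y =>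
    isUnit_iff_ne_zero.2 fun h => (hS _).1 y.2 <| by
      rw [(map_eq_zero_iff _ hinj).1 h, map_zero]
  let A := Localization S
  let ψ' : A →ₐ[L] L := IsLocalization.liftAlgHom (M := S) (f := ψ) hS1
  let j : A →ₐ[L] Ω := IsLocalization.liftAlgHom (M := S) (f := IsScalarTower.toAlgHom L R Ω) hS2
  have hj : ∀ r, j (algebraMap R A r) = algebraMap R Ω r := fun r => IsLocalization.lift_eq _ r
  have hψ' : ∀ r, ψ' (algebraMap R A r) = ψ r := fun r => IsLocalization.lift_eq _ r
  let _ : Algebra A Ω := j.toAlgebra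
  have : IsScalarTower L A Ω := IsScalarTower.of_algebraMap_eq' (AlgHom.comp_algebraMap j).symm
  have hjinj : Function.Injective (algebraMap A Ω) := by
    rw [injective_iff_map_eq_zero]
    intro a ha
    obtain ⟨⟨r, s⟩, hrs⟩ := IsLocalization.surj S a
    have h1 : algebraMap R Ω r = 0 := by
      rw [← hj, ← hrs, map_mul]
      change algebraMap A Ω a * _ = 0
      rw [ha, zero_mul]
    rw [(map_eq_zero_iff _ hinj).1 h1, map_zero] at hrs
    exact (IsLocalization.map_units A s).mul_left_eq_zero.1 hrs
  let B := integralClosure A Ω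
  have hB : Function.Injective (algebraMap A B) := fun x y h => hjinj <| congrArg Subtype.val h
  have : IsScalarTower L A B := inferInstance
  obtain ⟨φ, hφ⟩ := exists_algHom_extending_of_isIntegral hB ψ'
  refine ⟨B.restrictScalars L, φ, fun p u hu hp => ?_⟩
  let p' := p.map (algebraMap R A)
  have hp0 : p.leadingCoeff ∈ S := (hS _).2 hp
  have hunit : IsUnit (algebraMap R A p.leadingCoeff) := IsLocalization.map_units A ⟨_, hp0⟩
  have hu' : aeval u p' = 0 := by
    rw [Polynomial.aeval_def, Polynomial.eval₂_map]
    have : (algebraMap A Ω).comp (algebraMap R A) = algebraMap R Ω := RingHom.ext hj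
    rw [this]
    exact hu
  -- Dividing by the unit leading coefficient makes the equation monic, so `u` is integral over the
  -- localization.
  have h : u ∈ B := by
    obtain ⟨w, hw⟩ := hunit.exists_left_inv
    refine ⟨C w * p', ?_, ?_⟩
    · refine Polynomial.monic_of_natDegree_le_of_coeff_eq_one p.natDegree ?_ ?_
      · exact (Polynomial.natDegree_C_mul_le _ _).trans (Polynomial.natDegree_map_le)
      · rw [Polynomial.coeff_C_mul, Polynomial.coeff_map]
        exact hw
    · rw [← Polynomial.aeval_def, map_mul, hu', mul_zero]
  refine ⟨h, ?_⟩
  have h0 : aeval (⟨u, h⟩ : B) p' = 0 := by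
    apply Subtype.val_injective
    exact (Polynomial.aeval_algebraMap_apply Ω (⟨u, h⟩ : B) p').symm.trans hu'
  have h1 := congrArg φ h0
  rw [map_zero, Polynomial.aeval_def] at h1
  have h2 := Polynomial.hom_eval₂ p' (algebraMap A B) (φ : B →+* L) ⟨u, h⟩
  have h3 : (φ : B →+* L).comp (algebraMap A B) = (ψ' : A →+* L) := RingHom.ext hφ
  rw [h3] at h2
  have h4 : (ψ' : A →+* L).comp (algebraMap R A) = (ψ : R →+* L) := RingHom.ext hψ'
  rw [Polynomial.eval_map, ← h4, ← Polynomial.eval₂_map]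
  exact h2.symm.trans h1

end Place

/-! ### Specializations respecting fields of definition, and linear disjointness. -/

section Specialization

variable {Ω : Type u} [Field Ω] [CharZero Ω]

/-- The coefficients are formal polynomials in `X`, so that they can be moved from `N` to a larger
field and evaluated at other points. -/
theorem exists_polynomial_of_mem_acl {N : Subfield Ω} {X : Set Ω} {u : Ω}
    (hu : u ∈ acl ((N : Set Ω) ∪ X)) :
    ∃ p : (MvPolynomial X N)[X], p ≠ 0 ∧
      p.eval₂ (MvPolynomial.aeval (R := N) ((↑) : X → Ω)).toRingHom u = 0 := by
  have h1 : IsAlgebraic (Algebra.adjoin N X) u :=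
    isAlgebraic_of_subset (adjoin_int_union_subset N X) (mem_acl.1 hu)
  let f := MvPolynomial.aeval (R := N) ((↑) : X → Ω)
  have hf : f.range = Algebra.adjoin N X := by
    rw [← Algebra.adjoin_range_eq_range_aeval, Subtype.range_coe]
  let _ : Algebra (MvPolynomial X N) Ω := f.toAlgebra
  rw [← hf] at h1
  exact h1.of_ringHom_of_comp_eq f.rangeRestrict (RingHom.id Ω) f.rangeRestrict_surjective
    Function.injective_id rfl

/-- Specialization: elements algebraic over `X`, where `X` is independent over `L`, can be
specialized to `L` in a way that respects finitely many constraints on fields of definition. -/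
theorem exists_specialization (L : Subfield Ω) [IsAlgClosed L] {X : Set Ω}
    (hX : IndepOver (L : Set Ω) X) {ι : Type*} [Finite ι] (u : ι → Ω) (N : ι → Subfield Ω)
    (hN : ∀ i, N i ≤ L) (hN' : ∀ i, IsAlgClosed (N i))
    (hu : ∀ i, u i ∈ acl ((N i : Set Ω) ∪ X)) :
    ∃ (O : Subalgebra L Ω) (φ : O →ₐ[L] L), ∀ i, ∃ h : u i ∈ O, (φ ⟨u i, h⟩ : Ω) ∈ N i := by
  choose p hp hpu using fun i => exists_polynomial_of_mem_acl (hu i)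
  let inc : ∀ i, N i →+* L := fun i => Subfield.inclusion (hN i)
  let inc' : ∀ i, MvPolynomial X (N i) →+* MvPolynomial X L := fun i => MvPolynomial.map (inc i)
  have hinc' : ∀ i, Function.Injective (inc' i) := fun i =>
    MvPolynomial.map_injective _ (inc i).injective
  cases nonempty_fintype ι
  let c : MvPolynomial X L := ∏ i, inc' i (p i).leadingCoeff
  have hc : c ≠ 0 := Finset.prod_ne_zero_iff.2 fun i _ =>
    (map_ne_zero_iff _ (hinc' i)).2 (leadingCoeff_ne_zero.2 (hp i))
  -- The variables are sent to rationals because these lie in every `N i`; as there are infinitely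
  -- many, the product `c` of the leading coefficients can be kept nonzero.
  obtain ⟨q, hq⟩ : ∃ q : X → ℚ, MvPolynomial.eval (fun x => (q x : L)) c ≠ 0 := by
    by_contra! hcon
    refine hc ((MvPolynomial.funext_set_iff (fun _ => Set.range ((↑) : ℚ → L))
      fun _ => Set.infinite_range_of_injective Rat.cast_injective).2 fun x hx => ?_)
    choose q hq using fun i => hx i trivial
    have : x = fun i => (q i : L) := funext fun i => (hq i).symm
    rw [this, hcon, map_zero]
  let ψ : MvPolynomial X L →ₐ[L] L := MvPolynomial.aeval fun x => (q x : L)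
  have hψ : ∀ r, ψ r = MvPolynomial.eval (fun x => (q x : L)) r := fun r => by
    rw [← MvPolynomial.coe_aeval_eq_eval]
    rfl
  let ψN : ∀ i, MvPolynomial X (N i) →+* N i := fun i =>
    MvPolynomial.eval fun x => (q x : N i)
  have hψN : ∀ i, (ψ : MvPolynomial X L →+* L).comp (inc' i) = (inc i).comp (ψN i) := by
    intro i
    apply MvPolynomial.ringHom_ext
    · intro r
      simp [ψ, inc', ψN]
    · intro x
      simp [ψ, inc', ψN]
  let f : MvPolynomial X L →ₐ[L] Ω := MvPolynomial.aeval ((↑) : X → Ω)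
  have hf : Function.Injective f := (algebraicIndepOn_iff_indepOver L X).2 hX
  let _ : Algebra (MvPolynomial X L) Ω := f.toAlgebra
  have : IsScalarTower L (MvPolynomial X L) Ω :=
    IsScalarTower.of_algebraMap_eq' (AlgHom.comp_algebraMap f).symm
  obtain ⟨O, φ, hO⟩ := exists_place (Ω := Ω) hf ψ
  refine ⟨O, φ, fun i => ?_⟩
  have hlc : ((p i).map (inc' i)).leadingCoeff = inc' i (p i).leadingCoeff :=
    leadingCoeff_map_of_injective (hinc' i) _
  have hlc0 : ψ (inc' i (p i).leadingCoeff) ≠ 0 := by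
    rw [hψ]
    rw [map_prod] at hq
    exact Finset.prod_ne_zero_iff.1 hq i (Finset.mem_univ i)
  obtain ⟨h, h0⟩ := hO ((p i).map (inc' i)) (u i) (by
    rw [aeval_def, eval₂_map]
    have : (algebraMap (MvPolynomial X L) Ω).comp (inc' i) =
        (MvPolynomial.aeval (R := N i) ((↑) : X → Ω)).toRingHom := by
      apply MvPolynomial.ringHom_ext
      · intro r
        change f (MvPolynomial.map (inc i) (MvPolynomial.C r)) = _
        simp [f]
        rfl
      · intro x
        change f (MvPolynomial.map (inc i) (MvPolynomial.X x)) = _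
        simp [f]
    rw [this]
    exact hpu i) (by rwa [hlc])
  refine ⟨h, ?_⟩
  -- The specialized equation has coefficients in `N i` and a nonzero leading coefficient, so the
  -- value of `u i` is algebraic over the algebraically closed field `N i`.
  rw [map_map, hψN, ← map_map, eval_map] at h0
  have hN'i := hN' i
  rw [← acl_eq_of_isAlgClosed (N i)]
  refine mem_acl_of_isAlgebraic (r := N i) (subset_acl _) ⟨(p i).map (ψN i), fun hz => ?_, ?_⟩
  · have h1 : ψN i (p i).leadingCoeff = 0 := by
      have := congrArg (fun r => r.coeff (p i).natDegree) hz
      simpa using this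
    apply hlc0
    change ((ψ : MvPolynomial X L →+* L).comp (inc' i)) _ = 0
    rw [hψN, RingHom.comp_apply, h1, map_zero]
  · have h2 := congrArg (algebraMap L Ω) h0
    rw [Polynomial.hom_eval₂, map_zero] at h2
    exact h2

/-- A specialization `φ` that sends `u` into `N₁` and `v` into `N₂` fixes `u + v`, which lies in
`L`; hence `u + v = φ u + φ v`. -/
theorem exists_add_of_add_mem (L : Subfield Ω) [IsAlgClosed L] {X : Set Ω}
    (hX : IndepOver (L : Set Ω) X) {N₁ N₂ : Subfield Ω} (h₁ : N₁ ≤ L) (h₂ : N₂ ≤ L)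
    [IsAlgClosed N₁] [IsAlgClosed N₂] {u v : Ω} (hu : u ∈ acl ((N₁ : Set Ω) ∪ X))
    (hv : v ∈ acl ((N₂ : Set Ω) ∪ X)) (huv : u + v ∈ L) :
    ∃ a ∈ N₁, ∃ b ∈ N₂, u + v = a + b := by
  obtain ⟨O, φ, hφ⟩ := exists_specialization L hX ![u, v] ![N₁, N₂]
    (by simp [Fin.forall_fin_two, h₁, h₂])
    (by simp only [Fin.forall_fin_two]; exact ⟨‹_›, ‹_›⟩)
    (by simp only [Fin.forall_fin_two]; exact ⟨hu, hv⟩)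
  obtain ⟨hu', hu''⟩ := hφ 0
  obtain ⟨hv', hv''⟩ := hφ 1
  refine ⟨_, hu'', _, hv'', ?_⟩
  rw [← Subfield.coe_add, ← map_add]
  exact congrArg (fun l : L => (l : Ω)) (φ.commutes ⟨u + v, huv⟩).symm

theorem exists_mul_of_mul_mem (L : Subfield Ω) [IsAlgClosed L] {X : Set Ω}
    (hX : IndepOver (L : Set Ω) X) {N₁ N₂ : Subfield Ω} (h₁ : N₁ ≤ L) (h₂ : N₂ ≤ L)
    [IsAlgClosed N₁] [IsAlgClosed N₂] {u v : Ω} (hu : u ∈ acl ((N₁ : Set Ω) ∪ X))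
    (hv : v ∈ acl ((N₂ : Set Ω) ∪ X)) (huv : u * v ∈ L) :
    ∃ a ∈ N₁, ∃ b ∈ N₂, u * v = a * b := by
  obtain ⟨O, φ, hφ⟩ := exists_specialization L hX ![u, v] ![N₁, N₂]
    (by simp [Fin.forall_fin_two, h₁, h₂])
    (by simp only [Fin.forall_fin_two]; exact ⟨‹_›, ‹_›⟩)
    (by simp only [Fin.forall_fin_two]; exact ⟨hu, hv⟩)
  obtain ⟨hu', hu''⟩ := hφ 0
  obtain ⟨hv', hv''⟩ := hφ 1
  refine ⟨_, hu'', _, hv'', ?_⟩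
  rw [← Subfield.coe_mul, ← map_mul]
  exact congrArg (fun l : L => (l : Ω)) (φ.commutes ⟨u * v, huv⟩).symm

/-- Algebraic independence over an algebraically closed field implies linear disjointness. -/
theorem eq_zero_of_sum_mul_eq_zero {A B : Subfield Ω} {C : Subfield Ω} [IsAlgClosed A]
    [IsAlgClosed C] (hCA : C ≤ A) (h : Ind (A : Set Ω) B C) {ι : Type*}
    [Fintype ι] {a : ι → Ω} (ha : ∀ i, a i ∈ A) (hlin : LinearIndependent C a) {b : ι → Ω}
    (hb : ∀ i, b i ∈ B) (hsum : ∑ i, b i * a i = 0) (k : ι) : b k = 0 := by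
  by_contra hk
  obtain ⟨X, hXB, hX, hBX⟩ := exists_indepOver_basis (C : Set Ω) B
  have hXA : IndepOver (A : Set Ω) X :=
    (h.symm X hXB hX).mono_left (Set.subset_union_left.trans (subset_acl _))
  -- The coefficients are specialized from `B` to `C` with `A` fixed. Including the inverse of `b k`
  -- keeps the image of `b k` nonzero, so a nontrivial relation over `C` results.
  obtain ⟨O, φ, hφ⟩ := exists_specialization A hXA
    (fun i : Option ι => i.elim (b k)⁻¹ b) (fun _ => C) (fun _ => hCA) (fun _ => ‹_›)
    (by
      rintro (_ | i)
      · exact hBX (B.inv_mem (hb k))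
      · exact hBX (hb i))
  choose hO hC using hφ
  have h1 : (φ ⟨_, hO (some k)⟩ : Ω) * φ ⟨_, hO none⟩ = 1 := by
    rw [← Subfield.coe_mul, ← map_mul]
    have : (⟨_, hO (some k)⟩ : O) * ⟨_, hO none⟩ = 1 := Subtype.ext (mul_inv_cancel₀ hk)
    rw [this, map_one]
    rfl
  have h2 : ∑ i, (⟨(φ ⟨_, hO (some i)⟩ : Ω), hC (some i)⟩ : C) • a i = 0 := by
    have h3 : ∑ i, (⟨_, hO (some i)⟩ : O) * algebraMap A O ⟨a i, ha i⟩ = 0 := by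
      apply Subtype.val_injective
      rw [AddSubmonoidClass.coe_finsetSum]
      exact hsum
    have h4 := congrArg (fun z => (φ z : Ω)) h3
    simp only [map_sum, map_mul, AlgHom.commutes, map_zero] at h4
    rw [AddSubmonoidClass.coe_finsetSum] at h4
    exact h4
  have h5 := Fintype.linearIndependent_iff.1 hlin _ h2 k
  rw [show (φ ⟨_, hO (some k)⟩ : Ω) = 0 from congrArg Subtype.val h5, zero_mul] at h1
  exact zero_ne_one h1

end Specialization

end ELA

namespace ELA

open Cardinal TensorProduct

/-! ### Free embeddings into large algebraically closed fields. -/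

section FreeExtension

theorem mk_le_of_acl_eq_univ {Ω : Type u} [Field Ω] [CharZero Ω] {Z T : Set Ω}
    (h : Set.univ ⊆ (acl (Z ∪ T) : Set Ω)) (hΩ : ℵ₀ < #Ω) (hZ : #Z < #Ω) : #Ω ≤ #T := by
  by_contra! hT
  have h1 : #Ω ≤ max #(Z ∪ T : Set Ω) ℵ₀ := by
    rw [← mk_univ]
    exact (mk_le_mk_of_subset h).trans (mk_acl_le _)
  refine absurd h1 (not_le.2 (max_lt ((mk_union_le _ _).trans_lt ?_) hΩ))
  exact add_lt_of_lt hΩ.le hZ hT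

/-- A field containing a domain `R` embeds over `R` into a large algebraically closed field,
freely from a given small set. -/
theorem exists_free_embedding {R E Ω : Type u} [CommRing R] [IsDomain R] [Field E] [CharZero E]
    [Field Ω] [CharZero Ω] [IsAlgClosed Ω] (ρ : R →+* E) (hρ : Function.Injective ρ)
    (j : R →+* Ω) (hj : Function.Injective j) (hΩ : ℵ₀ < #Ω) (hE : #E ≤ #Ω) (Z : Set Ω)
    (hZ : #Z < #Ω) (hjZ : Set.range j ⊆ Z) :
    ∃ g : E →+* Ω, g.comp ρ = j ∧ Ind (Set.range g) Z (Set.range j) := by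
  let _ : Algebra R E := ρ.toAlgebra
  let _ : Algebra R Ω := j.toAlgebra
  have : FaithfulSMul R E := (faithfulSMul_iff_algebraMap_injective R E).2 hρ
  obtain ⟨S, hS⟩ := exists_isTranscendenceBasis R E
  obtain ⟨T, -, hT, hTΩ⟩ := exists_indepOver_basis Z Set.univ
  -- As `Z` is small, `T` has full size. The transcendence basis `S` of `E` can therefore be sent
  -- injectively into `T`, where its image is independent over `Z`.
  have hcard : #S ≤ #T := (mk_set_le S).trans (hE.trans (mk_le_of_acl_eq_univ hTΩ hΩ hZ))
  obtain ⟨t⟩ := hcard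
  let t' : S → Ω := fun s => t s
  have ht'inj : Function.Injective t' := Subtype.val_injective.comp t.injective
  have ht' : AlgebraicIndependent R t' := by
    let L := Subfield.closure Z
    let jL : R →+* L := j.codRestrict L fun r => Subfield.subset_closure (hjZ ⟨r, rfl⟩)
    let _ : Algebra R L := jL.toAlgebra
    have : IsScalarTower R L Ω := IsScalarTower.of_algebraMap_eq' rfl
    have h1 := (algebraicIndepOn_iff_indepOver L T).2 (indepOver_closure_iff.2 hT)
    exact (h1.comp t t.injective).restrictScalars fun x y h =>
      hj (congrArg (fun z : L => (z : Ω)) h)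
  let P := MvPolynomial S R
  let aE : P →ₐ[R] E := MvPolynomial.aeval ((↑) : S → E)
  let aΩ : P →ₐ[R] Ω := MvPolynomial.aeval t'
  let _ : Algebra P E := aE.toAlgebra
  let _ : Algebra P Ω := aΩ.toAlgebra
  have : FaithfulSMul P E := (faithfulSMul_iff_algebraMap_injective P E).2 hS.1
  have : FaithfulSMul P Ω := (faithfulSMul_iff_algebraMap_injective P Ω).2 ht'
  have halgS : ∀ e : E, IsAlgebraic (Algebra.adjoin R S) e := by
    have := hS.isAlgebraic
    rw [Subtype.range_coe] at this
    exact this.isAlgebraic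
  have hrange : aE.range = Algebra.adjoin R S := by
    rw [← Algebra.adjoin_range_eq_range_aeval, Subtype.range_coe]
  have : Algebra.IsAlgebraic P E := by
    refine ⟨fun e => ?_⟩
    have he := halgS e
    rw [← hrange] at he
    exact he.of_ringHom_of_comp_eq aE.rangeRestrict (RingHom.id E) aE.rangeRestrict_surjective
      Function.injective_id rfl
  -- `E` is algebraic over the polynomial ring `P` on its transcendence basis, so the choice of
  -- images of the basis extends.
  let g : E →ₐ[P] Ω := IsAlgClosed.lift
  have hg : ∀ p, g (aE p) = aΩ p := fun p => g.commutes p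
  have hgρ : ∀ r, g (ρ r) = j r := fun r => by
    have h1 := hg (algebraMap R P r)
    rwa [aE.commutes, aΩ.commutes] at h1
  refine ⟨g, RingHom.ext hgρ, ?_⟩
  have hgS : ∀ s : S, g s = t' s := fun s => by
    have h1 := hg (MvPolynomial.X s)
    rwa [show aE (MvPolynomial.X s) = s from MvPolynomial.aeval_X _ _,
      show aΩ (MvPolynomial.X s) = t' s from MvPolynomial.aeval_X _ _] at h1
  have hE' : Set.univ ⊆ (acl (Set.range ρ ∪ S) : Set E) := by
    intro e _
    refine mem_acl_of_isAlgebraic (r := Algebra.adjoin R S) (fun y hy => ?_) (halgS e)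
    induction hy using Algebra.adjoin_induction with
    | mem x hx => exact subset_acl _ (Or.inr hx)
    | algebraMap r => exact subset_acl _ (Or.inl ⟨r, rfl⟩)
    | add x y _ _ hx hy => exact (acl _).add_mem hx hy
    | mul x y _ _ hx hy => exact (acl _).mul_mem hx hy
  refine (ind_of_basis (S := Set.range t') ?_ ?_).symm
  · have h1 := (Set.image_mono hE').trans (image_acl_subset (g : E →+* Ω) (Set.range ρ ∪ S))
    rw [Set.image_univ, Set.image_union, ← Set.range_comp] at h1
    have h2 : (g : E →+* Ω) ∘ ρ = j := funext hgρ
    have h3 : (g : E →+* Ω) '' S = Set.range t' := by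
      ext x
      constructor
      · rintro ⟨s, hs, rfl⟩
        exact ⟨⟨s, hs⟩, (hgS ⟨s, hs⟩).symm⟩
      · rintro ⟨s, rfl⟩
        exact ⟨s, s.2, hgS s⟩
    rwa [h2, h3] at h1
  · rw [Set.union_eq_self_of_subset_right hjZ]
    refine hT.mono_right ?_
    rintro _ ⟨s, rfl⟩
    exact (t s).2

/-- In terms of a `C`-basis of `M₁`, an element of the kernel is a linear relation with coefficients
in `M₂` between elements independent over `C`; linear disjointness makes it trivial. -/
theorem productMap_injective {C M₁ M₂ E : Type u} [Field C] [Field M₁] [Field M₂] [Field E]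
    [CharZero E] [Algebra C M₁] [Algebra C M₂] [Algebra C E] [IsAlgClosed C] [IsAlgClosed M₁]
    (p₁ : M₁ →ₐ[C] E) (p₂ : M₂ →ₐ[C] E)
    (h : Ind (Set.range p₁) (Set.range p₂) (Set.range (algebraMap C E))) :
    Function.Injective (Algebra.TensorProduct.productMap p₂ p₁) := by
  let b := Module.Basis.ofVectorSpace C M₁
  let A := p₁.toRingHom.fieldRange
  let A₂ := p₂.toRingHom.fieldRange
  let C' := (algebraMap C E).fieldRange
  have : CharZero C := (algebraMap C E).charZero
  have : CharZero M₁ := p₁.toRingHom.charZero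
  have : IsAlgClosed A := isAlgClosed_fieldRange p₁.toRingHom
  have : IsAlgClosed C' := isAlgClosed_fieldRange (algebraMap C E)
  have hC'A : C' ≤ A := by
    rintro _ ⟨c, rfl⟩
    exact ⟨algebraMap C M₁ c, p₁.commutes c⟩
  have hlin : LinearIndependent C' fun i => p₁ (b i) := by
    refine b.linearIndependent.map_of_surjective_injective (algebraMap C E).rangeRestrictField
      p₁.toRingHom.toAddMonoidHom (algebraMap C E).rangeRestrictField_bijective.2
      (fun m hm => (map_eq_zero p₁).1 hm) fun r m => ?_
    change p₁ (r • m) = algebraMap C E r * p₁ m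
    rw [Algebra.smul_def, map_mul, p₁.commutes]
  rw [injective_iff_map_eq_zero]
  intro x hx
  obtain ⟨c, rfl⟩ := TensorProduct.eq_repr_basis_right b x
  have h1 : ∑ i : c.support, p₂ (c i) * p₁ (b i) = 0 := by
    rw [Finset.sum_coe_sort c.support fun i => p₂ (c i) * p₁ (b i), ← hx, Finsupp.sum, map_sum]
    exact Finset.sum_congr rfl fun k _ =>
      (Algebra.TensorProduct.productMap_apply_tmul p₂ p₁ (c k) (b k)).symm
  refine Finset.sum_eq_zero fun i hi => ?_
  have h2 : p₂ (c i) = 0 := eq_zero_of_sum_mul_eq_zero (A := A) (B := A₂) (C := C') hC'A h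
    (a := fun k : c.support => p₁ (b k)) (fun k => ⟨b k, rfl⟩)
    (hlin.comp _ Subtype.val_injective) (b := fun k => p₂ (c k)) (fun k => ⟨c k, rfl⟩)
    h1 ⟨i, hi⟩
  rw [(map_eq_zero p₂).1 h2]
  exact TensorProduct.zero_tmul _ _

/-- Two embeddings `g₁`, `g₂` of independent subfields `M₁`, `M₂` of `E` onto independent
subfields of `Ω` extend to `E`, freely from a given small set. -/
theorem exists_free_extension {C M₁ M₂ E Ω : Type u} [Field C] [Field M₁] [Field M₂] [Field E]
    [CharZero E] [Field Ω] [CharZero Ω] [IsAlgClosed Ω] [IsAlgClosed C] [IsAlgClosed M₁]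
    (c₁ : C →+* M₁) (c₂ : C →+* M₂) (p₁ : M₁ →+* E) (p₂ : M₂ →+* E)
    (hp : p₁.comp c₁ = p₂.comp c₂) (g₁ : M₁ →+* Ω) (g₂ : M₂ →+* Ω)
    (hg : g₁.comp c₁ = g₂.comp c₂)
    (hindp : Ind (Set.range p₁) (Set.range p₂) (Set.range (p₁.comp c₁)))
    (hindg : Ind (Set.range g₁) (Set.range g₂) (Set.range (g₁.comp c₁)))
    (hΩ : ℵ₀ < #Ω) (hE : #E < #Ω) (Z : Set Ω) (hZ : #Z < #Ω) :
    ∃ g : E →+* Ω, g.comp p₁ = g₁ ∧ g.comp p₂ = g₂ ∧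
      Ind (Set.range g) Z (Set.range g₁ ∪ Set.range g₂) := by
  let _ : Algebra C M₁ := c₁.toAlgebra
  let _ : Algebra C M₂ := c₂.toAlgebra
  let _ : Algebra C E := (p₁.comp c₁).toAlgebra
  let _ : Algebra C Ω := (g₁.comp c₁).toAlgebra
  let P₁ : M₁ →ₐ[C] E := ⟨p₁, fun _ => rfl⟩
  let P₂ : M₂ →ₐ[C] E := ⟨p₂, fun r => (RingHom.congr_fun hp r).symm⟩
  let G₁ : M₁ →ₐ[C] Ω := ⟨g₁, fun _ => rfl⟩
  let G₂ : M₂ →ₐ[C] Ω := ⟨g₂, fun r => (RingHom.congr_fun hg r).symm⟩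
  let ρ := Algebra.TensorProduct.productMap P₂ P₁
  let j := Algebra.TensorProduct.productMap G₂ G₁
  -- Both `E` and `Ω` contain the domain `M₂ ⊗[C] M₁` as the ring generated by the two subfields, so
  -- `g₁` and `g₂` agree to a single map on it, and `E` can be embedded freely over this ring.
  have hρ : Function.Injective ρ := productMap_injective P₁ P₂ hindp
  have hj : Function.Injective j := productMap_injective G₁ G₂ hindg
  have : IsDomain (M₂ ⊗[C] M₁) := hρ.isDomain ρ.toRingHom
  have hcard : #(Set.range j) < #Ω := by
    have h1 : #(M₂ ⊗[C] M₁) ≤ #E := mk_le_of_injective hρ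
    exact (mk_range_le.trans h1).trans_lt hE
  obtain ⟨g, hgρ, hind⟩ := exists_free_embedding ρ.toRingHom hρ j.toRingHom hj hΩ hE.le
    (Z ∪ Set.range j) ((mk_union_le _ _).trans_lt (add_lt_of_lt hΩ.le hZ hcard))
    Set.subset_union_right
  have hρ₁ : ∀ x, ρ (1 ⊗ₜ x) = p₁ x := fun x =>
    Algebra.TensorProduct.productMap_right_apply (f := P₂) (g := P₁) x
  have hρ₂ : ∀ x, ρ (x ⊗ₜ 1) = p₂ x := fun x =>
    Algebra.TensorProduct.productMap_left_apply (f := P₂) (g := P₁) x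
  have hj₁ : ∀ x, j (1 ⊗ₜ x) = g₁ x := fun x =>
    Algebra.TensorProduct.productMap_right_apply (f := G₂) (g := G₁) x
  have hj₂ : ∀ x, j (x ⊗ₜ 1) = g₂ x := fun x =>
    Algebra.TensorProduct.productMap_left_apply (f := G₂) (g := G₁) x
  refine ⟨g, RingHom.ext fun x => ?_, RingHom.ext fun x => ?_, ?_⟩
  · rw [RingHom.comp_apply, ← hρ₁, ← hj₁]
    exact RingHom.congr_fun hgρ _
  · rw [RingHom.comp_apply, ← hρ₂, ← hj₂]
    exact RingHom.congr_fun hgρ _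
  -- The base `Set.range j` may be replaced by the two ranges, as these generate it.
  · refine (hind.mono le_rfl ((Set.subset_union_left.trans Set.subset_union_left).trans
      (subset_acl _))).acl_base ?_
    apply SetLike.coe_injective
    refine Set.Subset.antisymm (acl_mono ?_) (acl_subset_iff.2 ?_)
    · rintro _ (⟨x, rfl⟩ | ⟨x, rfl⟩)
      · exact ⟨_, hj₁ x⟩
      · exact ⟨_, hj₂ x⟩
    · rintro _ ⟨x, rfl⟩
      change j x ∈ _
      induction x using TensorProduct.induction_on with
      | zero => rw [map_zero]; exact (acl _).zero_mem
      | add x y hx hy => rw [map_add]; exact (acl _).add_mem hx hy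
      | tmul x y =>
        have : x ⊗ₜ[C] y = (x ⊗ₜ 1) * (1 ⊗ₜ y) := by simp
        rw [this, map_mul, hj₁, hj₂]
        exact (acl _).mul_mem (subset_acl _ (Or.inr ⟨x, rfl⟩)) (subset_acl _ (Or.inl ⟨y, rfl⟩))

/-- Every field embeds into arbitrarily large algebraically closed fields. -/
theorem exists_large_algClosed (F : Type u) [Field F] (κ : Cardinal.{u}) :
    ∃ (Ω : Type u) (_ : Field Ω) (_ : IsAlgClosed Ω) (_ : F →+* Ω), κ < #Ω := by
  let T : Type u := (Order.succ κ).out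
  let Ω := AlgebraicClosure (FractionRing (MvPolynomial T F))
  let i : MvPolynomial T F →+* Ω :=
    (algebraMap (FractionRing (MvPolynomial T F)) Ω).comp (algebraMap _ _)
  have hi : Function.Injective i :=
    (RingHom.injective (algebraMap (FractionRing (MvPolynomial T F)) Ω)).comp
    (IsFractionRing.injective (MvPolynomial T F) (FractionRing (MvPolynomial T F)))
  refine ⟨Ω, inferInstance, inferInstance, i.comp MvPolynomial.C, ?_⟩
  have h1 : #T ≤ #Ω := mk_le_of_injective (hi.comp (MvPolynomial.X_injective))
  rw [mk_out] at h1
  exact (Order.lt_succ κ).trans_le h1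

end FreeExtension

end ELA

namespace ELA

open Cardinal

/-! ### Extending a partial exponential map without new kernel. -/

section Completion

/-- A uniquely divisible group is isomorphic to a rational vector space. -/
theorem exists_addEquiv_rat_module (W : Type u) [AddCommGroup W]
    (h : ∀ n : ℤ, n ≠ 0 → Function.Bijective fun w : W => n • w) :
    ∃ (W' : Type u) (_ : AddCommGroup W') (_ : Module ℚ W'), Nonempty (W' ≃+ W) := by
  have : IsLocalizedModule (nonZeroDivisors ℤ) (LinearMap.id : W →ₗ[ℤ] W) := by
    refine ⟨fun n => ?_, fun y => ⟨(y, 1), one_smul _ y⟩, fun {x y} hxy => ⟨1, ?_⟩⟩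
    · rw [Module.End.isUnit_iff]
      exact h n (nonZeroDivisors.ne_zero n.2)
    · rw [show x = y from hxy]
  let f := IsLocalizedModule.iso (nonZeroDivisors ℤ) (LinearMap.id : W →ₗ[ℤ] W)
  exact ⟨LocalizedModule (nonZeroDivisors ℤ) W, inferInstance,
    LocalizedModule.moduleOfIsLocalization, ⟨AddEquiv.mk f.toEquiv fun x y => f.map_add' x y⟩⟩

theorem rank_rat_eq_mk {V : Type u} [AddCommGroup V] [Module ℚ V] (h : ℵ₀ < #V) :
    Module.rank ℚ V = #V :=
  Module.Free.rank_eq_mk_of_infinite_lt ℚ V (by simpa using h)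

theorem mk_eq_of_mk_le_mul {κ α β : Cardinal.{u}} (hκ : ℵ₀ < κ) (hα : α < κ) (hβ : β ≤ κ)
    (h : κ ≤ α * β) : β = κ := by
  refine hβ.antisymm (not_lt.1 fun hlt => ?_)
  exact absurd h (not_le.2 (mul_lt_of_lt hκ.le hα hlt))

theorem mk_units_of_infinite {Ω : Type u} [Field Ω] (h : ℵ₀ < #Ω) : #Ωˣ = #Ω := by
  refine (mk_le_of_injective Units.val_injective).antisymm ?_
  by_contra! hlt
  have h1 : #Ω ≤ #(Option Ωˣ) := by
    classical
    refine mk_le_of_injective (f := fun x : Ω => if hx : x = 0 then none else some (Units.mk0 x hx))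
      fun x y hxy => ?_
    by_cases hx : x = 0 <;> by_cases hy : y = 0 <;> simp_all
  rw [mk_option] at h1
  exact absurd h1 (not_le.2 (add_lt_of_lt h.le hlt (one_lt_aleph0.trans h)))

theorem nsmul_units_surjective {Ω : Type u} [Field Ω] [IsAlgClosed Ω] {m : ℕ} (hm : m ≠ 0) :
    Function.Surjective fun x : Additive Ωˣ => m • x := by
  intro y
  obtain ⟨x, hx⟩ := IsAlgClosed.exists_pow_nat_eq (y.toMul : Ω) (Nat.pos_of_ne_zero hm)
  have hx0 : x ≠ 0 := fun h0 => y.toMul.ne_zero (by rw [← hx, h0, zero_pow hm])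
  exact ⟨Additive.ofMul (Units.mk0 x hx0), Additive.toMul.injective (Units.ext hx)⟩

/-- A partial exponential map on a large algebraically closed field, all of whose torsion values
are attained, extends to a surjective exponential map with the same kernel. -/
theorem exists_exp_extension {Ω P : Type u} [Field Ω] [CharZero Ω] [IsAlgClosed Ω]
    [AddCommGroup P] [Module ℚ P] (i : P →+ Ω) (e : P →+ Additive Ωˣ)
    (hie : ∀ p, i p = 0 → e p = 0)
    (htors : ∀ (ζ : Additive Ωˣ) (n : ℤ), n ≠ 0 → n • ζ = 0 → ∃ p, e p = ζ)
    (hΩ : ℵ₀ < #Ω) (hP : #P < #Ω) :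
    ∃ E : Ω →+ Additive Ωˣ, Function.Surjective E ∧ (∀ p, E (i p) = e p) ∧
      ∀ z, E z = 0 → ∃ p, i p = z ∧ e p = 0 := by
  let D := LinearMap.range i.toRatLinearMap
  obtain ⟨V, hDV⟩ := Submodule.exists_isCompl D
  let split := (Submodule.prodEquivOfIsCompl D V hDV).symm
  have hV : #V = #Ω := by
    refine mk_eq_of_mk_le_mul hΩ (α := #D) (lt_of_le_of_lt ?_ hP) (mk_subtype_le _) ?_
    · exact mk_range_le (f := i)
    · rw [mul_def]
      exact (mk_congr split.toEquiv).le
  let G := e.range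
  have hdivP : ∀ (p : P) (n : ℤ), n ≠ 0 → n • ((n : ℚ)⁻¹ • p) = p := fun p n hn => by
    rw [← Int.cast_smul_eq_zsmul ℚ, smul_smul, mul_inv_cancel₀ (Int.cast_ne_zero.2 hn), one_smul]
  have hG : ∀ (g : G) (n : ℤ), n ≠ 0 → ∃ g' : G, n • g' = g := by
    rintro ⟨_, p, rfl⟩ n hn
    refine ⟨⟨e ((n : ℚ)⁻¹ • p), _, rfl⟩, Subtype.ext ?_⟩
    change n • e _ = e p
    rw [← map_zsmul, hdivP p n hn]
  choose! div hdiv using hG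
  let _ : DivisibleBy G ℤ :=
    { div := fun g n => if n = 0 then 0 else div g n
      div_zero := fun g => if_pos rfl
      div_cancel := fun {n} g hn => by rw [if_neg hn]; exact hdiv g n hn }
  -- The group `G` of prescribed values is divisible, hence injective, hence a direct summand of
  -- `Ωˣ`; the kernel `W` of the retraction `r` is a complement.
  obtain ⟨r, hr⟩ := (Module.Baer.of_divisible G).extension_property_addMonoidHom
    G.subtype Subtype.val_injective (AddMonoidHom.id G)
  have hrG : ∀ g : G, r g = g := fun g => DFunLike.congr_fun hr g
  let W := r.ker
  have hsub : ∀ x, x - (r x : Additive Ωˣ) ∈ W := fun x => by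
    rw [AddMonoidHom.mem_ker, map_sub, hrG, sub_self]
  -- All torsion lies in `G` by `htors`, so `W` is torsion-free. It is divisible because roots exist
  -- in `Ω` and can be corrected by `r`.
  have hWbij : ∀ n : ℤ, n ≠ 0 → Function.Bijective fun w : W => n • w := by
    intro n hn
    refine ⟨?_, fun w => ?_⟩
    · intro x y hxy
      have h0 : n • ((x : Additive Ωˣ) - y) = 0 := by
        rw [zsmul_sub, sub_eq_zero]
        exact congrArg Subtype.val hxy
      obtain ⟨p, hp⟩ := htors _ n hn h0
      have h1 : r ((x : Additive Ωˣ) - y) = 0 := by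
        rw [map_sub, AddMonoidHom.mem_ker.1 x.2, AddMonoidHom.mem_ker.1 y.2, sub_zero]
      have h2 := hrG ⟨(x : Additive Ωˣ) - y, p, hp⟩
      rw [h1] at h2
      exact Subtype.ext (sub_eq_zero.1 (congrArg Subtype.val h2).symm)
    · have hroot : ∃ x : Additive Ωˣ, n • x = w := by
        obtain ⟨m, rfl | rfl⟩ := Int.eq_nat_or_neg n
        · obtain ⟨x, hx⟩ := nsmul_units_surjective (by simpa using hn : m ≠ 0) (w : Additive Ωˣ)
          exact ⟨x, by rw [natCast_zsmul]; exact hx⟩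
        · obtain ⟨x, hx⟩ := nsmul_units_surjective (by simpa using hn : m ≠ 0) (w : Additive Ωˣ)
          exact ⟨-x, by rw [neg_smul_neg, natCast_zsmul]; exact hx⟩
      obtain ⟨x, hx⟩ := hroot
      refine ⟨⟨x - r x, hsub x⟩, Subtype.ext ?_⟩
      change n • (x - (r x : Additive Ωˣ)) = w
      have h1 : n • (r x) = 0 := by rw [← map_zsmul, hx, AddMonoidHom.mem_ker.1 w.2]
      have h2 : n • (r x : Additive Ωˣ) = 0 := congrArg Subtype.val h1
      rw [zsmul_sub, hx, h2, sub_zero]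
  have hW : #W = #Ω := by
    have hU : #(Additive Ωˣ) = #Ω := mk_units_of_infinite hΩ
    refine mk_eq_of_mk_le_mul hΩ (α := #G) (lt_of_le_of_lt (mk_range_le (f := e)) hP)
      ((mk_subtype_le _).trans hU.le) ?_
    rw [mul_def, ← hU]
    refine mk_le_of_injective (f := fun x : Additive Ωˣ => ((r x, ⟨_, hsub x⟩) : G × W))
      fun x y hxy => ?_
    have h1 : r x = r y := congrArg Prod.fst hxy
    have h2 : x - (r x : Additive Ωˣ) = y - r y := congrArg (fun z => (z.2 : Additive Ωˣ)) hxy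
    rw [h1] at h2
    exact sub_left_injective h2
  obtain ⟨W', _, _, ⟨eW⟩⟩ := exists_addEquiv_rat_module W hWbij
  have hW' : #W' = #Ω := (mk_congr eW.toEquiv).trans hW
  -- Uncountable rational vector spaces of equal cardinality have equal dimension.
  obtain ⟨eV⟩ : Nonempty (V ≃ₗ[ℚ] W') := by
    rw [Module.nonempty_linearEquiv_iff_rank_eq, rank_rat_eq_mk (hV.symm ▸ hΩ),
      rank_rat_eq_mk (hW'.symm ▸ hΩ), hV, hW']
  let θ : V ≃+ W := eV.toAddEquiv.trans eW
  choose s hs using fun x : D => x.2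
  have hs' : ∀ x : D, i (s x) = x := hs
  have hse : ∀ (x : D) (p : P), i p = x → e (s x) = e p := fun x p hp => by
    rw [← sub_eq_zero, ← map_sub]
    exact hie _ (by rw [map_sub, hs', hp, sub_self])
  let d : D →+ Additive Ωˣ :=
    { toFun := fun x => e (s x)
      map_zero' := by rw [hse 0 0 (map_zero i), map_zero]
      map_add' := fun x y => by
        rw [hse (x + y) (s x + s y) (by rw [map_add, hs', hs']; rfl), map_add] }
  -- Prescribed on `D`, and an isomorphism from `V` onto `W`. Since `G` and `W` meet trivially, all
  -- kernel comes from `D`.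
  let E : Ω →+ Additive Ωˣ :=
    (d.coprod (W.subtype.comp θ.toAddMonoidHom)).comp split.toLinearMap.toAddMonoidHom
  have hE : ∀ (x : D) (v : V), E (x + v) = e (s x) + θ v := fun x v => by
    have : split ((x : Ω) + v) = (x, v) := by
      rw [LinearEquiv.symm_apply_eq, Submodule.coe_prodEquivOfIsCompl']
    change (d.coprod (W.subtype.comp θ.toAddMonoidHom)) (split ((x : Ω) + v)) = _
    rw [this]
    rfl
  have hdec : ∀ z : Ω, ∃ (x : D) (v : V), z = x + v := fun z =>
    ⟨(split z).1, (split z).2, ((Submodule.prodEquivOfIsCompl D V hDV).apply_symm_apply z).symm⟩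
  refine ⟨E, fun y => ?_, fun p => ?_, fun z hz => ?_⟩
  · obtain ⟨p, hp⟩ := (r y).2
    refine ⟨i p + θ.symm ⟨_, hsub y⟩, ?_⟩
    have h1 := hE ⟨i p, p, rfl⟩ (θ.symm ⟨_, hsub y⟩)
    rw [hse _ p rfl, θ.apply_symm_apply, hp] at h1
    exact h1.trans (add_sub_cancel _ _)
  · have h1 := hE ⟨i p, p, rfl⟩ 0
    rw [hse _ p rfl, map_zero] at h1
    simpa using h1
  · obtain ⟨x, v, rfl⟩ := hdec z
    rw [hE] at hz
    have h1 := congrArg r hz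
    rw [map_add, AddMonoidHom.mem_ker.1 (θ v).2, add_zero, map_zero,
      hrG ⟨e (s x), s x, rfl⟩] at h1
    have h2 : e (s x) = 0 := congrArg Subtype.val h1
    rw [h2, zero_add] at hz
    have h3 : v = 0 := by
      rw [← θ.map_eq_zero_iff]
      exact Subtype.ext hz
    exact ⟨s x, by rw [hs', h3]; simp, h2⟩

end Completion

end ELA

namespace ELA

open Cardinal CategoryTheory

variable {K : Type u} [ExpField K]

/-! ### Completing partial exponentials to objects; independent amalgams and Extension. -/

section Maps

/-- The ring homomorphism underlying an arrow. -/
abbrev ELAF.ringHom {M N : ELAF K} (f : M ⟶ N) : M.carrier →+* N.carrier :=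
  (ExpEmb.toRingHom (KPEmb.toExpEmb f))

theorem ELAF.ringHom_exp {M N : ELAF K} (f : M ⟶ N) (x : M.carrier) :
    ELAF.ringHom f (exp x) = exp (ELAF.ringHom f x) := KPEmb.map_exp' f x

theorem ELAF.exp_eq_one_iff {M N : ELAF K} (f : M ⟶ N) {x : M.carrier} :
    exp (ELAF.ringHom f x) = 1 ↔ exp x = 1 := ExpEmb.exp_eq_one_iff (KPEmb.toExpEmb f)

/-- `M` contains one logarithm of `y`, and any other in `N` differs from it by a kernel element,
which also comes from `M`. -/
theorem ELAF.exists_of_exp_eq {M N : ELAF K} (f : M ⟶ N) {x : N.carrier} {y : M.carrier}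
    (h : exp x = ELAF.ringHom f y) : ∃ m, ELAF.ringHom f m = x ∧ exp m = y := by
  obtain ⟨m, rfl⟩ := M.isELA.log y fun h0 => by simp [h0, exp_ne_zero] at h
  rw [ELAF.ringHom_exp, exp_eq_exp_iff] at h
  obtain ⟨k, hk⟩ := KPEmb.ker_subset (show KPEmb M.carrier N.carrier from f) h
  have hk' : ELAF.ringHom f k = x - ELAF.ringHom f m := hk
  have hk1 : exp k = 1 := by
    rw [← ELAF.exp_eq_one_iff f, hk']
    exact h
  exact ⟨m + k, by rw [map_add, hk', add_sub_cancel], by rw [exp_add, hk1, mul_one]⟩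

/-- Independence between ranges of arrows, in field-theoretic terms. -/
theorem elaIndep_range_iff {M M₁ M₂ N : ELAF K} (g₁ : M₁ ⟶ N) (g₂ : M₂ ⟶ N) (f : M ⟶ M₁)
    (f' : M ⟶ M₂) (h : f ≫ g₁ = f' ≫ g₂) :
    elaIndep K N (Set.range g₁) (Set.range g₂) (Set.range (f ≫ g₁)) ↔
      Ind (Set.range (ELAF.ringHom g₁)) (Set.range (ELAF.ringHom g₂))
        (Set.range (ELAF.ringHom (f ≫ g₁))) := by
  have h₁ : Set.range (f ≫ g₁) ⊆ Set.range g₁ := by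
    rintro _ ⟨x, rfl⟩
    exact ⟨f x, rfl⟩
  have h₂ : Set.range (f ≫ g₁) ⊆ Set.range g₂ := by
    rw [h]
    rintro _ ⟨x, rfl⟩
    exact ⟨f' x, rfl⟩
  have e₁ := KPEmb.elaClosure_range g₁ M₁.isELA N.isELA
  have e₂ := KPEmb.elaClosure_range g₂ M₂.isELA N.isELA
  have e₀ := KPEmb.elaClosure_range (f ≫ g₁) M.isELA N.isELA
  change ElaIndep _ _ _ ↔ _
  rw [elaIndep_iff_ind, Set.union_eq_self_of_subset_right h₁, Set.union_eq_self_of_subset_right h₂]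
  erw [e₁, e₂, e₀]
  rfl

/-- The exponential map as a homomorphism of additive groups. -/
def expAdd (F : Type u) [ExpField F] : F →+ Additive Fˣ where
  toFun x := Additive.ofMul (ExpField.expHom (F := F) (Multiplicative.ofAdd x))
  map_zero' := map_one (ExpField.expHom (F := F))
  map_add' x y := map_mul (ExpField.expHom (F := F)) (.ofAdd x) (.ofAdd y)

variable {F Ω : Type u} [ExpField F] [Field Ω]

/-- The exponential map followed by a field embedding. -/
def mapExp (g : F →+* Ω) : F →+ Additive Ωˣ :=
  (Units.map (g : F →* Ω)).toAdditive.comp (expAdd F)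

theorem eq_zero_iff_coe_eq_one {u : Additive Ωˣ} : u = 0 ↔ ((u.toMul : Ωˣ) : Ω) = 1 :=
  Units.val_eq_one.symm

theorem range_eq_image_of_forall {X N : Type u} [Field X] [Field N] {φ : Ω ≃+* N} {k : X →+* Ω}
    {l : X →+* N} (h : ∀ x, l x = φ (k x)) : Set.range l = (φ : Ω →+* N) '' Set.range k := by
  rw [← Set.range_comp]
  exact congrArg Set.range (funext h)

theorem ELAF.exists_add_of_exp_eq {M N : ELAF K} (f : M ⟶ N) {x y : N.carrier}
    (h : exp x = exp y) : ∃ m, x = y + ELAF.ringHom f m := by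
  obtain ⟨m, hm⟩ := KPEmb.ker_subset (show KPEmb M.carrier N.carrier from f) (exp_eq_exp_iff.1 h)
  exact ⟨m, eq_add_of_sub_eq' hm.symm⟩

end Maps

/-- Roots of unity lie in every algebraically closed subfield. -/
theorem exists_eq_of_zsmul_eq_zero {F Ω : Type u} [Field F] [CharZero F] [IsAlgClosed F] [Field Ω]
    [CharZero Ω] [IsAlgClosed Ω] (g : F →+* Ω) {ζ : Additive Ωˣ} {n : ℤ} (hn : n ≠ 0)
    (hζ : n • ζ = 0) : ∃ y, g y = (ζ.toMul : Ωˣ) := by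
  have := isAlgClosed_fieldRange g
  change ((ζ.toMul : Ωˣ) : Ω) ∈ (g.fieldRange : Set Ω)
  rw [← acl_eq_of_isAlgClosed g.fieldRange, SetLike.mem_coe, mem_acl_iff]
  have hm : ((ζ.toMul : Ωˣ) : Ω) ^ n.natAbs = 1 := by
    have : n.natAbs • ζ = 0 := by
      rw [← natCast_zsmul]
      obtain h | h := Int.natAbs_eq n
      · rw [← h, hζ]
      · rw [← neg_eq_zero, ← neg_zsmul, ← h, hζ]
    exact congrArg (fun u : Additive Ωˣ => ((u.toMul : Ωˣ) : Ω)) this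
  refine IsAlgebraic.of_pow (Int.natAbs_pos.2 hn) ?_
  rw [hm]
  exact isAlgebraic_one

/-- A field carrying a partial exponential map extends to an object of the category. -/
theorem exists_completion {M : ELAF K} {Ω P : Type u} [Field Ω] [CharZero Ω] [IsAlgClosed Ω]
    [AddCommGroup P] [Module ℚ P] (i : P →+ Ω) (e : P →+ Additive Ωˣ) (g₀ : M.carrier →+* Ω)
    (hg₀ : ∀ x, ∃ p, i p = g₀ x ∧ ((e p).toMul : Ω) = g₀ (exp x))
    (hie : ∀ p, i p = 0 → ((e p).toMul : Ω) = 1)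
    (hker : ∀ p, ((e p).toMul : Ω) = 1 → i p ∈ Set.range g₀)
    (hΩ : ℵ₀ < #Ω) (hP : #P < #Ω) :
    ∃ (N : ELAF K) (φ : Ω ≃+* N.carrier), (∀ p, exp (φ (i p)) = φ (e p).toMul) ∧
      ∀ (M' : ELAF K) (g : M'.carrier →+* Ω),
        (∀ x, ∃ p, i p = g x ∧ ((e p).toMul : Ω) = g (exp x)) → Set.range g₀ ⊆ Set.range g →
        ∃ f : M' ⟶ N, ∀ x, ELAF.ringHom f x = φ (g x) := by
  -- Roots of unity lie in the image of `M`, where they have logarithms.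
  have htors : ∀ (ζ : Additive Ωˣ) (n : ℤ), n ≠ 0 → n • ζ = 0 → ∃ p, e p = ζ := by
    have := M.isELA.algClosed
    intro ζ n hn hζ
    obtain ⟨y, hy⟩ := exists_eq_of_zsmul_eq_zero g₀ hn hζ
    obtain ⟨x, rfl⟩ := M.isELA.log y fun h0 => ζ.toMul.ne_zero (by rw [← hy, h0, map_zero])
    obtain ⟨p, -, hp⟩ := hg₀ x
    exact ⟨p, Additive.toMul.injective (Units.ext (hp.trans hy))⟩
  obtain ⟨E, hE, hEi, hEk⟩ := exists_exp_extension i e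
    (fun p hp => eq_zero_iff_coe_eq_one.2 (hie p hp)) htors hΩ hP
  let inst : ExpField Ω := ExpField.ofExp Ω (fun x => ((E x).toMul : Ωˣ))
    (by rw [map_zero]; rfl) fun x y => by rw [map_add]; rfl
  have hexp : ∀ x : Ω, exp x = ((E x).toMul : Ω) := fun x => rfl
  have hela : IsELAField Ω := ⟨inferInstance, fun y hy => by
    obtain ⟨x, hx⟩ := hE (Additive.ofMul (Units.mk0 y hy))
    exact ⟨x, by rw [hexp, hx]; rfl⟩⟩
  have hkp : ∀ (M' : ELAF K) (g : M'.carrier →+* Ω),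
      (∀ x, ∃ p, i p = g x ∧ ((e p).toMul : Ω) = g (exp x)) → Set.range g₀ ⊆ Set.range g →
      ∃ f : KPEmb M'.carrier Ω, f.toRingHom = g := by
    intro M' g hg hr
    refine ⟨⟨⟨g, fun x => ?_⟩, fun z hz => hr ?_⟩, rfl⟩
    · obtain ⟨p, hp, hp'⟩ := hg x
      change g (exp x) = exp (g x)
      rw [← hp', ← hp, hexp, hEi]
    -- The kernel of the completed exponential comes from that of `e`, which `hker` places in the
    -- image of `M`; so any embedding whose range contains this image preserves the kernel.
    · obtain ⟨p, rfl, hp⟩ := hEk z (eq_zero_iff_coe_eq_one.2 hz)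
      exact hker p (eq_zero_iff_coe_eq_one.1 hp)
  obtain ⟨f₀, -⟩ := hkp M g₀ hg₀ subset_rfl
  refine ⟨⟨Ω, hela, M.kernelType.of_kpEmb f₀ M.isELA hela⟩, RingEquiv.refl Ω, fun p => ?_,
    fun M' g hg hr => ?_⟩
  · change exp (i p) = _
    rw [hexp, hEi]
    rfl
  · obtain ⟨f, hf⟩ := hkp M' g hg hr
    exact ⟨f, fun x => DFunLike.congr_fun hf x⟩

/-- `B` is put into a huge field, and `A` is then embedded over `C` freely from it. -/
theorem exists_indep_fieldAmalgam {C A B : Type u} [Field C] [Field A] [CharZero A] [Field B]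
    [CharZero B] (c : C →+* A) (c' : C →+* B) (κ : Cardinal.{u}) :
    ∃ (Ω : Type u) (_ : Field Ω) (_ : CharZero Ω) (_ : IsAlgClosed Ω) (g : A →+* Ω) (g' : B →+* Ω),
      g.comp c = g'.comp c' ∧ Ind (Set.range g) (Set.range g') (Set.range (g.comp c)) ∧
      max ℵ₀ (max κ (max #A #B)) < #Ω := by
  obtain ⟨Ω, _, _, r, hr⟩ := exists_large_algClosed B (max ℵ₀ (max κ (max #A #B)))
  have : CharZero Ω := charZero_of_injective_ringHom r.injective
  have h1 : ℵ₀ < #Ω := (le_max_left _ _).trans_lt hr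
  have h2 : max #A #B < #Ω := ((le_max_right _ _).trans (le_max_right _ _)).trans_lt hr
  obtain ⟨g, hg, hind⟩ := exists_free_embedding c c.injective (r.comp c')
    (r.comp c').injective h1 ((le_max_left _ _).trans h2.le) (Set.range r)
    (mk_range_le.trans_lt ((le_max_right _ _).trans_lt h2))
    (by rintro _ ⟨x, rfl⟩; exact ⟨c' x, rfl⟩)
  exact ⟨Ω, ‹_›, ‹_›, ‹_›, g, r, hg, hg ▸ hind, hr⟩

theorem Ind.exists_of_eq {C A B Ω : Type u} [Field C] [CharZero C] [IsAlgClosed C] [Field A] [Field B]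
    [Field Ω] [CharZero Ω] [IsAlgClosed Ω] {c : C →+* A} {g : A →+* Ω} {g' : B →+* Ω}
    (h : Ind (Set.range g) (Set.range g') (Set.range (g.comp c))) {x : A} {y : B}
    (hxy : g x = g' y) : ∃ m, c m = x := by
  have := isAlgClosed_fieldRange (g.comp c)
  have h1 : g x ∈ (acl ((g.comp c).fieldRange : Set Ω) : Set Ω) := by
    rw [RingHom.coe_fieldRange]
    exact h.inter_subset ⟨⟨x, rfl⟩, ⟨y, hxy.symm⟩⟩
  rw [acl_eq_of_isAlgClosed] at h1
  obtain ⟨m, hm⟩ := h1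
  exact ⟨m, g.injective hm⟩

section FieldAmalgam

variable {M A B : ELAF K} {Ω : Type u} [Field Ω] [CharZero Ω] [IsAlgClosed Ω] {c : M ⟶ A}
  {c' : M ⟶ B} {g : A.carrier →+* Ω} {g' : B.carrier →+* Ω}

theorem Ind.exists_ringHom_eq
    (h : Ind (Set.range g) (Set.range g') (Set.range (g.comp (ELAF.ringHom c))))
    (hc : ∀ m, g (ELAF.ringHom c m) = g' (ELAF.ringHom c' m)) {x : A.carrier} {y : B.carrier}
    (hxy : g x = g' y) : ∃ m, ELAF.ringHom c m = x ∧ ELAF.ringHom c' m = y := by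
  have := M.isELA.algClosed
  obtain ⟨m, rfl⟩ := h.exists_of_eq hxy
  exact ⟨m, rfl, g'.injective (by rw [← hc, hxy])⟩

/-- This makes the joint exponential on `g(A) + g'(B)` well defined: if a sum vanishes, both terms
lie in the common part `M`, where the two exponentials agree. -/
theorem Ind.exp_mul_exp_eq_one
    (h : Ind (Set.range g) (Set.range g') (Set.range (g.comp (ELAF.ringHom c))))
    (hc : ∀ m, g (ELAF.ringHom c m) = g' (ELAF.ringHom c' m)) {x : A.carrier} {y : B.carrier}
    (hxy : g x + g' y = 0) : g (exp x) * g' (exp y) = 1 := by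
  rw [add_eq_zero_iff_eq_neg, ← map_neg] at hxy
  obtain ⟨m, rfl, hm⟩ := h.exists_ringHom_eq hc hxy
  rw [← neg_eq_iff_eq_neg.2 hm, ← ELAF.ringHom_exp, hc, exp_neg, ← ELAF.ringHom_exp, ← map_mul,
    mul_inv_cancel₀, map_one]
  rw [Ne, map_eq_zero]
  exact exp_ne_zero m

/-- This shows that the joint exponential has no kernel outside `M`: both factors lie in `M`, so
their logarithms do as well. -/
theorem Ind.add_mem_range
    (h : Ind (Set.range g) (Set.range g') (Set.range (g.comp (ELAF.ringHom c))))
    (hc : ∀ m, g (ELAF.ringHom c m) = g' (ELAF.ringHom c' m)) {x : A.carrier} {y : B.carrier}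
    (hxy : g (exp x) * g' (exp y) = 1) : g x + g' y ∈ Set.range (g.comp (ELAF.ringHom c)) := by
  have hy : g' (exp y) ≠ 0 := by simp [exp_ne_zero]
  rw [mul_eq_one_iff_eq_inv₀ hy, ← map_inv₀, ← exp_neg] at hxy
  obtain ⟨m, hm, hm'⟩ := h.exists_ringHom_eq hc hxy
  obtain ⟨a, rfl, -⟩ := ELAF.exists_of_exp_eq c hm.symm
  obtain ⟨b, hb, -⟩ := ELAF.exists_of_exp_eq c' hm'.symm
  refine ⟨a - b, ?_⟩
  rw [map_sub, RingHom.comp_apply, RingHom.comp_apply, hc b, hb, map_neg, sub_neg_eq_add]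

end FieldAmalgam

/-- Any two extensions of an object can be amalgamated independently. -/
theorem exists_indep_amalgam {M A B : ELAF K} (c : M ⟶ A) (c' : M ⟶ B) :
    ∃ (N : ELAF K) (g : A ⟶ N) (g' : B ⟶ N), c ≫ g = c' ≫ g' ∧
      elaIndep K N (Set.range g) (Set.range g') (Set.range (c ≫ g)) := by
  obtain ⟨Ω, _, _, _, g, g', hcg, hind, hΩ⟩ :=
    exists_indep_fieldAmalgam (ELAF.ringHom c) (ELAF.ringHom c') 0
  have hcg' : ∀ m, g (ELAF.ringHom c m) = g' (ELAF.ringHom c' m) := DFunLike.congr_fun hcg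
  have h0 : ℵ₀ < #Ω := (le_max_left _ _).trans_lt hΩ
  have h2 : max #A.carrier #B.carrier < #Ω :=
    ((le_max_right _ _).trans (le_max_right _ _)).trans_lt hΩ
  -- The partial exponential sends `g x + g' y` to `g (exp x) * g' (exp y)`, as it must if both
  -- embeddings are to respect `exp`.
  let i : A.carrier × B.carrier →+ Ω := g.toAddMonoidHom.coprod g'.toAddMonoidHom
  let e : A.carrier × B.carrier →+ Additive Ωˣ := (mapExp g).coprod (mapExp g')
  have hi : ∀ x y, i (x, y) = g x + g' y := fun _ _ => rfl
  have he : ∀ x y, ((e (x, y)).toMul : Ω) = g (exp x) * g' (exp y) := fun _ _ => rfl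
  have hA : ∀ x, ∃ p, i p = g x ∧ ((e p).toMul : Ω) = g (exp x) := fun x =>
    ⟨(x, 0), by rw [hi, map_zero, add_zero], by rw [he, exp_zero, map_one, mul_one]⟩
  have hB : ∀ y, ∃ p, i p = g' y ∧ ((e p).toMul : Ω) = g' (exp y) := fun y =>
    ⟨(0, y), by rw [hi, map_zero, zero_add], by rw [he, exp_zero, map_one, one_mul]⟩
  obtain ⟨N, φ, -, hN⟩ := exists_completion (M := M) i e (g.comp (ELAF.ringHom c))
    (fun x => by
      obtain ⟨p, hp⟩ := hA (ELAF.ringHom c x)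
      exact ⟨p, hp.1, by rw [hp.2, ← ELAF.ringHom_exp]; rfl⟩)
    (fun p => hind.exp_mul_exp_eq_one hcg') (fun p => hind.add_mem_range hcg')
    h0 (by
      rw [mk_prod, lift_id, lift_id]
      exact mul_lt_of_lt h0.le ((le_max_left _ _).trans_lt h2) ((le_max_right _ _).trans_lt h2))
  obtain ⟨f, hf⟩ := hN A g hA (by rintro _ ⟨x, rfl⟩; exact ⟨_, rfl⟩)
  obtain ⟨f', hf'⟩ := hN B g' hB (by rintro _ ⟨x, rfl⟩; exact ⟨_, (hcg' x).symm⟩)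
  have hc : c ≫ f = c' ≫ f' := ELAF.hom_ext fun x => by
    change ELAF.ringHom f (ELAF.ringHom c x) = ELAF.ringHom f' (ELAF.ringHom c' x)
    rw [hf, hf', hcg']
  refine ⟨N, f, f', hc, (elaIndep_range_iff f f' c c' hc).2 ?_⟩
  rw [range_eq_image_of_forall hf, range_eq_image_of_forall hf',
    range_eq_image_of_forall (k := g.comp (ELAF.ringHom c)) (l := ELAF.ringHom (c ≫ f))
      fun x => hf _]
  exact (ind_image_iff _).2 hind

theorem hasAmalgamation : HasAmalgamation (ELAF K) := fun f f' => by
  obtain ⟨N, g, g', h, -⟩ := exists_indep_amalgam f f'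
  exact ⟨N, g, g', h⟩

/-- `M` is amalgamated independently with itself over the closure of `B ∪ D`. The new tuple is the
second copy of `a`, while `B'` stays in the first copy; the Galois type is kept because the copies
agree on `B ∪ D`. -/
theorem extension_elaIndep : Extension (elaIndep K) := by
  intro M ι a B B' D hind hBB'
  obtain ⟨N, f, g, hfg, hN⟩ := exists_indep_amalgam
    (M.closureInclusion (B ∪ D)) (M.closureInclusion (B ∪ D))
  have hBD : ∀ x ∈ B ∪ D, f x = g x := fun x hx => by
    have := congrArg (fun k : M.closure (B ∪ D) ⟶ N =>
      ELAF.ringHom k ⟨x, subset_elaClosure _ hx⟩) hfg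
    exact this
  have hI := (isIndependenceRelation_elaIndep (K := K)).basic N
  refine ⟨N, f, fun j => g (a j), ?_, N, 𝟙 N, g, ?_⟩
  · have hr : Set.range (fun j => g (a j)) = g '' Set.range a := Set.range_comp g a
    have e₁ : g '' B = f '' B := Set.image_congr fun x hx => (hBD x (Or.inl hx)).symm
    have e₂ : g '' D = f '' D := Set.image_congr fun x hx => (hBD x (Or.inr hx)).symm
    have h1 := ((isIndependenceRelation_elaIndep (K := K)).invariance g _ _ _).1 hind
    rw [e₁, e₂, ← hr] at h1
    have h2 := hI.normality _ _ _ h1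
    -- Independence from `B ∪ D` over `D` is inherited from `a`; the amalgam supplies independence
    -- from `B'` over `B ∪ D`.
    refine hI.transitivity _ _ _ _ Set.subset_union_right h2 ?_
    have h3 := (elaIndep_range_iff f g _ _ hfg).1 hN
    have hg := KPEmb.elaClosure_range g M.isELA N.isELA
    have hf := KPEmb.elaClosure_range f M.isELA N.isELA
    have hcl : (elaClosure (f '' B ∪ f '' D) : Set N.carrier) =
        Set.range (ELAF.ringHom (M.closureInclusion (B ∪ D) ≫ f)) := by
      have h4 := KPEmb.image_elaClosure f M.isELA N.isELA (B ∪ D)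
      rw [Set.image_union] at h4
      refine h4.symm.trans ?_
      rw [← ELAF.range_closureInclusion, ← Set.range_comp]
      rfl
    have hBDg : f '' B ∪ f '' D ⊆ Set.range (ELAF.ringHom g) :=
      Set.union_subset (e₁ ▸ Set.image_subset_range _ _) (e₂ ▸ Set.image_subset_range _ _)
    refine elaIndep_iff_ind.2 ?_
    rw [hcl]
    refine h3.symm.mono ?_ (subset_trans ?_ (subset_trans Set.subset_union_left (subset_acl _)))
    · refine subset_trans (elaClosure_mono (Set.union_subset ?_ hBDg)) hg.subset
      rw [hr]
      exact Set.image_subset_range _ _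
    · refine subset_trans (elaClosure_mono (Set.union_subset ?_ (Set.union_subset ?_ ?_))) hf.subset
      all_goals exact Set.image_subset_range _ _
  · rintro (j | ⟨x, hx⟩)
    · rfl
    · exact hBD x hx

end ELA

namespace ELA

open Cardinal CategoryTheory

variable {K : Type u} [ExpField K]

/-! ### Three-amalgamation. -/

section Diagram

variable {Ω : Type u} [Field Ω] [CharZero Ω]

/-- In a free amalgam of three extensions `N₁₂`, `N₁₃`, `N₂₃`, sums and products of elements of
two of the extensions that lie in the third come from the vertices. -/
theorem exists_add_and_exists_mul_of_ind {N₀ N₁ N₂ N₃ N₁₂ N₁₃ N₂₃ : Subfield Ω} [IsAlgClosed N₁]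
    [IsAlgClosed N₂] [IsAlgClosed N₃] [IsAlgClosed N₁₂] (h01 : N₀ ≤ N₁) (h02 : N₀ ≤ N₂)
    (h03 : N₀ ≤ N₃) (h112 : N₁ ≤ N₁₂) (h212 : N₂ ≤ N₁₂) (h223 : N₂ ≤ N₂₃)
    (h323 : N₃ ≤ N₂₃) (hi : Ind (N₂ : Set Ω) N₃ N₀) (hi₁ : Ind (N₁ : Set Ω) N₂₃ N₀)
    (hi₂ : Ind (N₁₂ : Set Ω) N₂₃ (N₁ ∪ N₂))
    (hi₃ : Ind (N₁₃ : Set Ω) (N₁₂ ∪ N₂₃) (N₁ ∪ N₃)) :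
    (∀ u ∈ N₁₃, ∀ v ∈ N₂₃, u + v ∈ N₁₂ → ∃ a ∈ N₁, ∃ b ∈ N₂, u + v = a + b) ∧
    (∀ u ∈ N₁₃, ∀ v ∈ N₂₃, u * v ∈ N₁₂ → ∃ a ∈ N₁, ∃ b ∈ N₂, u * v = a * b) ∧
    ∀ u ∈ N₁₃, u ∈ N₂₃ → u ∈ N₃ := by
  have hsub : ∀ {A : Set Ω} {B : Set Ω}, A ⊆ B → A ⊆ acl B := fun h => h.trans (subset_acl _)
  -- The aim is a set `Y ∪ S`, independent over `N₁₂`, over which `N₁₃` is algebraic together with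
  -- `N₁`, and `N₂₃` together with `N₂`. A basis of `N₃` over `N₀` must be part of `Y`, since `N₃`
  -- lies in both fields.
  obtain ⟨T, hT, hT₀, hT₁⟩ := exists_indepOver_basis (N₀ : Set Ω) N₃
  have hT₂ : IndepOver (N₂ : Set Ω) T :=
    (hi.symm T hT hT₀).mono_left (hsub Set.subset_union_left)
  obtain ⟨Y, hTY, hY, hY₀, hY₁⟩ :=
    exists_indepOver_extension hT₂ (hT.trans h323 : T ⊆ (N₂₃ : Set Ω))
  obtain ⟨S, hS, hS₀, hS₁⟩ := exists_indepOver_basis (N₁ ∪ N₃ : Set Ω) N₁₃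
  -- Left transitivity through `N₁ ∪ N₂`: `N₁₂` is free from `N₂₃` over it, and `N₁ ∪ N₂` is free
  -- from `N₂₃` over `N₂`.
  have h2312 : Ind (N₂₃ : Set Ω) N₁₂ N₂ := by
    refine (hi₂.trans_left ?_ (hsub Set.subset_union_right)).symm
    exact (hi₁.base (hsub h02) (hsub (Set.subset_union_of_subset_left h223 _))).acl_left.mono
      (subset_acl _) (hsub Set.subset_union_left)
  have hY₂ : IndepOver (N₁₂ : Set Ω) Y :=
    (h2312 Y hY hY₀).mono_left (hsub Set.subset_union_left)
  have hS₂ := hi₃ S hS hS₀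
  have hX : IndepOver (N₁₂ : Set Ω) (Y ∪ S) := by
    refine (indepOver_union_iff ?_).2 ⟨hY₂, hS₂.mono_left (hsub ?_)⟩
    · refine Set.disjoint_left.2 fun y hy hyS => hS₂.notMem hyS (subset_acl _ ?_)
      exact Or.inl (Or.inr (hY hy))
    · rintro x (hx | hx)
      · exact Or.inl (Or.inl hx)
      · exact Or.inl (Or.inr (hY hx))
  have h13 : (N₁₃ : Set Ω) ⊆ acl (N₁ ∪ (Y ∪ S) : Set Ω) := by
    refine hS₁.trans (acl_subset_iff.2 ?_)
    rintro x ((hx | hx) | hx)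
    · exact subset_acl _ (Or.inl hx)
    · refine acl_mono ?_ (hT₁ hx)
      exact Set.union_subset_union h01 (hTY.trans Set.subset_union_left)
    · exact subset_acl _ (Or.inr (Or.inr hx))
  have h23 : (N₂₃ : Set Ω) ⊆ acl (N₂ ∪ (Y ∪ S) : Set Ω) :=
    hY₁.trans (acl_mono (Set.union_subset_union_right _ Set.subset_union_left))
  refine ⟨fun u hu v hv huv => exists_add_of_add_mem N₁₂ hX h112 h212 (h13 hu) (h23 hv) huv,
    fun u hu v hv huv => exists_mul_of_mul_mem N₁₂ hX h112 h212 (h13 hu) (h23 hv) huv,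
    fun u hu hu' => ?_⟩
  -- The same argument through `N₁ ∪ N₃`; independence then confines the intersection to the
  -- algebraically closed base `N₃`.
  have h : Ind (N₁₃ : Set Ω) N₂₃ N₃ := by
    refine Ind.trans_left (D := N₁ ∪ N₃) ?_ ?_ (hsub Set.subset_union_right)
    · exact hi₃.mono subset_rfl (hsub (Set.subset_union_right.trans Set.subset_union_left))
    · exact (hi₁.base (hsub h03) (hsub (Set.subset_union_of_subset_left h323 _))).acl_left.mono
        (subset_acl _) (hsub Set.subset_union_left)
  have := h.inter_subset ⟨hu, hu'⟩
  rwa [acl_eq_of_isAlgClosed] at this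

end Diagram

/-- With `M₂₃` fixed in a large field, `M₁` is placed freely from it over `M`, then `M₁₂` freely
from `M₂₃` over `M₁` and `M₂`, then `M₁₃` freely from `M₁₂` and `M₂₃` over `M₁` and `M₃`. The
hypotheses `hip` and `hiq` allow the last two placements to extend the maps already chosen. -/
theorem exists_free_diagram {M M₁ M₂ M₃ M₁₂ M₁₃ M₂₃ : Type u} [Field M] [Field M₁] [Field M₂]
    [Field M₃] [Field M₁₂] [Field M₁₃] [Field M₂₃] [CharZero M₁] [CharZero M₁₂] [CharZero M₁₃]
    [CharZero M₂₃] [IsAlgClosed M] [IsAlgClosed M₁]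
    {f₁ : M →+* M₁} {f₂ : M →+* M₂} {f₃ : M →+* M₃} {p₁ : M₁ →+* M₁₂} {p₂ : M₂ →+* M₁₂}
    {q₁ : M₁ →+* M₁₃} {q₃ : M₃ →+* M₁₃} {r₂ : M₂ →+* M₂₃} {r₃ : M₃ →+* M₂₃}
    (hp : p₁.comp f₁ = p₂.comp f₂) (hq : q₁.comp f₁ = q₃.comp f₃) (hr : r₂.comp f₂ = r₃.comp f₃)
    (hip : Ind (Set.range p₁) (Set.range p₂) (Set.range (p₁.comp f₁)))
    (hiq : Ind (Set.range q₁) (Set.range q₃) (Set.range (q₁.comp f₁))) :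
    ∃ (Ω : Type u) (_ : Field Ω) (_ : CharZero Ω) (_ : IsAlgClosed Ω) (g₁₂ : M₁₂ →+* Ω)
      (g₁₃ : M₁₃ →+* Ω) (g₂₃ : M₂₃ →+* Ω),
      g₁₂.comp p₁ = g₁₃.comp q₁ ∧ g₁₂.comp p₂ = g₂₃.comp r₂ ∧ g₁₃.comp q₃ = g₂₃.comp r₃ ∧
      Ind (Set.range (g₁₂.comp p₁)) (Set.range g₂₃) (Set.range ((g₁₂.comp p₁).comp f₁)) ∧
      Ind (Set.range g₁₂) (Set.range g₂₃)
        (Set.range (g₁₂.comp p₁) ∪ Set.range (g₁₂.comp p₂)) ∧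
      Ind (Set.range g₁₃) (Set.range g₁₂ ∪ Set.range g₂₃)
        (Set.range (g₁₂.comp p₁) ∪ Set.range (g₁₃.comp q₃)) ∧
      max ℵ₀ (max #M₁₂ (max #M₁₃ #M₂₃)) < #Ω := by
  obtain ⟨Ω, _, _, g, hΩ⟩ := exists_large_algClosed M₂₃ (max ℵ₀ (max #M₁₂ (max #M₁₃ #M₂₃)))
  have : CharZero Ω := charZero_of_injective_ringHom g.injective
  have h0 : ℵ₀ < #Ω := (le_max_left _ _).trans_lt hΩ
  have h' := (le_max_right _ _).trans_lt hΩ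
  have h12 : #M₁₂ < #Ω := (le_max_left _ _).trans_lt h'
  have h13 : #M₁₃ < #Ω := ((le_max_left _ _).trans (le_max_right _ _)).trans_lt h'
  have h23 : #M₂₃ < #Ω := ((le_max_right _ _).trans (le_max_right _ _)).trans_lt h'
  have hg : #(Set.range g) < #Ω := mk_range_le.trans_lt h23
  have hsub : ∀ {A : Set Ω} {B : Set Ω}, A ⊆ B → A ⊆ acl B := fun h => h.trans (subset_acl _)
  obtain ⟨g₁, hg₁, hi₁⟩ := exists_free_embedding f₁ f₁.injective (g.comp (r₂.comp f₂))
    (g.comp (r₂.comp f₂)).injective h0 ((mk_le_of_injective p₁.injective).trans h12.le)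
    (Set.range g) hg (by rintro _ ⟨x, rfl⟩; exact ⟨_, rfl⟩)
  obtain ⟨g₁₂, h1, h2, hi₂⟩ := exists_free_extension f₁ f₂ p₁ p₂ hp g₁ (g.comp r₂) hg₁ hip
    (by
      rw [hg₁]
      refine hi₁.mono subset_rfl (hsub (subset_trans ?_ Set.subset_union_left))
      rintro _ ⟨x, rfl⟩
      exact ⟨_, rfl⟩) h0 h12 (Set.range g) hg
  have hg₁' : g₁.comp f₁ = (g.comp r₃).comp f₃ := by
    rw [hg₁, hr]
    rfl
  obtain ⟨g₁₃, h3, h4, hi₃⟩ := exists_free_extension f₁ f₃ q₁ q₃ hq g₁ (g.comp r₃) hg₁' hiq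
    (by
      rw [hg₁]
      refine hi₁.mono subset_rfl (hsub (subset_trans ?_ Set.subset_union_left))
      rintro _ ⟨x, rfl⟩
      exact ⟨_, rfl⟩) h0 h13 (Set.range g₁₂ ∪ Set.range g)
    ((mk_union_le _ _).trans_lt (add_lt_of_lt h0.le (mk_range_le.trans_lt h12) hg))
  refine ⟨Ω, ‹_›, ‹_›, ‹_›, g₁₂, g₁₃, g, ?_, ?_, ?_, ?_, ?_, ?_, hΩ⟩
  · rw [h1, h3]
  · rw [h2]
  · rw [h4]
  · rw [h1, hg₁]
    exact hi₁
  · rw [h1, h2]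
    exact hi₂
  · rw [h1, h4]
    exact hi₃

theorem threeAmalgamation_elaIndep : ThreeAmalgamation (elaIndep K) := by
  intro M M₁ M₂ M₃ M₁₂ M₁₃ M₂₃ f₁ f₂ f₃ p₁ p₂ q₁ q₃ r₂ r₃ hp hq hr hip hir hiq
  replace hip := (elaIndep_range_iff p₁ p₂ f₁ f₂ hp).1 hip
  replace hir := (elaIndep_range_iff r₂ r₃ f₂ f₃ hr).1 hir
  replace hiq := ((elaIndep_range_iff q₃ q₁ f₃ f₁ hq.symm).1 hiq).symm
  rw [← hq] at hiq
  have hp' := congrArg ELAF.ringHom hp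
  have hq' := congrArg ELAF.ringHom hq
  have hr' := congrArg ELAF.ringHom hr
  have := M.isELA.algClosed
  have := M₁.isELA.algClosed
  have := M₂.isELA.algClosed
  have := M₃.isELA.algClosed
  have := M₁₂.isELA.algClosed
  obtain ⟨Ω, _, _, _, g₁₂, g₁₃, g₂₃, h1, h2, h3, hi₁, hi₂, hi₃, hΩ⟩ :=
    exists_free_diagram hp' hq' hr' hip hiq
  have := isAlgClosed_fieldRange (g₁₂.comp (ELAF.ringHom p₁))
  have := isAlgClosed_fieldRange (g₁₂.comp (ELAF.ringHom p₂))
  have := isAlgClosed_fieldRange (g₁₃.comp (ELAF.ringHom q₃))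
  have := isAlgClosed_fieldRange g₁₂
  have e1 : ∀ x, g₁₂ (ELAF.ringHom p₁ x) = g₁₃ (ELAF.ringHom q₁ x) := DFunLike.congr_fun h1
  have e2 : ∀ x, g₁₂ (ELAF.ringHom p₂ x) = g₂₃ (ELAF.ringHom r₂ x) := DFunLike.congr_fun h2
  have e3 : ∀ x, g₁₃ (ELAF.ringHom q₃ x) = g₂₃ (ELAF.ringHom r₃ x) := DFunLike.congr_fun h3
  have e01 : ∀ x, ELAF.ringHom p₁ (ELAF.ringHom f₁ x) = ELAF.ringHom p₂ (ELAF.ringHom f₂ x) :=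
    DFunLike.congr_fun hp'
  have e02 : ∀ x, ELAF.ringHom q₁ (ELAF.ringHom f₁ x) = ELAF.ringHom q₃ (ELAF.ringHom f₃ x) :=
    DFunLike.congr_fun hq'
  obtain ⟨hadd, hmul, hinter⟩ := exists_add_and_exists_mul_of_ind
    (N₀ := ((g₁₂.comp (ELAF.ringHom p₁)).comp (ELAF.ringHom f₁)).fieldRange)
    (N₁ := (g₁₂.comp (ELAF.ringHom p₁)).fieldRange) (N₂ := (g₁₂.comp (ELAF.ringHom p₂)).fieldRange)
    (N₃ := (g₁₃.comp (ELAF.ringHom q₃)).fieldRange) (N₁₂ := g₁₂.fieldRange)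
    (N₁₃ := g₁₃.fieldRange) (N₂₃ := g₂₃.fieldRange)
    (by rintro _ ⟨x, rfl⟩; exact ⟨_, rfl⟩)
    (by rintro _ ⟨x, rfl⟩; exact ⟨ELAF.ringHom f₂ x, congrArg g₁₂ (e01 x).symm⟩)
    (by
      rintro _ ⟨x, rfl⟩
      exact ⟨ELAF.ringHom f₃ x, (congrArg g₁₃ (e02 x).symm).trans (e1 _).symm⟩)
    (by rintro _ ⟨x, rfl⟩; exact ⟨_, rfl⟩)
    (by rintro _ ⟨x, rfl⟩; exact ⟨_, rfl⟩)
    (by rintro _ ⟨x, rfl⟩; exact ⟨_, (e2 x).symm⟩)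
    (by rintro _ ⟨x, rfl⟩; exact ⟨_, (e3 x).symm⟩)
    (by
      have := (ind_image_iff g₂₃).2 hir
      rw [← Set.range_comp, ← Set.range_comp, ← Set.range_comp] at this
      simp only [RingHom.coe_fieldRange]
      convert this using 1
      · exact congrArg Set.range (funext e2)
      · exact congrArg Set.range (funext e3)
      · exact congrArg Set.range (funext fun x => (congrArg g₁₂ (e01 x)).trans (e2 _)))
    (by simpa only [RingHom.coe_fieldRange] using hi₁)
    (by simpa only [RingHom.coe_fieldRange] using hi₂)
    (by simpa only [RingHom.coe_fieldRange] using hi₃)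
  -- A vanishing sum over the three edges is a coboundary of elements `a`, `b`, `c` at the vertices:
  -- `hadd` yields `a` and `b`, and what remains lies in `N₁₃` and in `N₂₃`, hence in `N₃`.
  have hsplit : ∀ x y z, g₁₂ x + g₁₃ y + g₂₃ z = 0 → ∃ a b c,
      x = -(ELAF.ringHom p₁ a + ELAF.ringHom p₂ b) ∧ y = ELAF.ringHom q₁ a + ELAF.ringHom q₃ c ∧
        z = ELAF.ringHom r₂ b - ELAF.ringHom r₃ c := by
    intro x y z h
    have hx : g₁₃ y + g₂₃ z = g₁₂ (-x) := by
      rw [map_neg, eq_neg_iff_add_eq_zero, ← h]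
      ring
    obtain ⟨_, ⟨a, rfl⟩, _, ⟨b, rfl⟩, hab⟩ := hadd _ ⟨y, rfl⟩ _ ⟨z, rfl⟩ ⟨_, hx.symm⟩
    rw [RingHom.comp_apply, RingHom.comp_apply] at hab
    have hc : g₁₃ (y - ELAF.ringHom q₁ a) = g₂₃ (ELAF.ringHom r₂ b - z) := by
      rw [map_sub, map_sub, sub_eq_sub_iff_add_eq_add, hab, ← e1, ← e2, add_comm]
    obtain ⟨c, hc'⟩ := hinter _ ⟨_, rfl⟩ ⟨_, hc.symm⟩
    refine ⟨a, b, c, ?_, ?_, ?_⟩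
    · rw [← neg_eq_iff_eq_neg]
      exact g₁₂.injective (by rw [← hx, hab, map_add])
    · rw [← sub_eq_iff_eq_add']
      exact g₁₃.injective hc'.symm
    · rw [eq_sub_iff_add_eq, ← eq_sub_iff_add_eq']
      exact g₂₃.injective (by rw [← hc, ← e3, ← hc']; rfl)
  -- The multiplicative version; the vertex elements are written as exponentials by taking
  -- logarithms in the vertices.
  have hsplit' : ∀ x y z, g₁₂ (exp x) * g₁₃ (exp y) * g₂₃ (exp z) = 1 → ∃ a b c,
      exp x = exp (-(ELAF.ringHom p₁ a + ELAF.ringHom p₂ b)) ∧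
        exp y = exp (ELAF.ringHom q₁ a + ELAF.ringHom q₃ c) ∧
        exp z = exp (ELAF.ringHom r₂ b - ELAF.ringHom r₃ c) := by
    intro x y z h
    have hx : g₁₃ (exp y) * g₂₃ (exp z) = g₁₂ (exp (-x)) := by
      rw [exp_neg, map_inv₀, ← mul_eq_one_iff_eq_inv₀ (by simp [exp_ne_zero]), ← h]
      ring
    obtain ⟨_, ⟨a, rfl⟩, _, ⟨b, rfl⟩, hab⟩ := hmul _ ⟨_, rfl⟩ _ ⟨_, rfl⟩ ⟨_, hx.symm⟩
    rw [RingHom.comp_apply, RingHom.comp_apply] at hab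
    have h0 : g₁₃ (exp y) * g₂₃ (exp z) ≠ 0 := by simp [exp_ne_zero]
    rw [hab] at h0
    obtain ⟨a, rfl⟩ := M₁.isELA.log a fun h => h0 (by simp [h])
    obtain ⟨b, rfl⟩ := M₂.isELA.log b fun h => h0 (by simp [h])
    have hc : g₁₃ (exp (y - ELAF.ringHom q₁ a)) = g₂₃ (exp (ELAF.ringHom r₂ b - z)) := by
      rw [exp_sub, exp_sub, map_div₀, map_div₀, div_eq_div_iff (by simp [exp_ne_zero])
        (by simp [exp_ne_zero]), hab, ← ELAF.ringHom_exp, ← ELAF.ringHom_exp, ← e1, ← e2, mul_comm]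
    obtain ⟨c, hc'⟩ := hinter _ ⟨_, rfl⟩ ⟨_, hc.symm⟩
    obtain ⟨c, rfl⟩ := M₃.isELA.log c fun h => by
      rw [h, map_zero] at hc'
      exact exp_ne_zero _ (g₁₃.injective (hc'.symm.trans (map_zero _).symm))
    refine ⟨a, b, c, ?_, ?_, ?_⟩
    · rw [exp_neg, ← inv_eq_iff_eq_inv, ← exp_neg, exp_add, ← ELAF.ringHom_exp, ← ELAF.ringHom_exp]
      exact g₁₂.injective (by rw [← hx, hab, map_mul])
    · have h := g₁₃.injective hc'
      rw [ELAF.ringHom_exp] at h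
      rw [exp_add, h, ← exp_add, add_sub_cancel]
    · have h : ELAF.ringHom r₃ (exp c) = exp (ELAF.ringHom r₂ b - z) :=
        g₂₃.injective (by rw [← hc, ← e3, ← hc']; rfl)
      rw [ELAF.ringHom_exp] at h
      rw [exp_sub, h, ← exp_sub, sub_sub_cancel]
  let i : M₁₂.carrier × M₁₃.carrier × M₂₃.carrier →+ Ω :=
    g₁₂.toAddMonoidHom.coprod (g₁₃.toAddMonoidHom.coprod g₂₃.toAddMonoidHom)
  let e : M₁₂.carrier × M₁₃.carrier × M₂₃.carrier →+ Additive Ωˣ :=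
    (mapExp g₁₂).coprod ((mapExp g₁₃).coprod (mapExp g₂₃))
  have hi : ∀ x y z, i (x, y, z) = g₁₂ x + g₁₃ y + g₂₃ z := fun x y z => (add_assoc _ _ _).symm
  have he : ∀ x y z, ((e (x, y, z)).toMul : Ω) = g₁₂ (exp x) * g₁₃ (exp y) * g₂₃ (exp z) :=
    fun x y z => (mul_assoc _ _ _).symm
  have hg12 : ∀ x, ∃ p, i p = g₁₂ x ∧ ((e p).toMul : Ω) = g₁₂ (exp x) := fun x =>
    ⟨(x, 0, 0), by simp [hi], by simp [he, exp_zero]⟩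
  have hg13 : ∀ x, ∃ p, i p = g₁₃ x ∧ ((e p).toMul : Ω) = g₁₃ (exp x) := fun x =>
    ⟨(0, x, 0), by simp [hi], by simp [he, exp_zero]⟩
  have hg23 : ∀ x, ∃ p, i p = g₂₃ x ∧ ((e p).toMul : Ω) = g₂₃ (exp x) := fun x =>
    ⟨(0, 0, x), by simp [hi], by simp [he, exp_zero]⟩
  have e0 : ∀ x, g₁₂ (ELAF.ringHom (f₁ ≫ p₁) x) = g₁₃ (ELAF.ringHom (f₁ ≫ q₁) x) := fun x => e1 _
  have e0' : ∀ x, g₁₂ (ELAF.ringHom (f₁ ≫ p₁) x) = g₂₃ (ELAF.ringHom (f₂ ≫ r₂) x) := fun x =>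
    (congrArg g₁₂ (e01 x)).trans (e2 _)
  have h0 : ℵ₀ < #Ω := (le_max_left _ _).trans_lt hΩ
  have h' := (le_max_right _ _).trans_lt hΩ
  obtain ⟨N, φ, -, hN⟩ := exists_completion (M := M) i e (g₁₂.comp (ELAF.ringHom (f₁ ≫ p₁)))
    (fun x => by
      obtain ⟨p, hp⟩ := hg12 (ELAF.ringHom (f₁ ≫ p₁) x)
      exact ⟨p, hp.1, by rw [hp.2, ← ELAF.ringHom_exp]; rfl⟩)
    (by
      rintro ⟨x, y, z⟩ hxyz
      -- The joint exponential is well defined: on a coboundary each vertex contributes a factor and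
      -- its inverse.
      rw [hi] at hxyz
      obtain ⟨a, b, c, rfl, rfl, rfl⟩ := hsplit x y z hxyz
      rw [he, exp_neg, exp_add, exp_add, exp_sub, map_inv₀, map_mul, map_mul, map_div₀]
      simp only [← ELAF.ringHom_exp, e1, e2, e3]
      have ha : g₁₃ (ELAF.ringHom q₁ (exp a)) ≠ 0 := by simp [exp_ne_zero]
      have hb : g₂₃ (ELAF.ringHom r₂ (exp b)) ≠ 0 := by simp [exp_ne_zero]
      have hc : g₂₃ (ELAF.ringHom r₃ (exp c)) ≠ 0 := by simp [exp_ne_zero]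
      field_simp)
    (by
      rintro ⟨x, y, z⟩ hxyz
      rw [he] at hxyz
      obtain ⟨a, b, c, hx, hy, hz⟩ := hsplit' x y z hxyz
      -- Each coordinate differs from the coboundary by a kernel element, which comes from `M`; the
      -- coboundary itself sums to zero.
      obtain ⟨k, rfl⟩ := ELAF.exists_add_of_exp_eq (f₁ ≫ p₁) hx
      obtain ⟨l, rfl⟩ := ELAF.exists_add_of_exp_eq (f₁ ≫ q₁) hy
      obtain ⟨m, rfl⟩ := ELAF.exists_add_of_exp_eq (f₂ ≫ r₂) hz
      refine ⟨k + l + m, ?_⟩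
      rw [hi]
      simp only [map_add, map_neg, map_sub, RingHom.comp_apply, e1, e2, e3, ← e0, ← e0']
      ring)
    h0 (by
      simp only [mk_prod, lift_id]
      exact mul_lt_of_lt h0.le ((le_max_left _ _).trans_lt h') (mul_lt_of_lt h0.le
        (((le_max_left _ _).trans (le_max_right _ _)).trans_lt h')
        (((le_max_right _ _).trans (le_max_right _ _)).trans_lt h')))
  obtain ⟨k₁₂, hk₁₂⟩ := hN M₁₂ g₁₂ hg12 (by rintro _ ⟨x, rfl⟩; exact ⟨_, rfl⟩)
  obtain ⟨k₁₃, hk₁₃⟩ := hN M₁₃ g₁₃ hg13 (by rintro _ ⟨x, rfl⟩; exact ⟨_, (e0 x).symm⟩)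
  obtain ⟨k₂₃, hk₂₃⟩ := hN M₂₃ g₂₃ hg23 (by rintro _ ⟨x, rfl⟩; exact ⟨_, (e0' x).symm⟩)
  have c1 : p₁ ≫ k₁₂ = q₁ ≫ k₁₃ := ELAF.hom_ext fun x =>
    (hk₁₂ _).trans ((congrArg φ (e1 x)).trans (hk₁₃ _).symm)
  have c2 : p₂ ≫ k₁₂ = r₂ ≫ k₂₃ := ELAF.hom_ext fun x =>
    (hk₁₂ _).trans ((congrArg φ (e2 x)).trans (hk₂₃ _).symm)
  have c3 : q₃ ≫ k₁₃ = r₃ ≫ k₂₃ := ELAF.hom_ext fun x =>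
    (hk₁₃ _).trans ((congrArg φ (e3 x)).trans (hk₂₃ _).symm)
  refine ⟨N, k₁₂, k₁₃, k₂₃, c1, c2, c3, ?_⟩
  refine (elaIndep_range_iff (p₁ ≫ k₁₂) k₂₃ f₁ (f₂ ≫ r₂) ?_).2 ?_
  · rw [← Category.assoc, hp, Category.assoc, c2, Category.assoc]
  · rw [range_eq_image_of_forall (k := g₁₂.comp (ELAF.ringHom p₁))
        (l := ELAF.ringHom (p₁ ≫ k₁₂)) fun x => hk₁₂ _, range_eq_image_of_forall hk₂₃,
      range_eq_image_of_forall (k := (g₁₂.comp (ELAF.ringHom p₁)).comp (ELAF.ringHom f₁))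
        (l := ELAF.ringHom (f₁ ≫ p₁ ≫ k₁₂)) fun x => hk₁₂ _]
    exact (ind_image_iff _).2 hi₁

end ELA

namespace ELA

open Cardinal CategoryTheory

/-! ### Failure of Base-Monotonicity. -/

section LinearDisjoint

variable {Ω : Type u} [Field Ω] [CharZero Ω]

/-- By linear disjointness a relation with coefficients in `B` and `z ≠ 0` makes `u`, `1`, `a`
dependent over `C`. Since `1`, `a` are independent, `u = s + t * a`, and coefficients can be
compared. -/
theorem exists_of_add_mul_add_mul_eq_zero {A B C : Subfield Ω} [IsAlgClosed A] [IsAlgClosed C]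
    (hCA : C ≤ A) (hCB : C ≤ B) (h : Ind (A : Set Ω) B C) {a u x y z : Ω} (ha : a ∈ A) (ha' : a ∉ C)
    (hu : u ∈ A) (hx : x ∈ B) (hy : y ∈ B) (hz : z ∈ B) (hsum : x + y * a + z * u = 0)
    (hz0 : z ≠ 0) : ∃ s ∈ C, ∃ t ∈ C, x + s * z = 0 ∧ y + t * z = 0 := by
  have hpair : LinearIndependent C ![1, a] := by
    rw [LinearIndependent.pair_iff]
    intro s t hst
    have hst' : (s : Ω) + t * a = 0 := by simpa [Subfield.smul_def] using hst
    have ht : t = 0 := by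
      by_contra ht
      have ht' : (t : Ω) ≠ 0 := fun h => ht (Subtype.ext h)
      refine ha' ?_
      rw [show a = ((-s / t : C) : Ω) by
        push_cast
        field_simp
        linear_combination hst']
      exact (-s / t : C).2
    refine ⟨Subtype.ext ?_, ht⟩
    simpa [ht] using hst'
  by_cases hlin : LinearIndependent C ![u, 1, a]
  · refine absurd (eq_zero_of_sum_mul_eq_zero hCA h (b := ![z, x, y]) ?_ hlin ?_ ?_ 0) hz0
    · intro i
      fin_cases i
      exacts [hu, A.one_mem, ha]
    · intro i
      fin_cases i
      exacts [hz, hx, hy]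
    · simp only [Fin.sum_univ_three, Matrix.cons_val]
      linear_combination hsum
  · rw [Matrix.vecCons, linearIndependent_finCons, not_and, not_not] at hlin
    obtain ⟨s, t, hst⟩ : ∃ s t : C, s • (1 : Ω) + t • a = u := by
      have := hlin hpair
      rwa [Matrix.range_cons, Matrix.range_cons, Matrix.range_empty, Set.union_empty,
        Set.singleton_union, Submodule.mem_span_pair] at this
    rw [Subfield.smul_def, Subfield.smul_def, smul_eq_mul, smul_eq_mul, mul_one] at hst
    have h2 := eq_zero_of_sum_mul_eq_zero hCA h (b := ![x + s * z, y + t * z]) (a := ![1, a])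
      ?_ hpair ?_ ?_
    · exact ⟨s, s.2, t, t.2, h2 0, h2 1⟩
    · intro i
      fin_cases i
      exacts [A.one_mem, ha]
    · intro i
      fin_cases i
      exacts [B.add_mem hx (B.mul_mem (hCB s.2) hz), B.add_mem hy (B.mul_mem (hCB t.2) hz)]
    · simp only [Fin.sum_univ_two, Matrix.cons_val]
      linear_combination hsum + z * hst

end LinearDisjoint

/-- A compatible system of roots of `u`, which exists because `Ωˣ` is divisible. It is needed to
prescribe one exponential value, as partial exponentials live on rational vector spaces. -/
theorem exists_ratHom {Ω : Type u} [Field Ω] [IsAlgClosed Ω] (u : Additive Ωˣ) :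
    ∃ h : ℚ →+ Additive Ωˣ, h 1 = u := by
  let _ : DivisibleBy (Additive Ωˣ) ℕ := divisibleByOfSMulRightSurj _ _ nsmul_units_surjective
  let _ : DivisibleBy (Additive Ωˣ) ℤ := AddGroup.divisibleByIntOfDivisibleByNat _
  obtain ⟨h, hh⟩ := (Module.Baer.of_divisible (Additive Ωˣ)).extension_property_addMonoidHom
    (Int.castAddHom ℚ) Int.cast_injective (zmultiplesHom _ u)
  refine ⟨h, ?_⟩
  have := DFunLike.congr_fun hh 1
  simpa using this

variable {K : Type u} [ExpField K]

/-- A kernel type, as an object. -/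
def IsKernelType.obj (hK : IsKernelType K) : ELAF K where
  carrier := K
  isELA := hK.isELA
  kernelType := ⟨(KPEmb.id K).toExpEmb, by
    rw [hK.closure_empty]
    exact Set.range_id⟩

/-- The exponential of `K` is itself a partial exponential on any large algebraically closed field
containing `K`. -/
theorem IsKernelType.exists_large_extension (hK : IsKernelType K) :
    ∃ (F : ELAF K) (_ : hK.obj ⟶ F), max ℵ₀ #K < #F.carrier := by
  obtain ⟨Ω, _, _, g, hΩ⟩ := exists_large_algClosed K (max ℵ₀ #K)
  have : CharZero Ω := charZero_of_injective_ringHom g.injective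
  have hg : ∀ x, ∃ p, g.toAddMonoidHom p = g x ∧ ((mapExp g p).toMul : Ω) = g (exp x) :=
    fun x => ⟨x, rfl, rfl⟩
  obtain ⟨N, φ, -, hN⟩ := exists_completion (M := hK.obj) g.toAddMonoidHom (mapExp g) g hg
    (fun p hp => by
      have : p = 0 := g.injective (hp.trans (map_zero g).symm)
      rw [this, map_zero]
      rfl)
    (fun p _ => ⟨p, rfl⟩) ((le_max_left _ _).trans_lt hΩ) ((le_max_right _ _).trans_lt hΩ)
  obtain ⟨f, -⟩ := hN hK.obj g hg subset_rfl
  exact ⟨N, f, hΩ.trans_eq (mk_congr φ.toEquiv)⟩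

theorem IsKernelType.elaClosure_empty_eq (hK : IsKernelType K) {N : ELAF K} (f : hK.obj ⟶ N) :
    (elaClosure (∅ : Set N.carrier) : Set N.carrier) = Set.range (ELAF.ringHom f) := by
  have h := KPEmb.image_elaClosure f hK.isELA N.isELA ∅
  rw [Set.image_empty] at h
  refine h.symm.trans ?_
  rw [← Set.image_univ]
  exact congrArg _ (congrArg SetLike.coe hK.closure_empty)

/-- In an independent amalgam of two copies of a large object one can let the exponential of a
product of elements from the two sides be their sum. -/
theorem IsKernelType.exists_exp_mul_eq (hK : IsKernelType K) :
    ∃ (F N : ELAF K) (k : hK.obj ⟶ F) (f f' : F ⟶ N) (a b c : F.carrier), k ≫ f = k ≫ f' ∧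
      Ind (Set.range (ELAF.ringHom f)) (Set.range (ELAF.ringHom f'))
        (Set.range (ELAF.ringHom (k ≫ f))) ∧ b ∉ elaClosure {c} ∧
      exp (ELAF.ringHom f a * ELAF.ringHom f' c) = ELAF.ringHom f a + ELAF.ringHom f' b := by
  obtain ⟨F, k, hF⟩ := hK.exists_large_extension
  have hmk : ∀ {S : Set F.carrier}, #S ≤ max ℵ₀ #K → ∃ x, x ∉ S := fun {S} hS => by
    by_contra! h
    rw [Set.eq_univ_of_forall h, mk_univ] at hS
    exact absurd hF (not_lt.2 hS)
  have hrange : #(Set.range (ELAF.ringHom k)) ≤ max ℵ₀ #K := mk_range_le.trans (le_max_right _ _)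
  -- By size, `a` is chosen outside `K` and `b` outside the closure of `a`. The element `a` also
  -- serves as `c`.
  obtain ⟨a, ha⟩ := hmk hrange
  obtain ⟨b, hb⟩ := hmk (S := elaClosure ({a} : Set F.carrier)) (by
    refine (mk_elaClosure_le F.isELA _).trans (max_le ?_ ?_)
    · rw [mk_singleton]
      exact one_lt_aleph0.le.trans (le_max_left _ _)
    · rw [F.mk_ker]
      exact (mk_subtype_le _).trans (le_max_right _ _))
  have hb' : b ∉ Set.range (ELAF.ringHom k) := fun h => by
    rw [← hK.elaClosure_empty_eq k] at h
    exact hb (elaClosure_mono (Set.empty_subset _) h)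
  obtain ⟨Ω, _, _, _, g, g', hcg, hind, hΩ⟩ :=
    exists_indep_fieldAmalgam (ELAF.ringHom k) (ELAF.ringHom k) 0
  have hcg' : ∀ m, g (ELAF.ringHom k m) = g' (ELAF.ringHom k m) := DFunLike.congr_fun hcg
  have h0 : ℵ₀ < #Ω := (le_max_left _ _).trans_lt hΩ
  have h2 : #F.carrier < #Ω :=
    ((le_max_left _ _).trans ((le_max_right _ _).trans (le_max_right _ _))).trans_lt hΩ
  have := hK.obj.isELA.algClosed
  have := F.isELA.algClosed
  have hrel : ∀ x y z u, g' x + g' y * g a + g' z * g u = 0 → z ≠ 0 →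
      ∃ s t, x + ELAF.ringHom k s * z = 0 ∧ y + ELAF.ringHom k t * z = 0 := by
    intro x y z u hsum hz
    have := isAlgClosed_fieldRange g
    have := isAlgClosed_fieldRange (g.comp (ELAF.ringHom k))
    obtain ⟨_, ⟨s, rfl⟩, _, ⟨t, rfl⟩, h1, h2⟩ := exists_of_add_mul_add_mul_eq_zero
      (A := g.fieldRange) (B := g'.fieldRange) (C := (g.comp (ELAF.ringHom k)).fieldRange)
      (by rintro _ ⟨x, rfl⟩; exact ⟨_, rfl⟩)
      (by rintro _ ⟨x, rfl⟩; exact ⟨_, (hcg' x).symm⟩)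
      (by simpa only [RingHom.coe_fieldRange] using hind) ⟨a, rfl⟩
      (by
        rintro ⟨m, hm⟩
        exact ha ⟨m, g.injective hm⟩)
      ⟨u, rfl⟩ ⟨x, rfl⟩ ⟨y, rfl⟩ ⟨z, rfl⟩ hsum (by simpa using hz)
    rw [RingHom.comp_apply, hcg', ← map_mul, ← map_add, map_eq_zero] at h1 h2
    exact ⟨s, t, h1, h2⟩
  -- The product of the two copies of `a` is a new argument for the exponential: otherwise linear
  -- disjointness would put `a` into `K`.
  have hadd : ∀ u v, g a * g' a ≠ g u + g' v := fun u v huv => by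
    obtain ⟨s, t, -, h⟩ := hrel (-v) a (-1) u
      (by rw [map_neg, map_neg, map_one]; linear_combination huv) (by simp)
    exact ha ⟨t, by linear_combination -h⟩
  -- The value to be prescribed is new as well: otherwise `a` or `b` would lie in `K`.
  have hmul : ∀ u v, g a + g' b ≠ g u * g' v := fun u v huv => by
    have hv : v ≠ 0 := by
      rintro rfl
      rw [map_zero, mul_zero, add_eq_zero_iff_eq_neg, ← map_neg] at huv
      obtain ⟨m, hm, -⟩ := hind.exists_ringHom_eq hcg' huv
      exact ha ⟨m, hm⟩
    obtain ⟨s, t, hs, ht⟩ := hrel b 1 (-v) u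
      (by rw [map_neg, map_one]; linear_combination huv) (neg_ne_zero.2 hv)
    have htv : ELAF.ringHom k t * v = 1 := by linear_combination -ht
    refine hb' ⟨s / t, ?_⟩
    have ht0 : ELAF.ringHom k t ≠ 0 := left_ne_zero_of_mul_eq_one htv
    rw [map_div₀, div_eq_iff ht0]
    linear_combination (-ELAF.ringHom k t) * hs - ELAF.ringHom k s * htv
  have hab : g a + g' b ≠ 0 := fun h => hmul 0 0 (by simpa using h)
  obtain ⟨h, hh⟩ := exists_ratHom (Additive.ofMul (Units.mk0 _ hab))
  -- The partial exponential of the free amalgam gets one more rational dimension, spanned by `g a *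
  -- g' a`, whose exponential is to be `g a + g' b`.
  let i : F.carrier × F.carrier × ℚ →+ Ω := g.toAddMonoidHom.coprod
    (g'.toAddMonoidHom.coprod ((AddMonoidHom.mulRight (g a * g' a)).comp
      (Rat.castHom Ω).toAddMonoidHom))
  let e : F.carrier × F.carrier × ℚ →+ Additive Ωˣ := (mapExp g).coprod ((mapExp g').coprod h)
  have hi : ∀ x y q, i (x, y, q) = g x + g' y + q * (g a * g' a) := fun x y z =>
    (add_assoc _ _ _).symm
  have he : ∀ x y q, e (x, y, q) = mapExp g x + mapExp g' y + h q := fun x y z =>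
    (add_assoc _ _ _).symm
  have he' : ∀ x y, ((e (x, y, 0)).toMul : Ω) = g (exp x) * g' (exp y) := fun x y => by
    rw [he, map_zero, add_zero]
    rfl
  have hg : ∀ x, ∃ p, i p = g x ∧ ((e p).toMul : Ω) = g (exp x) := fun x =>
    ⟨(x, 0, 0), by simp [hi], by simp [he', exp_zero]⟩
  have hg' : ∀ x, ∃ p, i p = g' x ∧ ((e p).toMul : Ω) = g' (exp x) := fun x =>
    ⟨(0, x, 0), by simp [hi], by simp [he', exp_zero]⟩
  obtain ⟨N, φ, hφ, hN⟩ := exists_completion (M := hK.obj) i e (g.comp (ELAF.ringHom k))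
    (fun x => by
      obtain ⟨p, hp⟩ := hg (ELAF.ringHom k x)
      exact ⟨p, hp.1, by rw [hp.2, ← ELAF.ringHom_exp]; rfl⟩)
    (by
      rintro ⟨x, y, q⟩ hp
      rw [hi] at hp
      have hq : q = 0 := by
        by_contra hq
        have hq' : (q : Ω) ≠ 0 := Rat.cast_ne_zero.2 hq
        refine hadd (-x / q) (-y / q) ?_
        simp only [map_div₀, map_neg, map_ratCast]
        field_simp
        linear_combination hp
      subst hq
      rw [he']
      exact hind.exp_mul_exp_eq_one hcg' (by simpa using hp))
    (by
      rintro ⟨x, y, q⟩ hp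
      have hq : q = 0 := by
        by_contra hq
        -- Scaling the last coordinate to `1` turns the trivial value into a root of unity, which
        -- lies in `g(F)`. This would write `g a + g' b` as a product excluded by `hmul`.
        have hnum : q.num • e (q⁻¹ • (x, y, q)) = 0 := by
          have h1 : q.num • (q⁻¹ • (x, y, q)) = (q.den : ℤ) • (x, y, q) := by
            rw [← Int.cast_smul_eq_zsmul ℚ, ← Int.cast_smul_eq_zsmul ℚ, smul_smul]
            congr 1
            rw [← div_eq_mul_inv, div_eq_iff hq]
            push_cast
            exact (Rat.den_mul_eq_num q).symm
          rw [← map_zsmul, h1, map_zsmul, eq_zero_iff_coe_eq_one.2 hp, smul_zero]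
        obtain ⟨ρ, hρ⟩ := exists_eq_of_zsmul_eq_zero g (Rat.num_ne_zero.2 hq) hnum
        rw [Prod.smul_mk, Prod.smul_mk, smul_eq_mul, inv_mul_cancel₀ hq, he, hh] at hρ
        have hρ' : g ρ = g (exp (q⁻¹ • x)) * g' (exp (q⁻¹ • y)) * (g a + g' b) := hρ
        refine hmul (ρ / exp (q⁻¹ • x)) (exp (q⁻¹ • y))⁻¹ ?_
        have e1 : g (exp (q⁻¹ • x)) ≠ 0 := by simp [exp_ne_zero]
        have e2 : g' (exp (q⁻¹ • y)) ≠ 0 := by simp [exp_ne_zero]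
        rw [map_div₀, map_inv₀, hρ']
        generalize g (exp (q⁻¹ • x)) = X at e1
        generalize g' (exp (q⁻¹ • y)) = Y at e2
        field_simp
      subst hq
      rw [he'] at hp
      simpa [hi] using hind.add_mem_range hcg' hp)
    h0 (by
      simp only [mk_prod, lift_id, lift_uzero]
      refine mul_lt_of_lt h0.le h2 (mul_lt_of_lt h0.le h2 (lt_of_le_of_lt ?_ h0))
      simp)
  obtain ⟨f, hf⟩ := hN F g hg (by rintro _ ⟨x, rfl⟩; exact ⟨_, rfl⟩)
  obtain ⟨f', hf'⟩ := hN F g' hg' (by rintro _ ⟨x, rfl⟩; exact ⟨_, (hcg' x).symm⟩)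
  refine ⟨F, N, k, f, f', a, b, a, ?_, ?_, hb, ?_⟩
  · exact ELAF.hom_ext fun x => (hf _).trans ((congrArg φ (hcg' x)).trans (hf' _).symm)
  · rw [range_eq_image_of_forall hf, range_eq_image_of_forall hf',
      range_eq_image_of_forall (k := g.comp (ELAF.ringHom k)) (l := ELAF.ringHom (k ≫ f))
        fun x => hf _]
    exact (ind_image_iff _).2 hind
  · have h1 := hφ (0, 0, 1)
    rw [hi, he, hh] at h1
    simp only [map_zero, zero_add, Rat.cast_one, one_mul] at h1
    rw [hf, hf', hf', ← map_mul, h1, ← map_add]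
    rfl

theorem not_baseMonotonicity_elaIndep (hK : IsKernelType K) :
    ¬ BaseMonotonicity (elaIndep K) := by
  obtain ⟨F, N, k, f, f', a, b, c, hkf, hind, hb, hexp⟩ := hK.exists_exp_mul_eq
  intro hBM
  have hcl := hK.elaClosure_empty_eq (k ≫ f)
  have hf := KPEmb.elaClosure_range f F.isELA N.isELA
  have hf' := KPEmb.elaClosure_range f' F.isELA N.isELA
  let α : N.carrier := ELAF.ringHom f a
  let β : N.carrier := ELAF.ringHom f' b
  let γ : N.carrier := ELAF.ringHom f' c
  have h1 : ElaIndep {α} {β, γ} ∅ := by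
    refine elaIndep_iff_ind.2 ?_
    rw [Set.union_empty, Set.union_empty, hcl]
    refine hind.mono (subset_trans (elaClosure_mono ?_) hf.subset) (subset_trans
      (subset_trans (elaClosure_mono ?_) hf'.subset)
      (subset_trans Set.subset_union_left (subset_acl _)))
    · exact Set.singleton_subset_iff.2 ⟨a, rfl⟩
    · exact Set.insert_subset ⟨b, rfl⟩ (Set.singleton_subset_iff.2 ⟨c, rfl⟩)
  have h2 : ElaIndep {α} {β, γ} {γ} :=
    hBM N {α} {β, γ} ∅ {γ} h1 (Set.empty_subset _) (Set.subset_insert _ _)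
  have h3 := elaIndep_iff_ind.1 h2
  have hα : α ∈ elaClosure ({α} ∪ {γ} : Set N.carrier) := subset_elaClosure _ (Or.inl rfl)
  have hγ : γ ∈ elaClosure ({α} ∪ {γ} : Set N.carrier) := subset_elaClosure _ (Or.inr rfl)
  -- `β = exp (α * γ) - α`. Independence over `γ` would then force `β` into the closure of `γ`,
  -- against the choice of `b`.
  have hβ : β ∈ elaClosure ({α} ∪ {γ} : Set N.carrier) := by
    have h4 := (isELASubfield_elaClosure N.isELA ({α} ∪ {γ})).exp_mem _
      (Subfield.mul_mem _ hα hγ)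
    rw [hexp] at h4
    simpa [α] using Subfield.sub_mem _ h4 hα
  have h5 := h3.inter_subset ⟨hβ, subset_elaClosure _ (Or.inl (Or.inl rfl))⟩
  rw [acl_elaClosure N.isELA] at h5
  have h6 := KPEmb.image_elaClosure f' F.isELA N.isELA {c}
  rw [Set.image_singleton] at h6
  have h7 : β ∈ (elaClosure {γ} : Set N.carrier) := h5
  erw [← h6] at h7
  obtain ⟨b', hb', hbb'⟩ := h7
  exact hb (KPEmb.injective f' hbb' ▸ hb')

end ELA

theorem mainTheorem2 (K : Type u) [ELA.ExpField K] (hK : ELA.IsKernelType K) :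
    ELA.IsAEC (ELA.ELAF K) ELA.expRing ∧ ELA.HasAmalgamation (ELA.ELAF K) ∧
    ELA.IsNSOP1Like (ELA.elaIndep K) ∧
    ELA.ClubLocalCharacter (ELA.elaIndep K) (Order.succ (Cardinal.mk (ELA.ker K))) ∧
    ¬ ELA.BaseMonotonicity (ELA.elaIndep K) ∧
    ¬ ELA.IsSimple (ELA.elaIndep K) :=
  have hclub := ELA.clubLocalCharacter_elaIndep hK.isELA
  have hbm := ELA.not_baseMonotonicity_elaIndep hK
  ⟨ELA.isAEC hK.isELA, ELA.hasAmalgamation,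
    ⟨ELA.isIndependenceRelation_elaIndep, ⟨_, hclub⟩, ELA.extension_elaIndep,
      ELA.threeAmalgamation_elaIndep⟩, hclub, hbm, fun h => hbm h.base_monotonicity⟩
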